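/- Let $m\ge 0$ be an integer and $\alpha,\beta$ real numbers with $\beta\neq 0$; put $\xi=-\alpha/\beta$, $\eta=1/\beta$ and $\Lambda=\langle 1,\alpha+i\beta\rangle$, $\Lambda^*=\langle 1,\,-\tfrac{\alpha}{\beta}+\tfrac{i}{\beta}\rangle=\{a+b(\xi+i\eta):a,b\in\mathbb Z\}\subset\mathbb C$. Suppose that $\xi,\eta$ are algebraically independent over $\mathbb Q$ and that the pair $(\xi,\eta)$ is strongly Diophantine: for every $n\in\mathbb N$ there are $K_1\in\mathbb N$ and $c>0$ such that $|p(\xi,\eta)|\ge c\,h(p)^{-K_1}$ for every integer polynomial $p(x,y)$ of degree at most $n$ with $p(\xi,\eta)\ne0$, where $h(p)$ is the largest absolute value of a coefficient of $p$. Fix a smooth $\omega\ge0$ on $\mathbb R$ with $\int\omega=1$ such that, for every $A>0$, $|\omega(t)|\ll_A(1+|t|)^{-A}$ and $|\hat\omega(t)|\ll_A(1+|t|)^{-A}$, and a smooth even integrable $\psi:\mathbb R\to\mathbb R$ with $\int\psi=1$ whose Fourier transform $\hat\psi$ has compact support (here $\hat f(y)=\int f(x)e^{-2\pi i xy}\,dx$).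 For $T,L,M>0$ write $\langle f\rangle_T=\frac1T\int_{-\infty}^{\infty} f(t)\,\omega(t/T)\,dt$ and define $$\mathcal M_{\Lambda,m}=\Bigg\langle\bigg(\frac{2}{\beta\pi}\sum_{k\in\Lambda^*\setminus\{0\}}\frac{\sin(\pi|k|/L)}{|k|^{3/2}}\,\sin\Big(2\pi\big(t+\tfrac1{2L}\big)|k|+\tfrac{\pi}{4}\Big)\,\hat\psi\Big(\frac{|k|}{\sqrt M}\Big)\bigg)^{m}\Bigg\rangle_T,$$ $$\sigma=\bigg(\frac{4}{\beta^2\pi^2}\sum_{k\in\Lambda^*\setminus\{0\}}\frac{\sin^2(\pi|k|/L)}{|k|^{3}}\,\hat\psi\Big(\frac{|k|}{\sqrt M}\Big)^2\bigg)^{1/2}.$$ Call a positive integer $K$ *admissible for $m$* if there is $c>0$ such that, for all $X\ge1$, all signs $\epsilon_j=\pm1$ and all integers $a_j,b_j$ ($1\le j\le m$) for which every $z_j=a_j^2+2a_jb_j\xi+b_j^2(\xi^2+\eta^2)$ is at most $X$, either $\sum_{j=1}^m\epsilon_j\sqrt{z_j}=0$ or $\big|\sum_{j=1}^m\epsilon_j\sqrt{z_j}\big|\ge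 cX^{-K}$. Then an integer admissible for $m$ exists. Moreover, let $K_m$ be any integer admissible for $m$, let $\delta>0$, and let $L=L(T)$ and $M=M(T)$ be real functions, with $M(T)>0$ for all large $T$, such that, as $T\to\infty$, $M=O\big(T^{(1-\delta)/K_m}\big)$, $L\to\infty$ and $L/\sqrt M\to0$. Then, as $T\to\infty$, $$\frac{\mathcal M_{\Lambda,m}}{\sigma^m}=\begin{cases}\dfrac{m!}{2^{m/2}\,(m/2)!}+O\Big(\dfrac{\log L}{L}\Big),& m\text{ even},\\[2ex] O\Big(\dfrac{\log L}{L}\Big),& m\text{ odd}.\end{cases}$$ -/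

import Mathlib

open Filter Asymptotics MeasureTheory
open scoped Topology Nat FourierTransform

noncomputable section

/-- The height of an integer polynomial: the largest absolute value of a coefficient. -/
def polyHeight (p : MvPolynomial (Fin 2) ℤ) : ℕ :=
  p.support.sup fun s => (p.coeff s).natAbs

/-- The pair `(ξ, η)` is strongly Diophantine: for every `n` there are `K₁` and `c > 0` such that
`|p(ξ, η)| ≥ c / h(p) ^ K₁` for every integer polynomial `p` in two variables of degree at most `n`
that does not vanish at `(ξ, η)`. -/
def StronglyDiophantine (ξ η : ℝ) : Prop :=
  ∀ n : ℕ, ∃ K₁ : ℕ, ∃ c : ℝ, 0 < c ∧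
    ∀ p : MvPolynomial (Fin 2) ℤ, p.totalDegree ≤ n →
      MvPolynomial.aeval ![ξ, η] p ≠ 0 →
        c / (polyHeight p : ℝ) ^ K₁ ≤ |MvPolynomial.aeval ![ξ, η] p|

/-- Signed sums of `m` square roots of `z = a² + 2abξ + b²ξ² + b²η²` (with integers `a`, `b`), with
all `z ≤ X`, are either zero or `≫ X ^ (-K)`. The bound is polynomial in `X`, so `z ≤ X` and
`z ≪ X` give the same condition on `K`. -/
def SqrtSumsSeparated (ξ η : ℝ) (m K : ℕ) : Prop :=
  ∃ c : ℝ, 0 < c ∧ ∀ X : ℝ, 1 ≤ X → ∀ (a b : Fin m → ℤ) (ε z : Fin m → ℝ),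
    (∀ j, ε j = 1 ∨ ε j = -1) →
    (∀ j, z j = (a j : ℝ) ^ 2 + (b j : ℝ) ^ 2 * ξ ^ 2 + 2 * a j * b j * ξ
      + (b j : ℝ) ^ 2 * η ^ 2) →
    (∀ j, z j ≤ X) →
    ∑ j, ε j * √(z j) ≠ 0 →
      c / X ^ K ≤ |∑ j, ε j * √(z j)|

/-- The averaging weight: smooth, nonnegative, of total mass one, and rapidly decaying together
with its Fourier transform. -/
structure IsAveragingWeight (ω : ℝ → ℝ) : Prop where
  smooth : ContDiff ℝ (⊤ : ℕ∞) ω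
  nonneg : ∀ t, 0 ≤ ω t
  integrable : Integrable ω
  mass_one : ∫ t, ω t = 1
  decay : ∀ A : ℝ, 0 < A → ∃ C : ℝ, ∀ t, |ω t| ≤ C / (1 + |t|) ^ A
  fourier_decay : ∀ A : ℝ, 0 < A → ∃ C : ℝ, ∀ t,
    ‖𝓕 (fun x : ℝ => (ω x : ℂ)) t‖ ≤ C / (1 + |t|) ^ A

/-- The smoothing kernel: a smooth even function of total mass one on the real line whose Fourier
transform has compact support. -/
structure IsSmoothingKernel (ψ : ℝ → ℝ) : Prop where
  smooth : ContDiff ℝ (⊤ : ℕ∞) ψ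
  even : ∀ x, ψ (-x) = ψ x
  integrable : Integrable ψ
  mass_one : ∫ x, ψ x = 1
  fourier_compact : HasCompactSupport (𝓕 (fun x : ℝ => (ψ x : ℂ)))

/-- The Fourier transform `ψ̂(r) = ∫ ψ(x) exp(-2πixr) dx` of a real even function, as a real number
(its imaginary part vanishes because `ψ` is even). -/
def kernelHat (ψ : ℝ → ℝ) (r : ℝ) : ℝ := (𝓕 (fun x : ℝ => (ψ x : ℂ)) r).re

/-- The lattice `Λ* = ⟨1, -α/β + i/β⟩` in the complex plane. -/
def latticeStar (α β : ℝ) : Submodule ℤ ℂ :=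
  Submodule.span ℤ {1, ((-α / β : ℝ) : ℂ) + ((1 / β : ℝ) : ℂ) * Complex.I}

/-- `⟨f⟩_T = (1/T) ∫ f(t) ω(t/T) dt`. -/
def weightedMean (ω : ℝ → ℝ) (T : ℝ) (f : ℝ → ℝ) : ℝ :=
  1 / T * ∫ t, f t * ω (t / T)

/-- The trigonometric sum over `Λ* \ {0}` (a finite sum for `M > 0`, since `ψ̂` has compact
support) whose moments are taken. -/
def smoothAnnulusSum (α β : ℝ) (ψ : ℝ → ℝ) (L M t : ℝ) : ℝ :=
  2 / (β * Real.pi) * ∑' k : {k : ℂ // k ∈ latticeStar α β ∧ k ≠ 0},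
    Real.sin (Real.pi * ‖(k : ℂ)‖ / L) / ‖(k : ℂ)‖ ^ (3 / 2 : ℝ)
      * Real.sin (2 * Real.pi * (t + 1 / (2 * L)) * ‖(k : ℂ)‖ + Real.pi / 4)
      * kernelHat ψ (‖(k : ℂ)‖ / √M)

/-- The `m`-th moment `M_{Λ,m}`. -/
def smoothMoment (α β : ℝ) (ω ψ : ℝ → ℝ) (m : ℕ) (T L M : ℝ) : ℝ :=
  weightedMean ω T fun t => smoothAnnulusSum α β ψ L M t ^ m

/-- The variance `σ²`. -/
def smoothVariance (α β : ℝ) (ψ : ℝ → ℝ) (L M : ℝ) : ℝ :=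
  4 / (β ^ 2 * Real.pi ^ 2) * ∑' k : {k : ℂ // k ∈ latticeStar α β ∧ k ≠ 0},
    Real.sin (Real.pi * ‖(k : ℂ)‖ / L) ^ 2 / ‖(k : ℂ)‖ ^ 3
      * kernelHat ψ (‖(k : ℂ)‖ / √M) ^ 2

end

/-! Every nonzero `k ∈ Λ*` is uniquely `n • D` with `n ≠ 0` an integer and `D` a primitive vector in
a fixed half plane (`primMultiple_bijective`). Hence `√L` times the sum over `Λ*` is a trigonometric
polynomial `∑_D X_D`, where `X_D` has frequencies `n|D|`. The proof treats the `X_D` as independent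
centred random variables and shows that the moments of their sum are nearly Gaussian.

The expectation is the constant term of a trigonometric polynomial. Expanding the `m`-th power under
`⟨·⟩_T`, a frequency `x` is weighted by `ω̂(-xT)`. For `x = 0` this is `1`. For `x ≠ 0`,
admissibility of `K` gives `|x| ≫ M^(-K)`, so `|x|T ≫ T^δ` and the rapid decay of `ω̂` makes all
these terms together `O(1/T)` (`norm_weightedMean_pow_sub_constTerm_le`, `le_abs_sum_freq`).

Independence holds because the norms `|D|` are linearly independent over `ℤ`
(`linearIndependent_latNorm`). This and the existence of `K` rest on one device: the product over
all signs of `∑ ± c_j |v_j|` contains square roots to even powers only, so it is an integer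
polynomial in `ξ, η` (`exists_poly_prod_signed_sum`). It is not the zero polynomial when the `v_j`
with `c_j ≠ 0` are pairwise non-proportional (`exists_prod_signed_sum_ne_zero`), so algebraic
independence makes it nonzero at `(ξ, η)`. The Diophantine hypothesis then bounds it below, while
all factors are trivially bounded above (`exists_lower_bound_sum_latNorm`).

For independent variables the moments of the sum satisfy the Gaussian recursion `μ_{q+2} = (q+1) V
μ_q` up to errors controlled by the largest variance and the sum of the higher moments
(`moment_recursion`, `moment_close_gaussMoment`). Here the total variance is `Lσ² = O(1)`, and both
error quantities are `O(log L / L)` (`classVariance_le`, `norm_constTerm_multSum_pow_le`,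
`sum_inv_sq_mul_add_le`). Finally `Lσ²` is bounded below (`exists_le_mul_smoothVariance`), because
`L/√M → 0` leaves about `L²` lattice points on which neither the sine nor `ψ̂` is small, so dividing
by `(Lσ²)^(m/2)` is harmless. -/

noncomputable section

/-! ### Products of linear forms over all choices of signs -/

/-- The number of indices mapped to `j`. -/
def fiberCard {κ ι : Type*} [Fintype κ] [DecidableEq ι] (χ : κ → ι) (j : ι) : ℕ :=
  (Finset.univ.filter fun s => χ s = j).card

lemma prod_comp_eq_prod_pow_fiberCard {κ ι M : Type*} [Fintype κ] [Fintype ι] [DecidableEq ι]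
    [CommMonoid M] (χ : κ → ι) (f : ι → M) :
    ∏ s, f (χ s) = ∏ j, f j ^ fiberCard χ j := by
  rw [← Finset.prod_fiberwise_of_maps_to (s := Finset.univ) (t := Finset.univ) (g := χ)
    (fun _ _ => Finset.mem_univ _)]
  refine Finset.prod_congr rfl fun j _ => ?_
  rw [fiberCard, ← Finset.prod_const]
  exact Finset.prod_congr rfl fun s hs => by rw [(Finset.mem_filter.1 hs).2]

lemma sum_fiberCard {κ ι : Type*} [Fintype κ] [Fintype ι] [DecidableEq ι] (χ : κ → ι) :
    ∑ j, fiberCard χ j = Fintype.card κ := by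
  rw [← Finset.card_univ]
  exact (Finset.card_eq_sum_card_fiberwise fun _ _ => Finset.mem_coe.2 (Finset.mem_univ _)).symm

lemma sum_units_int_pow (n : ℕ) :
    ∑ s : ℤˣ, (((s : ℤ) : ℝ)) ^ n = if Even n then 2 else 0 := by
  have : (Finset.univ : Finset ℤˣ) = {1, -1} := rfl
  rw [this, Finset.sum_pair (by decide)]
  split_ifs with h
  · simp [h.neg_pow]; norm_num
  · simp [(Nat.not_even_iff_odd.1 h).neg_pow]

/-- The product of all signed sums only involves even powers. -/
lemma prod_signed_sum {ι : Type*} [Fintype ι] [DecidableEq ι] (y : ι → ℝ) :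
    ∏ σ : ι → ℤˣ, ∑ j, ((σ j : ℤ) : ℝ) * y j =
      ∑ χ ∈ Finset.univ.filter fun χ : (ι → ℤˣ) → ι => ∀ j, Even (fiberCard χ j),
        ((∏ σ : ι → ℤˣ, (σ (χ σ) : ℤ) : ℤ) : ℝ) * ∏ j, (y j ^ 2) ^ (fiberCard χ j / 2) := by
  -- Translating `σ` by `τ` permutes the factors, so the product is unchanged while the monomial of
  -- `χ` acquires the sign `∏ τ_j ^ fiberCard χ j`.
  have key : ∀ τ : ι → ℤˣ, ∏ σ : ι → ℤˣ, ∑ j, ((σ j : ℤ) : ℝ) * y j =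
      ∑ χ : (ι → ℤˣ) → ι, (∏ j, ((τ j : ℤ) : ℝ) ^ fiberCard χ j) *
        (((∏ σ : ι → ℤˣ, (σ (χ σ) : ℤ) : ℤ) : ℝ) * ∏ j, y j ^ fiberCard χ j) := by
    intro τ
    rw [← Fintype.prod_equiv (Equiv.mulLeft τ) (fun σ => ∑ j, (((τ * σ) j : ℤ) : ℝ) * y j) _
      (fun σ => rfl), Finset.prod_univ_sum, Fintype.piFinset_univ]
    refine Finset.sum_congr rfl fun χ _ => ?_
    rw [← prod_comp_eq_prod_pow_fiberCard χ y,
      ← prod_comp_eq_prod_pow_fiberCard χ (fun j => ((τ j : ℤ) : ℝ))]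
    push_cast
    rw [← Finset.prod_mul_distrib, ← Finset.prod_mul_distrib]
    refine Finset.prod_congr rfl fun σ _ => ?_
    simp [mul_assoc]
  -- Summing over `τ` kills every monomial with an odd exponent.
  have hs : (Fintype.card (ι → ℤˣ) : ℝ) * ∏ σ : ι → ℤˣ, ∑ j, ((σ j : ℤ) : ℝ) * y j =
      (Fintype.card (ι → ℤˣ) : ℝ) *
      ∑ χ ∈ Finset.univ.filter fun χ : (ι → ℤˣ) → ι => ∀ j, Even (fiberCard χ j),
        ((∏ σ : ι → ℤˣ, (σ (χ σ) : ℤ) : ℤ) : ℝ) * ∏ j, (y j ^ 2) ^ (fiberCard χ j / 2) := by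
    calc _ = ∑ τ : ι → ℤˣ, ∏ σ : ι → ℤˣ, ∑ j, ((σ j : ℤ) : ℝ) * y j := by
          rw [Finset.sum_const, Finset.card_univ, nsmul_eq_mul]
      _ = ∑ χ : (ι → ℤˣ) → ι, (∑ τ : ι → ℤˣ, ∏ j, ((τ j : ℤ) : ℝ) ^ fiberCard χ j) *
        (((∏ σ : ι → ℤˣ, (σ (χ σ) : ℤ) : ℤ) : ℝ) * ∏ j, y j ^ fiberCard χ j) := by
          rw [Finset.sum_congr rfl fun τ _ => key τ, Finset.sum_comm]
          exact Finset.sum_congr rfl fun χ _ => by rw [Finset.sum_mul]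
      _ = _ := by
          rw [Finset.mul_sum, Finset.sum_filter]
          refine Finset.sum_congr rfl fun χ _ => ?_
          have h1 : ∑ τ : ι → ℤˣ, ∏ j, ((τ j : ℤ) : ℝ) ^ fiberCard χ j =
              ∏ j, ∑ s : ℤˣ, ((s : ℤ) : ℝ) ^ fiberCard χ j := by
            rw [Finset.prod_univ_sum, Fintype.piFinset_univ]
          rw [h1]
          split_ifs with h
          · have h2 : ∏ j, ∑ s : ℤˣ, ((s : ℤ) : ℝ) ^ fiberCard χ j =
                (Fintype.card (ι → ℤˣ) : ℝ) := by
              rw [Finset.prod_congr rfl fun j _ => (sum_units_int_pow _).trans (if_pos (h j))]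
              simp
            rw [h2]
            congr 2
            refine Finset.prod_congr rfl fun j _ => ?_
            rw [← pow_mul, Nat.mul_div_cancel' (h j).two_dvd]
          · push Not at h
            obtain ⟨j, hj⟩ := h
            rw [Finset.prod_eq_zero (Finset.mem_univ j)
              ((sum_units_int_pow _).trans (if_neg hj)), zero_mul]
  have hc : (Fintype.card (ι → ℤˣ) : ℝ) ≠ 0 := by
    exact_mod_cast Fintype.card_ne_zero
  exact mul_left_cancel₀ hc hs

/-! ### Heights of integer polynomials -/

/-- The sum of the absolute values of the coefficients of an integer polynomial. -/
def coeffNorm {σ : Type*} (p : MvPolynomial σ ℤ) : ℝ :=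
  ∑ s ∈ p.support, |((p.coeff s : ℤ) : ℝ)|

lemma coeffNorm_nonneg {σ : Type*} (p : MvPolynomial σ ℤ) : 0 ≤ coeffNorm p :=
  Finset.sum_nonneg fun _ _ => abs_nonneg _

lemma coeffNorm_eq_of_subset {σ : Type*} (p : MvPolynomial σ ℤ) {t : Finset (σ →₀ ℕ)}
    (h : p.support ⊆ t) : coeffNorm p = ∑ s ∈ t, |((p.coeff s : ℤ) : ℝ)| := by
  refine Finset.sum_subset h fun s _ hs => ?_
  rw [MvPolynomial.notMem_support_iff.1 hs]; simp

lemma coeffNorm_add {σ : Type*} (p q : MvPolynomial σ ℤ) :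
    coeffNorm (p + q) ≤ coeffNorm p + coeffNorm q := by
  classical
  rw [coeffNorm_eq_of_subset (p + q) MvPolynomial.support_add,
    coeffNorm_eq_of_subset p Finset.subset_union_left,
    coeffNorm_eq_of_subset q Finset.subset_union_right, ← Finset.sum_add_distrib]
  refine Finset.sum_le_sum fun s _ => ?_
  rw [MvPolynomial.coeff_add]; push_cast
  exact abs_add_le _ _

lemma coeffNorm_zero {σ : Type*} : coeffNorm (0 : MvPolynomial σ ℤ) = 0 := by
  simp [coeffNorm]

lemma coeffNorm_sum {σ κ : Type*} (s : Finset κ) (f : κ → MvPolynomial σ ℤ) :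
    coeffNorm (∑ i ∈ s, f i) ≤ ∑ i ∈ s, coeffNorm (f i) :=
  Finset.le_sum_of_subadditive _ coeffNorm_zero.le coeffNorm_add s f

lemma coeffNorm_monomial {σ : Type*} (s : σ →₀ ℕ) (c : ℤ) :
    coeffNorm (MvPolynomial.monomial s c) = |(c : ℝ)| := by
  classical
  rw [coeffNorm_eq_of_subset _ MvPolynomial.support_monomial_subset]
  simp

/-- Submultiplicativity is the reason for working with the sum of the coefficients rather than with
`polyHeight`, which it dominates. -/
lemma coeffNorm_mul {σ : Type*} (p q : MvPolynomial σ ℤ) :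
    coeffNorm (p * q) ≤ coeffNorm p * coeffNorm q := by
  have h : p * q = ∑ s ∈ p.support, ∑ t ∈ q.support,
      MvPolynomial.monomial (s + t) (p.coeff s * q.coeff t) := by
    conv_lhs => rw [p.as_sum, q.as_sum, Finset.sum_mul_sum]
    simp only [MvPolynomial.monomial_mul]
  have h2 : coeffNorm p * coeffNorm q = ∑ s ∈ p.support, ∑ t ∈ q.support,
      |((p.coeff s : ℤ) : ℝ)| * |((q.coeff t : ℤ) : ℝ)| := Finset.sum_mul_sum _ _ _ _
  rw [h, h2]
  refine (coeffNorm_sum _ _).trans (Finset.sum_le_sum fun s _ => ?_)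
  refine (coeffNorm_sum _ _).trans (Finset.sum_le_sum fun t _ => ?_)
  rw [coeffNorm_monomial]; push_cast
  exact (abs_mul _ _).le

lemma coeffNorm_C {σ : Type*} (c : ℤ) : coeffNorm (MvPolynomial.C c : MvPolynomial σ ℤ) = |(c : ℝ)| :=
  coeffNorm_monomial 0 c

lemma coeffNorm_X {σ : Type*} (i : σ) : coeffNorm (MvPolynomial.X i : MvPolynomial σ ℤ) = 1 := by
  rw [MvPolynomial.X, coeffNorm_monomial]; simp

lemma coeffNorm_pow {σ : Type*} (p : MvPolynomial σ ℤ) (n : ℕ) :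
    coeffNorm (p ^ n) ≤ coeffNorm p ^ n := by
  induction n with
  | zero => 
    rw [pow_zero, pow_zero, ← MvPolynomial.C_1, coeffNorm_C]; simp
  | succ n ih =>
    rw [pow_succ, pow_succ]
    exact (coeffNorm_mul _ _).trans (mul_le_mul_of_nonneg_right ih (coeffNorm_nonneg _))

lemma coeffNorm_prod {σ κ : Type*} (s : Finset κ) (f : κ → MvPolynomial σ ℤ) :
    coeffNorm (∏ i ∈ s, f i) ≤ ∏ i ∈ s, coeffNorm (f i) := by
  classical
  induction s using Finset.induction_on with
  | empty => rw [Finset.prod_empty, Finset.prod_empty, ← MvPolynomial.C_1, coeffNorm_C]; simp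
  | insert i s hi ih =>
    rw [Finset.prod_insert hi, Finset.prod_insert hi]
    exact (coeffNorm_mul _ _).trans (mul_le_mul_of_nonneg_left ih (coeffNorm_nonneg _))

lemma polyHeight_le_coeffNorm (p : MvPolynomial (Fin 2) ℤ) : (polyHeight p : ℝ) ≤ coeffNorm p := by
  have h : ∀ s ∈ p.support, ((p.coeff s).natAbs : ℝ) ≤ coeffNorm p := by
    intro s hs
    rw [Nat.cast_natAbs, Int.cast_abs]
    exact Finset.single_le_sum (f := fun s => |((p.coeff s : ℤ) : ℝ)|) (fun _ _ => abs_nonneg _) hs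
  rw [polyHeight]
  rcases p.support.eq_empty_or_nonempty with h0 | h0
  · rw [h0]; simpa using coeffNorm_nonneg p
  · obtain ⟨s, hs, he⟩ := Finset.exists_mem_eq_sup _ h0 fun s => (p.coeff s).natAbs
    rw [he]; exact h s hs

/-- Ensures that the denominator in `StronglyDiophantine` is positive. -/
lemma one_le_polyHeight {p : MvPolynomial (Fin 2) ℤ} (hp : p ≠ 0) : 1 ≤ polyHeight p := by
  obtain ⟨s, hs⟩ := MvPolynomial.support_nonempty.2 hp
  refine le_trans ?_ (Finset.le_sup (f := fun s => (p.coeff s).natAbs) hs)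
  have := MvPolynomial.mem_support_iff.1 hs
  exact Nat.one_le_iff_ne_zero.2 (by simpa using this)

/-! ### The norm form as an integer polynomial -/

/-- The binary form `|a + b (x + iy)|²`. -/
def latForm (x y : ℝ) (v : ℤ × ℤ) : ℝ := (v.1 + v.2 * x) ^ 2 + (v.2 * y) ^ 2

/-- `|a + b (x + iy)|`. -/
def latNorm (x y : ℝ) (v : ℤ × ℤ) : ℝ := √(latForm x y v)

lemma latForm_nonneg (x y : ℝ) (v : ℤ × ℤ) : 0 ≤ latForm x y v := by
  unfold latForm; positivity

/-- The form `|a + b (x + iy)|²` as a polynomial in `x` and `y`. -/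
def latPoly (v : ℤ × ℤ) : MvPolynomial (Fin 2) ℤ :=
  (MvPolynomial.C v.1 + MvPolynomial.C v.2 * MvPolynomial.X 0) ^ 2
    + (MvPolynomial.C v.2 * MvPolynomial.X 1) ^ 2

lemma aeval_latPoly (x y : ℝ) (v : ℤ × ℤ) :
    MvPolynomial.aeval ![x, y] (latPoly v) = latForm x y v := by
  simp [latPoly, latForm]

lemma totalDegree_latPoly (v : ℤ × ℤ) : (latPoly v).totalDegree ≤ 2 := by
  have hC : ∀ (c : ℤ) (i : Fin 2), (MvPolynomial.C c * MvPolynomial.X i :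
      MvPolynomial (Fin 2) ℤ).totalDegree ≤ 1 := fun c i => by
    refine (MvPolynomial.totalDegree_mul _ _).trans ?_
    rw [MvPolynomial.totalDegree_C, MvPolynomial.totalDegree_X]
  refine (MvPolynomial.totalDegree_add _ _).trans (max_le ?_ ?_)
  · refine (MvPolynomial.totalDegree_pow _ _).trans ?_
    have := (MvPolynomial.totalDegree_add (MvPolynomial.C v.1 : MvPolynomial (Fin 2) ℤ)
      (MvPolynomial.C v.2 * MvPolynomial.X 0)).trans (max_le ((MvPolynomial.totalDegree_C _).le.trans zero_le_one) (hC _ _))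
    omega
  · refine (MvPolynomial.totalDegree_pow _ _).trans ?_
    have := hC v.2 1
    omega

lemma coeffNorm_latPoly (v : ℤ × ℤ) {B : ℝ} (h1 : |(v.1 : ℝ)| ≤ B) (h2 : |(v.2 : ℝ)| ≤ B) :
    coeffNorm (latPoly v) ≤ 5 * B ^ 2 := by
  have hC : ∀ (i : Fin 2), coeffNorm (MvPolynomial.C v.2 * MvPolynomial.X i :
      MvPolynomial (Fin 2) ℤ) ≤ B := fun i => by
    refine (coeffNorm_mul _ _).trans ?_
    rw [coeffNorm_C, coeffNorm_X, mul_one]; exact h2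
  have e1 := (coeffNorm_add (MvPolynomial.C v.1 : MvPolynomial (Fin 2) ℤ)
      (MvPolynomial.C v.2 * MvPolynomial.X 0)).trans (add_le_add ((coeffNorm_C _).le.trans h1) (hC 0))
  have e2 := (coeffNorm_pow _ 2).trans (pow_le_pow_left₀ (coeffNorm_nonneg _) e1 2)
  have e3 := (coeffNorm_pow _ 2).trans (pow_le_pow_left₀ (coeffNorm_nonneg _) (hC 1) 2)
  refine (coeffNorm_add _ _).trans ((add_le_add e2 e3).trans (le_of_eq (by ring)))

/-- The product over all signs of `∑ ± c_j |v_j|` as an integer polynomial. -/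
lemma exists_poly_prod_signed_sum {ι : Type*} [Fintype ι] [DecidableEq ι] (c : ι → ℤ)
    (v : ι → ℤ × ℤ) :
    ∃ p : MvPolynomial (Fin 2) ℤ, p.totalDegree ≤ Fintype.card (ι → ℤˣ) ∧
      (∀ x y : ℝ, MvPolynomial.aeval ![x, y] p =
        ∏ σ : ι → ℤˣ, ∑ j, ((σ j : ℤ) : ℝ) * (c j * latNorm x y (v j))) ∧
      ∀ B : ℝ, 1 ≤ B → (∀ j, |(c j : ℝ)| ≤ B ∧ |((v j).1 : ℝ)| ≤ B ∧ |((v j).2 : ℝ)| ≤ B) →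
        coeffNorm p ≤ (Fintype.card ((ι → ℤˣ) → ι) : ℝ) * (5 * B ^ 4) ^ Fintype.card (ι → ℤˣ) := by
  have hhalf : ∀ χ : (ι → ℤˣ) → ι, ∑ j, fiberCard χ j / 2 * 2 ≤ Fintype.card (ι → ℤˣ) := fun χ =>
    (Finset.sum_le_sum fun j _ => Nat.div_mul_le_self _ _).trans (sum_fiberCard χ).le
  refine ⟨∑ χ ∈ Finset.univ.filter fun χ : (ι → ℤˣ) → ι => ∀ j, Even (fiberCard χ j),
        MvPolynomial.C (∏ σ : ι → ℤˣ, (σ (χ σ) : ℤ)) *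
          ∏ j, (MvPolynomial.C (c j ^ 2) * latPoly (v j)) ^ (fiberCard χ j / 2), ?_, ?_, ?_⟩
  · refine MvPolynomial.totalDegree_finsetSum_le fun χ _ => ?_
    refine (MvPolynomial.totalDegree_mul _ _).trans ?_
    rw [MvPolynomial.totalDegree_C, zero_add]
    refine (MvPolynomial.totalDegree_finsetProd _ _).trans (le_trans ?_ (hhalf χ))
    refine Finset.sum_le_sum fun j _ => (MvPolynomial.totalDegree_pow _ _).trans ?_
    refine Nat.mul_le_mul_left _ ((MvPolynomial.totalDegree_mul _ _).trans ?_)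
    rw [MvPolynomial.totalDegree_C, zero_add]; exact totalDegree_latPoly _
  · intro x y
    rw [prod_signed_sum, map_sum]
    refine Finset.sum_congr rfl fun χ _ => ?_
    rw [map_mul, MvPolynomial.aeval_C]
    refine congrArg₂ (· * ·) (by simp)
      ((map_prod _ _ _).trans (Finset.prod_congr rfl fun j _ => ?_))
    rw [map_pow, map_mul, aeval_latPoly, latNorm, mul_pow (c j : ℝ), Real.sq_sqrt (latForm_nonneg _ _ _),
      MvPolynomial.aeval_C]
    simp
  · intro B hB h
    have h5 : 1 ≤ 5 * B ^ 4 := by nlinarith [one_le_pow₀ hB (n := 4)]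
    refine (coeffNorm_sum _ _).trans ?_
    -- One square `c_j ^ 2 · latPoly (v j)` has norm at most `B ^ 2 · 5 B ^ 2`.
    refine (Finset.sum_le_card_nsmul _ _ ((5 * B ^ 4) ^ Fintype.card (ι → ℤˣ)) fun χ _ => ?_).trans ?_
    · refine (coeffNorm_mul _ _).trans ?_
      have hone : |((∏ σ : ι → ℤˣ, (σ (χ σ) : ℤ) : ℤ) : ℝ)| = 1 := by
        push_cast
        rw [Finset.abs_prod]
        refine Finset.prod_eq_one fun σ _ => ?_
        rw [← Int.cast_abs, Int.isUnit_iff_abs_eq.1 (σ (χ σ)).isUnit, Int.cast_one]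
      rw [coeffNorm_C, hone, one_mul]
      refine (coeffNorm_prod _ _).trans ?_
      calc _ ≤ ∏ j, (5 * B ^ 4) ^ (fiberCard χ j / 2) := by
            refine Finset.prod_le_prod (fun j _ => coeffNorm_nonneg _) fun j _ => ?_
            refine (coeffNorm_pow _ _).trans (pow_le_pow_left₀ (coeffNorm_nonneg _) ?_ _)
            refine (coeffNorm_mul _ _).trans ?_
            rw [coeffNorm_C]
            have hc2 : |((c j ^ 2 : ℤ) : ℝ)| ≤ B ^ 2 := by
              push_cast; rw [abs_pow]; exact pow_le_pow_left₀ (abs_nonneg _) (h j).1 2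
            calc _ ≤ B ^ 2 * (5 * B ^ 2) :=
                  mul_le_mul hc2 (coeffNorm_latPoly _ (h j).2.1 (h j).2.2) (coeffNorm_nonneg _)
                    (by positivity)
              _ = _ := by ring
        _ = (5 * B ^ 4) ^ ∑ j, fiberCard χ j / 2 := Finset.prod_pow_eq_pow_sum _ _ _
        _ ≤ _ := pow_le_pow_right₀ h5 <| (Finset.sum_le_sum fun j _ => by omega).trans (hhalf χ)
    · rw [nsmul_eq_mul]
      refine mul_le_mul_of_nonneg_right ?_ (by positivity)
      exact_mod_cast Finset.card_le_univ _

/-! ### Primitive vectors and comparison of norms -/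

/-- Primitive integer vectors in a half plane: one from each pair `±v`. -/
def IsPrimHalf (v : ℤ × ℤ) : Prop :=
  Int.gcd v.1 v.2 = 1 ∧ (0 < v.2 ∨ v.2 = 0 ∧ 0 < v.1)

lemma isPrimHalf_one_zero : IsPrimHalf (1, 0) := by
  simp [IsPrimHalf]

lemma IsPrimHalf.ne_zero {v : ℤ × ℤ} (h : IsPrimHalf v) : v ≠ 0 := by
  rintro rfl
  simp [IsPrimHalf] at h

/-- By coprimality the second coordinates divide each other, and the half plane fixes their sign. If
they vanish, primitivity forces the first coordinates to be `1`. -/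
lemma IsPrimHalf.eq_of_cross {u v : ℤ × ℤ} (hu : IsPrimHalf u) (hv : IsPrimHalf v)
    (h : u.1 * v.2 = v.1 * u.2) : u = v := by
  obtain ⟨a, b⟩ := u
  obtain ⟨a', b'⟩ := v
  obtain ⟨hg, hs⟩ := hu
  obtain ⟨hg', hs'⟩ := hv
  simp only at *
  have c1 : IsCoprime b a := (Int.isCoprime_iff_gcd_eq_one.2 hg).symm
  have c2 : IsCoprime b' a' := (Int.isCoprime_iff_gcd_eq_one.2 hg').symm
  have d1 : b ∣ b' := c1.dvd_of_dvd_mul_left (by rw [h]; exact dvd_mul_left _ _)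
  have d2 : b' ∣ b := c2.dvd_of_dvd_mul_left (by rw [← h]; exact dvd_mul_left _ _)
  have hbb : b = b' := Int.dvd_antisymm (by omega) (by omega) d1 d2
  subst hbb
  rcases hs with hb | ⟨rfl, ha⟩
  · rw [mul_right_cancel₀ hb.ne' h]
  · have ha' : 0 < a' := by omega
    simp only [Int.gcd_zero_right] at hg hg'
    have : a = a' := by omega
    rw [this]

lemma exists_smul_isPrimHalf (v : ℤ × ℤ) : ∃ (D : ℤ × ℤ) (n : ℤ), IsPrimHalf D ∧ v = n • D ∧
    |D.1| ≤ |v.1| + 1 ∧ |D.2| ≤ |v.2| ∧ |n| ≤ |v.1| + |v.2| := by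
  obtain ⟨a, b⟩ := v
  by_cases h0 : a = 0 ∧ b = 0
  -- The zero vector is `0 • (1, 0)`; this case is the source of the `+ 1` in the bound for `D.1`.
  · exact ⟨(1, 0), 0, isPrimHalf_one_zero, by simp [h0.1, h0.2], by simp [h0.1], by simp, by simp [h0]⟩
  have hg : 0 < Int.gcd a b := by
    rw [Nat.pos_iff_ne_zero, Ne, Int.gcd_eq_zero_iff]; exact h0
  obtain ⟨a', b', hco, ha, hb⟩ := Int.exists_gcd_one hg
  set g : ℤ := (Int.gcd a b : ℤ) with hgdef
  have hg0 : (0 : ℤ) < g := Int.natCast_pos.2 hg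
  have ha' : |a'| ≤ |a| := by
    rw [ha, abs_mul, abs_of_pos hg0]; nlinarith [abs_nonneg a']
  have hb' : |b'| ≤ |b| := by
    rw [hb, abs_mul, abs_of_pos hg0]; nlinarith [abs_nonneg b']
  have hne : ¬ (a' = 0 ∧ b' = 0) := by
    rintro ⟨rfl, rfl⟩; simp at hco
  have hsum : |g| ≤ |a| + |b| := by
    have h1 : 1 ≤ |a'| + |b'| := by
      by_contra hlt
      have e1 := abs_nonneg a'
      have e2 := abs_nonneg b'
      exact hne ⟨abs_eq_zero.1 (by omega), abs_eq_zero.1 (by omega)⟩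
    have e : |a| + |b| = (|a'| + |b'|) * g := by
      rw [add_mul]
      nth_rewrite 1 [ha]; nth_rewrite 1 [hb]
      rw [abs_mul, abs_mul, abs_of_pos hg0]
    rw [e, abs_of_pos hg0]; nlinarith
  by_cases hs : 0 < b' ∨ b' = 0 ∧ 0 < a'
  · refine ⟨(a', b'), g, ⟨hco, hs⟩, ?_, by simp only; linarith, hb', hsum⟩
    ext
    · simpa [mul_comm] using ha
    · simpa [mul_comm] using hb
  · refine ⟨(-a', -b'), -g, ⟨by simpa using hco, ?_⟩, ?_, by simp only [abs_neg]; linarith,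
      by simpa using hb', by simpa using hsum⟩
    · simp only; omega
    · ext
      · simpa [mul_comm] using ha
      · simpa [mul_comm] using hb

lemma latForm_smul (x y : ℝ) (n : ℤ) (v : ℤ × ℤ) :
    latForm x y (n • v) = (n : ℝ) ^ 2 * latForm x y v := by
  simp [latForm]; ring

lemma latNorm_smul (x y : ℝ) (n : ℤ) (v : ℤ × ℤ) :
    latNorm x y (n • v) = |(n : ℝ)| * latNorm x y v := by
  rw [latNorm, latForm_smul, Real.sqrt_mul (sq_nonneg _), Real.sqrt_sq_eq_abs, latNorm]

lemma latNorm_nonneg (x y : ℝ) (v : ℤ × ℤ) : 0 ≤ latNorm x y v := Real.sqrt_nonneg _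

lemma abs_snd_le_latNorm {x y : ℝ} (hy : y ≠ 0) (v : ℤ × ℤ) :
    |(v.2 : ℝ)| ≤ latNorm x y v / |y| := by
  rw [le_div_iff₀ (abs_pos.2 hy), ← abs_mul]
  refine Real.abs_le_sqrt ?_
  unfold latForm; nlinarith [sq_nonneg ((v.1 : ℝ) + v.2 * x)]

lemma abs_fst_le_latNorm {x y : ℝ} (hy : y ≠ 0) (v : ℤ × ℤ) :
    |(v.1 : ℝ)| ≤ latNorm x y v * (1 + |x| / |y|) := by
  have h1 : |(v.1 : ℝ) + v.2 * x| ≤ latNorm x y v := by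
    refine Real.abs_le_sqrt ?_
    unfold latForm; nlinarith [sq_nonneg ((v.2 : ℝ) * y)]
  have h2 : |(v.2 : ℝ) * x| ≤ latNorm x y v * (|x| / |y|) := by
    rw [abs_mul]
    calc _ ≤ latNorm x y v / |y| * |x| :=
          mul_le_mul_of_nonneg_right (abs_snd_le_latNorm hy v) (abs_nonneg _)
      _ = _ := by ring
  calc |(v.1 : ℝ)| = |((v.1 : ℝ) + v.2 * x) - v.2 * x| := by ring_nf
    _ ≤ |(v.1 : ℝ) + v.2 * x| + |(v.2 : ℝ) * x| := abs_sub _ _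
    _ ≤ _ := by linarith

lemma latNorm_le {x y B : ℝ} {v : ℤ × ℤ} (h1 : |(v.1 : ℝ)| ≤ B) (h2 : |(v.2 : ℝ)| ≤ B) :
    latNorm x y v ≤ B * (1 + |x| + |y|) := by
  have hB : 0 ≤ B := (abs_nonneg _).trans h1
  rw [latNorm]
  refine Real.sqrt_le_iff.2 ⟨by positivity, ?_⟩
  have e1 : |(v.1 : ℝ) + v.2 * x| ≤ B * (1 + |x|) := by
    refine (abs_add_le _ _).trans ?_
    rw [abs_mul]; nlinarith [abs_nonneg x]
  have e2 : |(v.2 : ℝ) * y| ≤ B * |y| := by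
    rw [abs_mul]; exact mul_le_mul_of_nonneg_right h2 (abs_nonneg _)
  have e3 := pow_le_pow_left₀ (abs_nonneg _) e1 2
  have e4 := pow_le_pow_left₀ (abs_nonneg _) e2 2
  rw [sq_abs] at e3 e4
  unfold latForm
  have : 0 ≤ B * (1 + |x|) * (B * |y|) := by positivity
  nlinarith

lemma latNorm_pos {x y : ℝ} (hy : y ≠ 0) {v : ℤ × ℤ} (hv : v ≠ 0) : 0 < latNorm x y v := by
  rcases (latNorm_nonneg x y v).lt_or_eq with h | h
  · exact h
  · have h1 := abs_fst_le_latNorm (x := x) hy v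
    have h2 := abs_snd_le_latNorm (x := x) hy v
    rw [← h] at h1 h2
    simp at h1 h2
    exact absurd (Prod.ext h1 h2) hv

/-! ### Nonvanishing and lower bounds for signed sums of norms -/

/-- If the vectors with nonzero coefficients are nonzero and pairwise not proportional, then some
specialisation of `(x, y)` makes all signed sums nonzero. -/
lemma exists_prod_signed_sum_ne_zero {ι : Type*} [Fintype ι] [DecidableEq ι] (c : ι → ℤ)
    (v : ι → ℤ × ℤ) (hc : ∃ i, c i ≠ 0) (hv : ∀ i, v i ≠ 0)
    (hcross : ∀ i j, c i ≠ 0 → c j ≠ 0 → (v i).1 * (v j).2 = (v j).1 * (v i).2 → i = j) :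
    ∃ x y : ℝ, ∏ σ : ι → ℤˣ, ∑ j, ((σ j : ℤ) : ℝ) * (c j * latNorm x y (v j)) ≠ 0 := by
  by_cases hb : ∃ i, c i ≠ 0 ∧ (v i).2 ≠ 0
  · obtain ⟨i, hci, hbi⟩ := hb
    have hbR : ((v i).2 : ℝ) ≠ 0 := by exact_mod_cast hbi
    have hcR : (c i : ℝ) ≠ 0 := by exact_mod_cast hci
    -- At `x = x₀` the norm of `v i` is `|b_i| |t|`, with a corner at `t = 0`. Every other relevant
    -- norm is positive at `t = 0` and depends on `t ^ 2` only, so it has derivative zero there.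
    set x₀ : ℝ := -((v i).1 : ℝ) / (v i).2 with hx₀
    have hev : ∀ σ : ι → ℤˣ, ∀ᶠ t in 𝓝[>] (0 : ℝ),
        ∑ j, ((σ j : ℤ) : ℝ) * (c j * latNorm x₀ t (v j)) ≠ 0 := by
      intro σ
      have hσ : ((σ i : ℤ) : ℝ) ≠ 0 := by exact_mod_cast (σ i).ne_zero
      -- The corner is replaced by the linear function that agrees with it for `t > 0`. The
      -- resulting derivative is nonzero, so the sum does not vanish for small `t > 0`, whatever its
      -- value at `0`.
      have hd : HasDerivAt (fun t : ℝ => ((σ i : ℤ) : ℝ) * (c i * (|((v i).2 : ℝ)| * t)) +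
          ∑ j ∈ Finset.univ.erase i, ((σ j : ℤ) : ℝ) * (c j * latNorm x₀ t (v j)))
          (((σ i : ℤ) : ℝ) * (c i * (|((v i).2 : ℝ)| * 1)) +
            ∑ j ∈ Finset.univ.erase i, 0) 0 := by
        refine HasDerivAt.add ((((hasDerivAt_id _).const_mul _).const_mul _).const_mul _) ?_
        refine HasDerivAt.fun_sum fun j hj => ?_
        by_cases hcj : c j = 0
        · simpa [hcj] using hasDerivAt_const (0 : ℝ) (0 : ℝ)
        · have hA : ((v j).1 : ℝ) + (v j).2 * x₀ ≠ 0 := by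
            intro h0
            refine (Finset.mem_erase.1 hj).1 (hcross j i hcj hci ?_)
            rw [hx₀] at h0
            field_simp at h0
            have : ((v j).1 : ℝ) * (v i).2 = (v i).1 * (v j).2 := by linarith
            exact_mod_cast this
          have h1 : HasDerivAt (fun t : ℝ => latForm x₀ t (v j)) 0 0 := by
            have := ((((hasDerivAt_id (0 : ℝ)).const_mul ((v j).2 : ℝ)).pow 2).const_add
              ((((v j).1 : ℝ) + (v j).2 * x₀) ^ 2))
            simpa [latForm] using this
          have h2 := h1.sqrt (by
            unfold latForm
            simpa using hA)
          have h3 := (h2.const_mul (c j : ℝ)).const_mul ((σ j : ℤ) : ℝ)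
          simpa [latNorm] using h3
      have hne := hd.eventually_ne (c := 0) (by
        simp only [Finset.sum_const_zero, mul_one, add_zero]
        exact mul_ne_zero hσ (mul_ne_zero hcR (abs_ne_zero.2 hbR)))
      have hne' := hne.filter_mono (nhdsWithin_mono (0 : ℝ) (fun t (ht : 0 < t) => ht.ne'))
      filter_upwards [hne', self_mem_nhdsWithin] with t ht htpos
      have htpos' : (0 : ℝ) < t := htpos
      rw [← Finset.add_sum_erase _ _ (Finset.mem_univ i)]
      have hn : latNorm x₀ t (v i) = |((v i).2 : ℝ)| * t := by
        have : ((v i).1 : ℝ) + (v i).2 * x₀ = 0 := by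
          rw [hx₀]; field_simp; ring
        rw [latNorm, latForm, this, zero_pow two_ne_zero, zero_add, Real.sqrt_sq_eq_abs, abs_mul,
          abs_of_pos htpos']
      rw [hn]; exact ht
    obtain ⟨t, ht⟩ := (eventually_all.2 hev).exists
    exact ⟨x₀, t, Finset.prod_ne_zero_iff.2 fun σ _ => ht σ⟩
  -- All relevant vectors lie on the real axis, hence are proportional, and a single term survives.
  · push Not at hb
    obtain ⟨i, hi⟩ := hc
    refine ⟨0, 1, Finset.prod_ne_zero_iff.2 fun σ _ => ?_⟩
    rw [Finset.sum_eq_single i]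
    · refine mul_ne_zero (by exact_mod_cast (σ i).ne_zero) (mul_ne_zero (by exact_mod_cast hi) ?_)
      exact (latNorm_pos one_ne_zero (hv i)).ne'
    · intro j _ hji
      by_cases hcj : c j = 0
      · simp [hcj]
      · exact absurd (hcross j i hcj hi (by rw [hb i hi, hb j hcj]; simp)) hji
    · simp

/-- The product is the value of an integer polynomial that some specialisation shows to be nonzero;
by algebraic independence it cannot vanish at `(ξ, η)`. -/
lemma prod_signed_sum_ne_zero {ξ η : ℝ}
    (hind : ∀ p : MvPolynomial (Fin 2) ℤ, MvPolynomial.aeval ![ξ, η] p = 0 → p = 0)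
    {ι : Type*} [Fintype ι] [DecidableEq ι] (c : ι → ℤ)
    (v : ι → ℤ × ℤ) (hc : ∃ i, c i ≠ 0) (hv : ∀ i, v i ≠ 0)
    (hcross : ∀ i j, c i ≠ 0 → c j ≠ 0 → (v i).1 * (v j).2 = (v j).1 * (v i).2 → i = j) :
    ∏ σ : ι → ℤˣ, ∑ j, ((σ j : ℤ) : ℝ) * (c j * latNorm ξ η (v j)) ≠ 0 := by
  obtain ⟨x, y, hxy⟩ := exists_prod_signed_sum_ne_zero c v hc hv hcross
  obtain ⟨p, -, hp, -⟩ := exists_poly_prod_signed_sum c v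
  intro h0
  rw [← hp] at h0 hxy
  rw [hind p h0] at hxy
  simp at hxy

/-- A linear relation would be the vanishing of the factor with all signs `+` in a product that is
nonzero. -/
lemma linearIndependent_latNorm {ξ η : ℝ}
    (hind : ∀ p : MvPolynomial (Fin 2) ℤ, MvPolynomial.aeval ![ξ, η] p = 0 → p = 0) :
    LinearIndependent ℤ fun D : {D : ℤ × ℤ // IsPrimHalf D} => latNorm ξ η D := by
  classical
  rw [linearIndependent_iff']
  intro s g hg i hi
  by_contra hne
  have h := prod_signed_sum_ne_zero hind (ι := s) (fun j => g j) (fun j => (j : {D // IsPrimHalf D}))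
    ⟨⟨i, hi⟩, hne⟩ (fun j => j.1.2.ne_zero) (fun j k _ _ hjk =>
      Subtype.ext (Subtype.ext (j.1.2.eq_of_cross k.1.2 hjk)))
  refine Finset.prod_ne_zero_iff.1 h 1 (Finset.mem_univ _) ?_
  rw [← hg, ← Finset.sum_coe_sort s]
  refine Finset.sum_congr rfl fun j _ => ?_
  simp

/-- Lower bound for integer combinations of norms of primitive vectors. -/
lemma exists_lower_bound_sum_latNorm {ξ η : ℝ}
    (hind : ∀ p : MvPolynomial (Fin 2) ℤ, MvPolynomial.aeval ![ξ, η] p = 0 → p = 0)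
    (hd : StronglyDiophantine ξ η) (m : ℕ) :
    ∃ (K : ℕ) (c : ℝ), 0 < K ∧ 0 < c ∧ ∀ (B : ℝ), 1 ≤ B → ∀ (C : Fin m → ℤ) (D : Fin m → ℤ × ℤ),
      (∀ i, D i ≠ 0) →
      (∀ i j, C i ≠ 0 → C j ≠ 0 → (D i).1 * (D j).2 = (D j).1 * (D i).2 → i = j) →
      (∀ j, |(C j : ℝ)| ≤ B ∧ |((D j).1 : ℝ)| ≤ B ∧ |((D j).2 : ℝ)| ≤ B) →
      ∑ j, (C j : ℝ) * latNorm ξ η (D j) ≠ 0 →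
      c / B ^ K ≤ |∑ j, (C j : ℝ) * latNorm ξ η (D j)| := by
  set R := Fintype.card (Fin m → ℤˣ) with hR
  have hRpos : 0 < R := Fintype.card_pos
  -- The `+ 1` keeps `F` positive when `m = 0`.
  set F := (Fintype.card ((Fin m → ℤˣ) → Fin m) : ℝ) + 1 with hF
  have hFpos : 0 < F := by positivity
  obtain ⟨K₁, c, hc, hp⟩ := hd R
  set W : ℝ := (m + 1) * (1 + |ξ| + |η|) with hW
  have hW1 : 1 ≤ W := by
    have h1 : (0 : ℝ) ≤ m := by positivity
    rw [hW]; nlinarith [abs_nonneg ξ, abs_nonneg η, mul_nonneg h1 (abs_nonneg ξ),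
      mul_nonneg h1 (abs_nonneg η)]
  -- The height, of order `B ^ (4R)`, enters to the power `K₁`; the remaining factors, each at most
  -- `W B ^ 2`, cost at most `(W B ^ 2) ^ R`.
  refine ⟨4 * R * K₁ + 2 * R, c / (F ^ K₁ * 5 ^ (R * K₁) * W ^ R), by positivity, by positivity, ?_⟩
  intro B hB C D hD hcross hbd hne
  have hB0 : 0 < B := by linarith
  have hCne : ∃ i, C i ≠ 0 := by
    by_contra h
    push Not at h
    exact hne (by simp [h])
  have hP := prod_signed_sum_ne_zero hind C D hCne hD hcross
  obtain ⟨p, hdeg, hev, hnorm⟩ := exists_poly_prod_signed_sum C D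
  rw [← hev] at hP
  have hlow := hp p hdeg hP
  have hp0 : p ≠ 0 := by rintro rfl; simp at hP
  have hheight : (polyHeight p : ℝ) ≤ F * (5 * B ^ 4) ^ R :=
    (polyHeight_le_coeffNorm p).trans ((hnorm B hB hbd).trans
      (mul_le_mul_of_nonneg_right (by rw [hF]; linarith) (by positivity)))
  have hh1 : (1 : ℝ) ≤ polyHeight p := by exact_mod_cast one_le_polyHeight hp0
  have hlow2 : c / (F * (5 * B ^ 4) ^ R) ^ K₁ ≤ |MvPolynomial.aeval ![ξ, η] p| :=
    (div_le_div_of_nonneg_left hc.le (by positivity)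
      (pow_le_pow_left₀ (by positivity) hheight _)).trans hlow
  have hfac : ∀ σ : Fin m → ℤˣ, |∑ j, ((σ j : ℤ) : ℝ) * (C j * latNorm ξ η (D j))| ≤ W * B ^ 2 := by
    intro σ
    refine (Finset.abs_sum_le_sum_abs _ _).trans ?_
    refine (Finset.sum_le_card_nsmul _ _ (B * (B * (1 + |ξ| + |η|))) fun j _ => ?_).trans ?_
    · have h1 : |((σ j : ℤ) : ℝ)| = 1 := by
        rw [← Int.cast_abs, Int.isUnit_iff_abs_eq.1 (σ j).isUnit, Int.cast_one]
      rw [abs_mul, h1, one_mul, abs_mul, abs_of_nonneg (latNorm_nonneg _ _ _)]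
      exact mul_le_mul (hbd j).1 (latNorm_le (hbd j).2.1 (hbd j).2.2) (latNorm_nonneg _ _ _) hB0.le
    · rw [nsmul_eq_mul, Finset.card_univ, Fintype.card_fin, hW]
      have : 0 ≤ (1 + |ξ| + |η|) * B ^ 2 := by positivity
      nlinarith
  have hWB : 1 ≤ W * B ^ 2 := by nlinarith [one_le_pow₀ hB (n := 2)]
  have hup : |MvPolynomial.aeval ![ξ, η] p| ≤
      |∑ j, (C j : ℝ) * latNorm ξ η (D j)| * (W * B ^ 2) ^ R := by
    rw [hev, Finset.abs_prod, ← Finset.mul_prod_erase _ _ (Finset.mem_univ (1 : Fin m → ℤˣ))]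
    refine mul_le_mul (by simp) ?_ (Finset.prod_nonneg fun _ _ => abs_nonneg _) (abs_nonneg _)
    refine (Finset.prod_le_prod (fun _ _ => abs_nonneg _) fun σ _ => hfac σ).trans ?_
    rw [Finset.prod_const]
    exact pow_le_pow_right₀ hWB (by
      rw [hR, ← Finset.card_univ]; exact Finset.card_le_card (Finset.erase_subset _ _))
  have hfin := hlow2.trans hup
  rw [← div_le_iff₀ (by positivity)] at hfin
  refine le_trans (le_of_eq ?_) hfin
  clear_value W
  rw [div_div, div_div]
  congr 1
  simp only [mul_pow, ← pow_mul, pow_add]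
  ring

/-- Signed sums of square roots of the binary form are separated from zero. -/
lemma exists_sqrtSumsSeparated {ξ η : ℝ} (hη : η ≠ 0)
    (hind : ∀ p : MvPolynomial (Fin 2) ℤ, MvPolynomial.aeval ![ξ, η] p = 0 → p = 0)
    (hd : StronglyDiophantine ξ η) (m : ℕ) :
    ∃ K : ℕ, 0 < K ∧ SqrtSumsSeparated ξ η m K := by
  classical
  obtain ⟨K, c, hK, hc, hlow⟩ := exists_lower_bound_sum_latNorm hind hd m
  -- Chosen so that `κ X` dominates the collected coefficients and the entries of the primitive
  -- vectors.
  set κ : ℝ := (m + 1) * (1 + (1 + |ξ| / |η|) + 1 / |η|) with hκ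
  have hκ1 : 1 ≤ κ := by
    have : (0 : ℝ) ≤ m := by positivity
    have h2 : 0 ≤ |ξ| / |η| := by positivity
    have h3 : 0 ≤ 1 / |η| := by positivity
    rw [hκ]; nlinarith
  refine ⟨K, hK, c / κ ^ K, by positivity, ?_⟩
  intro X hX a b ε z hε hz hzX hne
  have hX0 : 0 < X := by linarith
  set v : Fin m → ℤ × ℤ := fun j => (a j, b j) with hv
  have hzv : ∀ j, √(z j) = latNorm ξ η (v j) := fun j => by
    rw [latNorm, hz j]; congr 1; simp only [latForm, hv]; ring
  have hsX : ∀ j, latNorm ξ η (v j) ≤ X := fun j => by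
    rw [← hzv]
    exact (Real.sqrt_le_sqrt (hzX j)).trans (Real.sqrt_le_iff.2 ⟨hX0.le, by nlinarith⟩)
  choose D n hD hvn hD1 hD2 hn using fun j => exists_smul_isPrimHalf (v j)
  have hbfst : ∀ j, |((v j).1 : ℝ)| ≤ X * (1 + |ξ| / |η|) := fun j =>
    (abs_fst_le_latNorm hη _).trans (mul_le_mul_of_nonneg_right (hsX j) (by positivity))
  have hbsnd : ∀ j, |((v j).2 : ℝ)| ≤ X * (1 / |η|) := fun j => by
    refine (abs_snd_le_latNorm (x := ξ) hη _).trans ?_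
    rw [mul_one_div]; exact div_le_div_of_nonneg_right (hsX j) (abs_nonneg _)
  set e : Fin m → ℤ := fun j => if ε j = 1 then |n j| else -|n j| with he
  have hterm : ∀ j, ε j * √(z j) = (e j : ℝ) * latNorm ξ η (D j) := by
    intro j
    rw [hzv, hvn j, latNorm_smul, ← mul_assoc]
    congr 1
    simp only [he]
    rcases hε j with h | h
    · simp [h]
    · have : (-1 : ℝ) ≠ 1 := by norm_num
      simp [h, this]
  -- One representative index for each primitive vector. Collecting the coefficients at
  -- representatives makes the vectors with nonzero coefficient pairwise distinct, hence
  -- non-proportional.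
  set r : Fin m → Fin m := fun j => (⟨j, rfl⟩ : ∃ i, D i = D j).choose with hr
  have hrD : ∀ j, D (r j) = D j := fun j => (⟨j, rfl⟩ : ∃ i, D i = D j).choose_spec
  have hrr : ∀ i j, D i = D j → r i = r j := fun i j h => by simp only [hr, h]
  set C : Fin m → ℤ := fun i => ∑ j ∈ Finset.univ.filter (fun j => r j = i), e j with hC
  have hsum : ∑ j, ε j * √(z j) = ∑ i, (C i : ℝ) * latNorm ξ η (D i) := by
    rw [Finset.sum_congr rfl fun j _ => hterm j,
      ← Finset.sum_fiberwise_of_maps_to (s := Finset.univ) (t := Finset.univ) (g := r)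
      (fun _ _ => Finset.mem_univ _)]
    refine Finset.sum_congr rfl fun i _ => ?_
    simp only [hC]; push_cast; rw [Finset.sum_mul]
    refine Finset.sum_congr rfl fun j hj => ?_
    rw [← (Finset.mem_filter.1 hj).2, hrD]
  have hCr : ∀ i, C i ≠ 0 → r i = i := by
    intro i hi
    obtain ⟨j, hj, -⟩ := Finset.exists_ne_zero_of_sum_ne_zero hi
    have hj' := (Finset.mem_filter.1 hj).2
    exact (hrr i j (by rw [← hrD j, hj'])).trans hj'
  rw [hsum] at hne ⊢
  have hen : ∀ j, |(e j : ℝ)| ≤ X * (1 + |ξ| / |η|) + X * (1 / |η|) := by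
    intro j
    have h1 : |e j| = |n j| := by
      simp only [he]; split_ifs <;> simp
    calc |(e j : ℝ)| = |(n j : ℝ)| := by exact_mod_cast congrArg (Int.cast : ℤ → ℝ) h1
      _ ≤ |((v j).1 : ℝ)| + |((v j).2 : ℝ)| := by exact_mod_cast hn j
      _ ≤ _ := add_le_add (hbfst j) (hbsnd j)
  have hmκ : X * (1 + (1 + |ξ| / |η|) + 1 / |η|) ≤ κ * X := by
    have : 0 ≤ m * (X * (1 + (1 + |ξ| / |η|) + 1 / |η|)) := by positivity
    rw [hκ]; nlinarith
  have hq1 : 0 ≤ X * (|ξ| / |η|) := by positivity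
  have hq2 : 0 ≤ X * (1 / |η|) := by positivity
  have := hlow (κ * X) (by nlinarith) C D (fun i => (hD i).ne_zero) (fun i j hi hj hij => by
      rw [← hCr i hi, ← hCr j hj]
      exact hrr i j ((hD i).eq_of_cross (hD j) hij)) (fun j => ⟨?_, ?_, ?_⟩) hne
  · rwa [mul_pow, ← div_div] at this
  · have h1 : |(C j : ℝ)| ≤ ∑ i ∈ Finset.univ.filter (fun i => r i = j), |(e i : ℝ)| := by
      simp only [hC]; push_cast; exact Finset.abs_sum_le_sum_abs _ _
    refine h1.trans ((Finset.sum_le_sum_of_subset_of_nonneg (Finset.subset_univ _)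
      fun _ _ _ => abs_nonneg _).trans ?_)
    refine (Finset.sum_le_card_nsmul _ _ _ fun i _ => hen i).trans ?_
    rw [nsmul_eq_mul, Finset.card_univ, Fintype.card_fin, hκ]
    have : (0 : ℝ) ≤ m * X := by positivity
    nlinarith
  · have h1 : |((D j).1 : ℝ)| ≤ |((v j).1 : ℝ)| + 1 := by exact_mod_cast hD1 j
    refine le_trans ?_ hmκ
    have := hbfst j
    nlinarith
  · have h1 : |((D j).2 : ℝ)| ≤ |((v j).2 : ℝ)| := by exact_mod_cast hD2 j
    refine le_trans ?_ hmκ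
    have := hbsnd j
    nlinarith

/-! ### Moments of sums of small independent elements -/

/-- The moments of a centred Gaussian of variance `V`. -/
def gaussMoment : ℕ → ℂ → ℂ
  | 0, _ => 1
  | 1, _ => 0
  | n + 2, V => (n + 1) * V * gaussMoment n V

/-- The Lipschitz bound absorbs the change of variance when one summand is removed. Both bounds pass
through the two-step recursion. -/
lemma gaussMoment_bounds (q : ℕ) {C : ℝ} (hC : 0 ≤ C) : ∃ K : ℝ, 0 ≤ K ∧
    (∀ V : ℂ, ‖V‖ ≤ C → ‖gaussMoment q V‖ ≤ K) ∧
    ∀ V W : ℂ, ‖V‖ ≤ C → ‖W‖ ≤ C → ‖gaussMoment q V - gaussMoment q W‖ ≤ K * ‖V - W‖ := by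
  induction q using Nat.twoStepInduction with
  | zero => exact ⟨1, zero_le_one, by simp [gaussMoment], by simp [gaussMoment]⟩
  | one => exact ⟨0, le_rfl, by simp [gaussMoment], by simp [gaussMoment]⟩
  | more n ih _ =>
    obtain ⟨K, hK, h1, h2⟩ := ih
    have hn : ‖((n : ℂ) + 1)‖ = n + 1 := by
      rw [← Nat.cast_succ, Complex.norm_natCast]; simp
    refine ⟨(n + 1) * (C * K + K), by positivity, fun V hV => ?_, fun V W hV hW => ?_⟩
    · rw [gaussMoment, norm_mul, norm_mul, hn, mul_assoc]
      refine mul_le_mul_of_nonneg_left ?_ (by positivity)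
      have := mul_le_mul hV (h1 V hV) (norm_nonneg _) hC
      linarith
    · have : gaussMoment (n + 2) V - gaussMoment (n + 2) W = (n + 1) *
          (V * (gaussMoment n V - gaussMoment n W) + (V - W) * gaussMoment n W) := by
        simp only [gaussMoment]; ring
      rw [this, norm_mul, hn, mul_assoc]
      refine mul_le_mul_of_nonneg_left ((norm_add_le _ _).trans ?_) (by positivity)
      rw [norm_mul, norm_mul]
      have e1 := mul_le_mul hV (h2 V W hV hW) (norm_nonneg _) hC
      have e2 := mul_le_mul_of_nonneg_left (h1 W hW) (norm_nonneg (V - W))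
      nlinarith

lemma gaussMoment_two_mul (n : ℕ) (V : ℂ) :
    gaussMoment (2 * n) V = ((2 * n)! : ℂ) / (2 ^ n * (n ! : ℂ)) * V ^ n := by
  induction n with
  | zero => simp [gaussMoment]
  | succ n ih =>
    have h1 : ((n ! : ℕ) : ℂ) ≠ 0 := by exact_mod_cast n.factorial_ne_zero
    have h2 : ((n : ℂ) + 1) ≠ 0 := by exact_mod_cast n.succ_ne_zero
    rw [show 2 * (n + 1) = 2 * n + 2 from rfl, gaussMoment, ih, Nat.factorial_succ (2 * n + 1),
      Nat.factorial_succ (2 * n), Nat.factorial_succ n]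
    push_cast
    field_simp
    ring

lemma gaussMoment_odd {n : ℕ} (hn : Odd n) (V : ℂ) : gaussMoment n V = 0 := by
  obtain ⟨k, rfl⟩ := hn
  induction k with
  | zero => rfl
  | succ k ih => rw [show 2 * (k + 1) + 1 = 2 * k + 1 + 2 from rfl, gaussMoment, ih, mul_zero]

/-- A family of independent centred elements, with small variances `≤ v i` and small higher moments
`≤ e i`, with respect to a normalised functional. -/
structure IsSmallIndepFamily {A ι : Type*} [CommRing A] [DecidableEq ι] (E : A →+ ℂ) (X : ι → A)
    (S : Finset ι) (v e : ι → ℝ) (C ε : ℝ) (m : ℕ) : Prop where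
  map_one : E 1 = 1
  indep : ∀ s ⊆ S, ∀ i ∈ S, i ∉ s → ∀ p q : ℕ,
    E (X i ^ p * (∑ j ∈ s, X j) ^ q) = E (X i ^ p) * E ((∑ j ∈ s, X j) ^ q)
  mean_zero : ∀ i ∈ S, E (X i) = 0
  norm_two : ∀ i ∈ S, ‖E (X i ^ 2)‖ ≤ v i
  le_eps : ∀ i ∈ S, v i ≤ ε
  sum_two : ∑ i ∈ S, v i ≤ C
  norm_high : ∀ i ∈ S, ∀ l, 3 ≤ l → l ≤ m → ‖E (X i ^ l)‖ ≤ e i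
  sum_high : ∑ i ∈ S, e i ≤ ε
  high_nonneg : ∀ i ∈ S, 0 ≤ e i
  eps_nonneg : 0 ≤ ε
  eps_le : ε ≤ 1

/-- Write `S ^ (q+2) = ∑ X_i S ^ (q+1)` and expand `S = X_i + S'` with `S'` independent of `X_i`.
The term linear in `X_i` has mean zero, the quadratic one reproduces the Gaussian recursion, and the
others involve moments of order at least three. -/
lemma moment_recursion {A ι : Type*} [CommRing A] [DecidableEq ι] {E : A →+ ℂ} {X : ι → A}
    {S : Finset ι} {v e : ι → ℝ} {C ε : ℝ} {m : ℕ} (h : IsSmallIndepFamily E X S v e C ε m)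
    {s : Finset ι} (hs : s ⊆ S) (q : ℕ) :
    E ((∑ j ∈ s, X j) ^ (q + 2)) = ∑ i ∈ s, (((q : ℂ) + 1) * E (X i ^ 2) *
        E ((∑ j ∈ s.erase i, X j) ^ q) +
      ∑ p ∈ Finset.range q, ((q + 1).choose (p + 2) : ℂ) * E (X i ^ (p + 3)) *
        E ((∑ j ∈ s.erase i, X j) ^ (q + 1 - (p + 2)))) := by
  rw [pow_succ, mul_comm, Finset.sum_mul, map_sum]
  refine Finset.sum_congr rfl fun i hi => ?_
  have hstep : X i * (∑ j ∈ s, X j) ^ (q + 1) = ∑ p ∈ Finset.range (q + 2),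
      (q + 1).choose p • (X i ^ (p + 1) * (∑ j ∈ s.erase i, X j) ^ (q + 1 - p)) := by
    rw [← Finset.add_sum_erase _ _ hi, add_pow, Finset.mul_sum]
    refine Finset.sum_congr rfl fun p _ => ?_
    rw [nsmul_eq_mul]; ring
  have hE : ∀ p k : ℕ, E (X i ^ p * (∑ j ∈ s.erase i, X j) ^ k) =
      E (X i ^ p) * E ((∑ j ∈ s.erase i, X j) ^ k) := fun p k =>
    h.indep _ ((Finset.erase_subset _ _).trans hs) i (hs hi) (Finset.notMem_erase _ _) p k
  have hterm : ∀ p, E ((q + 1).choose p • (X i ^ (p + 1) *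
      (∑ j ∈ s.erase i, X j) ^ (q + 1 - p))) = ((q + 1).choose p : ℂ) * E (X i ^ (p + 1)) *
        E ((∑ j ∈ s.erase i, X j) ^ (q + 1 - p)) := fun p => by
    rw [map_nsmul, hE, nsmul_eq_mul, mul_assoc]
  rw [hstep, map_sum, Finset.sum_congr rfl fun p _ => hterm p, Finset.sum_range_succ',
    Finset.sum_range_succ', zero_add, pow_one, h.mean_zero i (hs hi), mul_zero, zero_mul, add_zero,
    add_comm]
  simp

/-- The moments of a sum of independent small elements are close to Gaussian moments. -/
lemma moment_close_gaussMoment {A ι : Type*} [CommRing A] [DecidableEq ι] (E : A →+ ℂ) {C : ℝ}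
    (hC : 0 ≤ C) (m : ℕ) :
    ∃ K : ℝ, 0 ≤ K ∧ ∀ (X : ι → A) (S : Finset ι) (v e : ι → ℝ) (ε : ℝ),
      IsSmallIndepFamily E X S v e C ε m → ∀ s ⊆ S, ∀ j ≤ m,
        ‖E ((∑ i ∈ s, X i) ^ j) - gaussMoment j (∑ i ∈ s, E (X i ^ 2))‖ ≤ K * ε := by
  -- The induction keeps one constant for all subsets `s` and all orders up to `q`, since the
  -- recursion passes to `s.erase i` and to several lower orders.
  suffices H : ∀ q : ℕ, ∃ K : ℝ, 0 ≤ K ∧ ∀ (X : ι → A) (S : Finset ι) (v e : ι → ℝ) (ε : ℝ),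
      IsSmallIndepFamily E X S v e C ε m → ∀ s ⊆ S, ∀ j ≤ q, j ≤ m →
        ‖E ((∑ i ∈ s, X i) ^ j) - gaussMoment j (∑ i ∈ s, E (X i ^ 2))‖ ≤ K * ε by
    obtain ⟨K, hK, h⟩ := H m
    exact ⟨K, hK, fun X S v e ε hX s hs j hj => h X S v e ε hX s hs j hj hj⟩
  choose G hG0 hGb hGl using fun q => gaussMoment_bounds q hC
  have hV : ∀ (X : ι → A) (S : Finset ι) (v e : ι → ℝ) (ε : ℝ),
      IsSmallIndepFamily E X S v e C ε m → ∀ s ⊆ S, ∑ i ∈ s, v i ≤ C ∧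
        ‖∑ i ∈ s, E (X i ^ 2)‖ ≤ C := by
    intro X S v e ε h s hs
    have h1 : ∑ i ∈ s, v i ≤ C := (Finset.sum_le_sum_of_subset_of_nonneg hs fun i hi _ =>
      (norm_nonneg _).trans (h.norm_two i hi)).trans h.sum_two
    exact ⟨h1, (norm_sum_le _ _).trans ((Finset.sum_le_sum fun i hi =>
      h.norm_two i (hs hi)).trans h1)⟩
  intro q
  induction q with
  | zero =>
    refine ⟨0, le_rfl, fun X S v e ε h s hs j hj _ => ?_⟩
    obtain rfl : j = 0 := by omega
    simp [gaussMoment, h.map_one]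
  | succ q ih =>
    obtain ⟨K, hK, hq⟩ := ih
    rcases q with _ | q
    · refine ⟨0, le_rfl, fun X S v e ε h s hs j hj _ => ?_⟩
      obtain rfl | rfl : j = 0 ∨ j = 1 := by omega
      · simp [gaussMoment, h.map_one]
      · simp only [pow_one, map_sum, gaussMoment]
        rw [Finset.sum_eq_zero fun i hi => h.mean_zero i (hs hi)]; simp
    set B : ℝ := ∑ j ∈ Finset.range (q + 2), (K + G j) with hB
    have hB0 : ∀ j < q + 2, K + G j ≤ B := fun j hj =>
      Finset.single_le_sum (f := fun j => K + G j) (fun i _ => add_nonneg hK (hG0 i))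
        (Finset.mem_range.2 hj)
    have hBnn : 0 ≤ B := Finset.sum_nonneg fun i _ => add_nonneg hK (hG0 i)
    set K' : ℝ := (q + 1) * C * (K + G q) + q * (2 ^ (q + 1) * B) with hK'
    have hK'0 : 0 ≤ K' := by
      have := hG0 q
      rw [hK']; positivity
    refine ⟨K + K', by positivity, fun X S v e ε h s hs j hj hjm => ?_⟩
    have hε := h.eps_nonneg
    rcases Nat.lt_or_ge j (q + 2) with hlt | hge
    · refine (hq X S v e ε h s hs j (by omega) hjm).trans ?_
      exact mul_le_mul_of_nonneg_right (by linarith) hε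
    obtain rfl : j = q + 2 := by omega
    have hbd : ∀ i ∈ s, ∀ j < q + 2, ‖E ((∑ k ∈ s.erase i, X k) ^ j)‖ ≤ B := by
      intro i hi j hj
      have hsub : s.erase i ⊆ S := (Finset.erase_subset _ _).trans hs
      have e1 := hq X S v e ε h _ hsub j (by omega) (by omega)
      have e2 := hGb j _ (hV X S v e ε h _ hsub).2
      refine (norm_le_norm_sub_add _ (gaussMoment j (∑ i ∈ s.erase i, E (X i ^ 2)))).trans ?_
      have := hB0 j hj
      have : K * ε ≤ K := mul_le_of_le_one_right hK h.eps_le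
      linarith
    -- Dropping `i` shifts the variance by at most `ε`; the factor `v i` keeps the sum over `i` of
    -- order `C ε`.
    have hmain : ∀ i ∈ s, ‖((q : ℂ) + 1) * E (X i ^ 2) * E ((∑ j ∈ s.erase i, X j) ^ q) -
        ((q : ℂ) + 1) * E (X i ^ 2) * gaussMoment q (∑ i ∈ s, E (X i ^ 2))‖ ≤
        (q + 1) * v i * ((K + G q) * ε) := by
      intro i hi
      have hsub : s.erase i ⊆ S := (Finset.erase_subset _ _).trans hs
      have e1 := hq X S v e ε h _ hsub q (by omega) (by omega)
      have e2 := hGl q (∑ i ∈ s.erase i, E (X i ^ 2)) (∑ i ∈ s, E (X i ^ 2))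
        (hV X S v e ε h _ hsub).2 (hV X S v e ε h _ hs).2
      have e3 : ‖∑ i ∈ s.erase i, E (X i ^ 2) - ∑ i ∈ s, E (X i ^ 2)‖ ≤ ε := by
        rw [← Finset.add_sum_erase _ _ hi, sub_add_cancel_right, norm_neg]
        exact (h.norm_two i (hs hi)).trans (h.le_eps i (hs hi))
      have e4 := mul_le_mul_of_nonneg_left e3 (hG0 q)
      have hn : ‖((q : ℂ) + 1)‖ = q + 1 := by
        rw [← Nat.cast_succ, Complex.norm_natCast]; simp
      rw [← mul_sub, norm_mul, norm_mul, hn]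
      refine mul_le_mul (mul_le_mul_of_nonneg_left (h.norm_two i (hs hi)) (by positivity)) ?_
        (norm_nonneg _) (mul_nonneg (by positivity) ((norm_nonneg _).trans (h.norm_two i (hs hi))))
      refine (norm_sub_le_norm_sub_add_norm_sub _
        (gaussMoment q (∑ i ∈ s.erase i, E (X i ^ 2))) _).trans ?_
      linarith
    -- The bounds `e i` add up to at most `ε`, so bounded lower moments suffice here.
    have hrest : ∀ i ∈ s, ‖∑ p ∈ Finset.range q, ((q + 1).choose (p + 2) : ℂ) * E (X i ^ (p + 3)) *
        E ((∑ j ∈ s.erase i, X j) ^ (q + 1 - (p + 2)))‖ ≤ q * (2 ^ (q + 1) * B) * e i := by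
      intro i hi
      refine (norm_sum_le_of_le _ (f := fun p => ((q + 1).choose (p + 2) : ℂ) * E (X i ^ (p + 3)) *
        E ((∑ j ∈ s.erase i, X j) ^ (q + 1 - (p + 2)))) (n := fun _ => 2 ^ (q + 1) * e i * B)
        fun p hp => ?_).trans ?_
      · have hp' := Finset.mem_range.1 hp
        rw [norm_mul, norm_mul, Complex.norm_natCast]
        refine mul_le_mul (mul_le_mul ?_ (h.norm_high i (hs hi) _ (by omega) (by omega))
          (norm_nonneg _) (by positivity)) (hbd i hi _ (by omega)) (norm_nonneg _)
          (mul_nonneg (by positivity) (h.high_nonneg i (hs hi)))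
        exact_mod_cast Nat.choose_le_two_pow _ _
      · rw [Finset.sum_const, Finset.card_range, nsmul_eq_mul]
        exact le_of_eq (by ring)
    rw [moment_recursion h hs, gaussMoment]
    have hsplit : ∑ i ∈ s, (((q : ℂ) + 1) * E (X i ^ 2) *
        E ((∑ j ∈ s.erase i, X j) ^ q) +
      ∑ p ∈ Finset.range q, ((q + 1).choose (p + 2) : ℂ) * E (X i ^ (p + 3)) *
        E ((∑ j ∈ s.erase i, X j) ^ (q + 1 - (p + 2)))) -
      ((q : ℂ) + 1) * (∑ i ∈ s, E (X i ^ 2)) * gaussMoment q (∑ i ∈ s, E (X i ^ 2)) =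
      ∑ i ∈ s, ((((q : ℂ) + 1) * E (X i ^ 2) * E ((∑ j ∈ s.erase i, X j) ^ q) -
        ((q : ℂ) + 1) * E (X i ^ 2) * gaussMoment q (∑ i ∈ s, E (X i ^ 2))) +
        ∑ p ∈ Finset.range q, ((q + 1).choose (p + 2) : ℂ) * E (X i ^ (p + 3)) *
        E ((∑ j ∈ s.erase i, X j) ^ (q + 1 - (p + 2)))) := by
      rw [Finset.mul_sum, Finset.sum_mul, ← Finset.sum_sub_distrib]
      exact Finset.sum_congr rfl fun i _ => by ring
    rw [hsplit]
    refine (norm_sum_le_of_le _ fun i hi => (norm_add_le _ _).trans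
      (add_le_add (hmain i hi) (hrest i hi))).trans ?_
    rw [Finset.sum_add_distrib, ← Finset.mul_sum, ← Finset.sum_mul, ← Finset.mul_sum]
    have f1 : ∑ i ∈ s, e i ≤ ε :=
      (Finset.sum_le_sum_of_subset_of_nonneg hs fun i hi _ => h.high_nonneg i hi).trans h.sum_high
    have f2 := (hV X S v e ε h s hs).1
    have f3 : (q * (2 ^ (q + 1) * B)) * ∑ i ∈ s, e i ≤ (q * (2 ^ (q + 1) * B)) * ε :=
      mul_le_mul_of_nonneg_left f1 (by positivity)
    have f4 : ((q : ℝ) + 1) * (∑ i ∈ s, v i) * ((K + G q) * ε) ≤ (q + 1) * C * ((K + G q) * ε) := by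
      have := hG0 q
      gcongr
    have f5 := mul_nonneg hK hε
    rw [hK']
    nlinarith

/-! ### Constant terms of trigonometric polynomials -/

/-- The constant term of a trigonometric polynomial. -/
def constTerm : AddMonoidAlgebra ℂ ℝ →+ ℂ where
  toFun f := f.coeff 0
  map_zero' := rfl
  map_add' _ _ := rfl

lemma constTerm_apply (f : AddMonoidAlgebra ℂ ℝ) : constTerm f = f.coeff 0 := rfl

lemma constTerm_one : constTerm 1 = 1 := by
  simp [constTerm_apply]

/-- All frequencies of `f` lie in `G`. -/
def SuppIn (G : Submodule ℤ ℝ) (f : AddMonoidAlgebra ℂ ℝ) : Prop := ∀ x, f.coeff x ≠ 0 → x ∈ G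

lemma SuppIn.add {G : Submodule ℤ ℝ} {f g : AddMonoidAlgebra ℂ ℝ} (hf : SuppIn G f)
    (hg : SuppIn G g) : SuppIn G (f + g) := by
  intro x hx
  by_cases h : f.coeff x = 0
  · refine hg x fun h' => hx ?_
    rw [AddMonoidAlgebra.coeff_add, Finsupp.add_apply, h, h', add_zero]
  · exact hf x h

lemma SuppIn.zero (G : Submodule ℤ ℝ) : SuppIn G 0 := fun _ hx => absurd rfl hx

lemma SuppIn.single {G : Submodule ℤ ℝ} {x : ℝ} (hx : x ∈ G) (c : ℂ) :
    SuppIn G (AddMonoidAlgebra.single x c) := by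
  classical
  intro y hy
  rw [AddMonoidAlgebra.coeff_single, Finsupp.single_apply] at hy
  have : x = y := by
    by_contra h
    simp [h] at hy
  rwa [← this]

lemma SuppIn.sum {κ : Type*} {G : Submodule ℤ ℝ} {s : Finset κ} {f : κ → AddMonoidAlgebra ℂ ℝ}
    (hf : ∀ i ∈ s, SuppIn G (f i)) : SuppIn G (∑ i ∈ s, f i) :=
  Finset.sum_induction _ (SuppIn G) (fun _ _ => SuppIn.add) (SuppIn.zero G) hf

lemma SuppIn.mul {G : Submodule ℤ ℝ} {f g : AddMonoidAlgebra ℂ ℝ} (hf : SuppIn G f)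
    (hg : SuppIn G g) : SuppIn G (f * g) := by
  intro x hx
  rw [AddMonoidAlgebra.coeff_mul_apply_left] at hx
  obtain ⟨a, ha, hne⟩ := Finset.exists_ne_zero_of_sum_ne_zero hx
  have h1 := hf a (Finsupp.mem_support_iff.1 ha)
  have h2 := hg _ (right_ne_zero_of_mul hne)
  have := G.add_mem h1 h2
  simpa using this

lemma SuppIn.pow {G : Submodule ℤ ℝ} {f : AddMonoidAlgebra ℂ ℝ} (hf : SuppIn G f) (n : ℕ) :
    SuppIn G (f ^ n) := by
  induction n with
  | zero =>
    rw [pow_zero, AddMonoidAlgebra.one_def]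
    exact SuppIn.single G.zero_mem 1
  | succ n ih => rw [pow_succ]; exact ih.mul hf

lemma SuppIn.mono {G H : Submodule ℤ ℝ} (h : G ≤ H) {f : AddMonoidAlgebra ℂ ℝ} (hf : SuppIn G f) :
    SuppIn H f := fun x hx => h (hf x hx)

/-- Two opposite frequencies, one from each factor, both lie in `G ∩ H = 0`, so only the product of
the constant terms remains. -/
lemma constTerm_mul_of_disjoint {G H : Submodule ℤ ℝ} (hGH : Disjoint G H)
    {f g : AddMonoidAlgebra ℂ ℝ} (hf : SuppIn G f) (hg : SuppIn H g) :
    constTerm (f * g) = constTerm f * constTerm g := by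
  rw [constTerm_apply, AddMonoidAlgebra.coeff_mul_apply_left, Finsupp.sum, Finset.sum_eq_single 0]
  · simp [constTerm_apply]
  · intro a ha hne
    by_contra hprod
    have h1 := hf a (Finsupp.mem_support_iff.1 ha)
    have h2 := hg _ (right_ne_zero_of_mul hprod)
    rw [add_zero] at h2
    exact hne (Submodule.disjoint_def.1 hGH a h1 (by simpa using H.neg_mem h2))
  · intro h
    rw [Finsupp.notMem_support_iff.1 h, zero_mul]

/-- `∑ c(nd) e(nd)` over `|n| ≤ N`. -/
def multSum (c : ℝ → ℂ) (N : ℕ) (d : ℝ) : AddMonoidAlgebra ℂ ℝ :=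
  ∑ n ∈ Finset.Icc (-(N : ℤ)) N, AddMonoidAlgebra.single ((n : ℝ) * d) (c (n * d))

lemma suppIn_multSum (c : ℝ → ℂ) (N : ℕ) (d : ℝ) :
    SuppIn (Submodule.span ℤ {d}) (multSum c N d) := by
  refine SuppIn.sum fun n _ => SuppIn.single ?_ _
  have := (Submodule.span ℤ {d}).smul_mem n (Submodule.mem_span_singleton_self d)
  rwa [zsmul_eq_mul] at this

/-- Linear independence makes the span of `d i` disjoint from the span of the other `d j`, which is
where the frequencies live. -/
lemma multSum_indep {ι : Type*} {d : ι → ℝ} (hd : LinearIndependent ℤ d) (c : ℝ → ℂ) (N : ℕ)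
    (s : Finset ι) (i : ι) (hi : i ∉ s) (p q : ℕ) :
    constTerm (multSum c N (d i) ^ p * (∑ j ∈ s, multSum c N (d j)) ^ q) =
      constTerm (multSum c N (d i) ^ p) * constTerm ((∑ j ∈ s, multSum c N (d j)) ^ q) := by
  have hdis : Disjoint ({i} : Set ι) (s : Set ι) := by
    rw [Set.disjoint_singleton_left]; simpa using hi
  have h := hd.disjoint_span_image hdis
  rw [Set.image_singleton] at h
  refine constTerm_mul_of_disjoint h ((suppIn_multSum c N (d i)).pow p) (SuppIn.pow ?_ q)
  exact SuppIn.sum fun j hj => (suppIn_multSum c N (d j)).mono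
    (Submodule.span_mono (Set.singleton_subset_iff.2 (Set.mem_image_of_mem d (Finset.mem_coe.2 hj))))

lemma norm_coeff_mul_sum_single_le {κ : Type*} (I : Finset κ) (x : κ → ℝ) (y : κ → ℂ)
    {h : AddMonoidAlgebra ℂ ℝ} {B : ℝ} (hB : ∀ s, ‖h.coeff s‖ ≤ B) (s : ℝ) :
    ‖(h * ∑ i ∈ I, AddMonoidAlgebra.single (x i) (y i)).coeff s‖ ≤ B * ∑ i ∈ I, ‖y i‖ := by
  rw [Finset.mul_sum, AddMonoidAlgebra.coeff_sum, Finsupp.finsetSum_apply, Finset.mul_sum]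
  refine norm_sum_le_of_le _ fun i _ => ?_
  rw [AddMonoidAlgebra.coeff_mul_single_apply, norm_mul]
  exact mul_le_mul_of_nonneg_right (hB _) (norm_nonneg _)

/-- The inequality of arithmetic and geometric means for `ab`, `bc`, `ac`. -/
lemma mul_mul_le_cubes {a b c : ℝ} (ha : 0 ≤ a) (hb : 0 ≤ b) (hc : 0 ≤ c) :
    a ^ 2 * b ^ 2 * c ^ 2 ≤ (a ^ 3 * b ^ 3 + b ^ 3 * c ^ 3 + a ^ 3 * c ^ 3) / 3 := by
  have key : ∀ p q r : ℝ, 0 ≤ p → 0 ≤ q → 0 ≤ r → p * q * r ≤ (p ^ 3 + q ^ 3 + r ^ 3) / 3 := by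
    intro p q r hp hq hr
    nlinarith [mul_nonneg (add_nonneg (add_nonneg hp hq) hr)
      (add_nonneg (add_nonneg (sq_nonneg (p - q)) (sq_nonneg (q - r))) (sq_nonneg (p - r)))]
  have := key (a * b) (b * c) (a * c) (by positivity) (by positivity) (by positivity)
  nlinarith

/-- Young's inequality for a triple convolution, in the case of the exponent `3 / 2`. -/
lemma norm_coeff_cube_le {κ : Type*} [DecidableEq κ] (I : Finset κ) (x : κ → ℝ) (y : κ → ℂ)
    (hx : Set.InjOn x I) (s : ℝ) :
    ‖((∑ i ∈ I, AddMonoidAlgebra.single (x i) (y i)) ^ 3).coeff s‖ ≤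
      (∑ i ∈ I, √‖y i‖ ^ 3) ^ 2 := by
  classical
  have h1 : ((∑ i ∈ I, AddMonoidAlgebra.single (x i) (y i)) ^ 3).coeff s =
      ∑ i ∈ I, ∑ j ∈ I, ∑ k ∈ I, if x i + x j + x k = s then y i * y j * y k else 0 := by
    rw [pow_three', Finset.sum_mul_sum, Finset.sum_mul, AddMonoidAlgebra.coeff_sum,
      Finsupp.finsetSum_apply]
    refine Finset.sum_congr rfl fun i _ => ?_
    rw [Finset.sum_mul_sum, AddMonoidAlgebra.coeff_sum, Finsupp.finsetSum_apply]
    refine Finset.sum_congr rfl fun j _ => ?_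
    rw [AddMonoidAlgebra.coeff_sum, Finsupp.finsetSum_apply]
    refine Finset.sum_congr rfl fun k _ => ?_
    rw [AddMonoidAlgebra.single_mul_single, AddMonoidAlgebra.single_mul_single,
      AddMonoidAlgebra.coeff_single, Finsupp.single_apply]
  -- Injectivity of `x`: in `x i + x j + x k = s` any two of the indices determine the third.
  have hcount : ∀ u : ℝ, ∀ a : ℝ, 0 ≤ a → ∑ k ∈ I, (if x k = u then a else 0) ≤ a := by
    intro u a ha
    by_cases hk : ∃ k ∈ I, x k = u
    · obtain ⟨k, hkI, hku⟩ := hk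
      rw [Finset.sum_eq_single k]
      · rw [if_pos hku]
      · intro l hl hlk
        rw [if_neg fun h => hlk (hx hl hkI (h.trans hku.symm))]
      · exact fun h => absurd hkI h
    · push Not at hk
      rw [Finset.sum_eq_zero fun k hkI => if_neg (hk k hkI)]
      exact ha
  -- With `|y i| = r i ^ 2` the product of three coefficients is bounded by products of only two
  -- cubes, and the free third index is then counted once.
  set r : κ → ℝ := fun i => √‖y i‖ with hr
  have hr0 : ∀ i, 0 ≤ r i := fun i => Real.sqrt_nonneg _
  have hr2 : ∀ i, ‖y i‖ = r i ^ 2 := fun i => (Real.sq_sqrt (norm_nonneg _)).symm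
  set Q := ∑ i ∈ I, r i ^ 3 with hQ
  have hQQ : ∑ i ∈ I, ∑ j ∈ I, r i ^ 3 * r j ^ 3 = Q ^ 2 := by
    rw [sq, hQ, Finset.sum_mul_sum]
  have b1 : ∑ i ∈ I, ∑ j ∈ I, ∑ k ∈ I, (if x i + x j + x k = s then r i ^ 3 * r j ^ 3 else 0)
      ≤ Q ^ 2 := by
    rw [← hQQ]
    refine Finset.sum_le_sum fun i _ => Finset.sum_le_sum fun j _ => ?_
    have := hcount (s - x i - x j) (r i ^ 3 * r j ^ 3)
      (mul_nonneg (pow_nonneg (hr0 i) 3) (pow_nonneg (hr0 j) 3))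
    refine le_trans (le_of_eq (Finset.sum_congr rfl fun k _ => ?_)) this
    exact if_congr ⟨fun h => by linarith, fun h => by linarith⟩ rfl rfl
  have b2 : ∑ i ∈ I, ∑ j ∈ I, ∑ k ∈ I, (if x i + x j + x k = s then r j ^ 3 * r k ^ 3 else 0)
      ≤ Q ^ 2 := by
    refine le_trans (le_of_eq ?_) b1
    rw [Finset.sum_comm]
    refine Finset.sum_congr rfl fun j _ => ?_
    rw [Finset.sum_comm]
    refine Finset.sum_congr rfl fun i _ => Finset.sum_congr rfl fun k _ => ?_
    exact if_congr ⟨fun h => by linarith, fun h => by linarith⟩ rfl rfl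
  have b3 : ∑ i ∈ I, ∑ j ∈ I, ∑ k ∈ I, (if x i + x j + x k = s then r i ^ 3 * r k ^ 3 else 0)
      ≤ Q ^ 2 := by
    refine le_trans (le_of_eq ?_) b1
    refine Finset.sum_congr rfl fun i _ => ?_
    rw [Finset.sum_comm]
    refine Finset.sum_congr rfl fun j _ => Finset.sum_congr rfl fun k _ => ?_
    exact if_congr ⟨fun h => by linarith, fun h => by linarith⟩ rfl rfl
  have hsplit : ‖((∑ i ∈ I, AddMonoidAlgebra.single (x i) (y i)) ^ 3).coeff s‖ ≤
      ∑ i ∈ I, ∑ j ∈ I, ∑ k ∈ I,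
        ((if x i + x j + x k = s then r i ^ 3 * r j ^ 3 else 0) +
        (if x i + x j + x k = s then r j ^ 3 * r k ^ 3 else 0) +
        (if x i + x j + x k = s then r i ^ 3 * r k ^ 3 else 0)) / 3 := by
    rw [h1]
    refine norm_sum_le_of_le _ fun i _ => norm_sum_le_of_le _ fun j _ =>
      norm_sum_le_of_le _ fun k _ => ?_
    split_ifs
    · rw [norm_mul, norm_mul, hr2, hr2, hr2]
      exact mul_mul_le_cubes (hr0 i) (hr0 j) (hr0 k)
    · simp
  refine hsplit.trans ?_
  simp only [← Finset.sum_div, Finset.sum_add_distrib]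
  linarith

/-- Three factors are estimated by the `3/2` norm and each further factor by the `ℓ¹` norm. The
induction runs over all coefficients, as multiplication by a further factor shifts frequencies. -/
lemma norm_constTerm_pow_le {κ : Type*} [DecidableEq κ] (I : Finset κ) (x : κ → ℝ) (y : κ → ℂ)
    (hx : Set.InjOn x I) {l : ℕ} (hl : 3 ≤ l) :
    ‖constTerm ((∑ i ∈ I, AddMonoidAlgebra.single (x i) (y i)) ^ l)‖ ≤
      (∑ i ∈ I, √‖y i‖ ^ 3) ^ 2 * (∑ i ∈ I, ‖y i‖) ^ (l - 3) := by
  obtain ⟨k, rfl⟩ := Nat.exists_eq_add_of_le hl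
  rw [Nat.add_sub_cancel_left, constTerm_apply]
  generalize (0 : ℝ) = s
  induction k generalizing s with
  | zero => simpa using norm_coeff_cube_le I x y hx s
  | succ k ih =>
    rw [← add_assoc, pow_succ, pow_succ _ k, ← mul_assoc]
    exact norm_coeff_mul_sum_single_le I x y (fun s => ih (by omega) s) s

/-! ### Sums compared with integrals -/

lemma sum_Icc_neg_eq {M : Type*} [AddCommMonoid M] (N : ℕ) (g : ℤ → M) :
    ∑ n ∈ Finset.Icc (-(N : ℤ)) N, g n =
      g 0 + ∑ n ∈ Finset.range N, (g (n + 1) + g (-(n + 1))) := by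
  induction N with
  | zero => simp
  | succ N ih =>
    have : Finset.Icc (-((N + 1 : ℕ) : ℤ)) (N + 1 : ℕ) =
        insert ((N : ℤ) + 1) (insert (-((N : ℤ) + 1)) (Finset.Icc (-(N : ℤ)) N)) := by
      ext n; simp only [Finset.mem_Icc, Finset.mem_insert]; push_cast; omega
    rw [this, Finset.sum_insert, Finset.sum_insert, ih, Finset.sum_range_succ]
    · abel
    · simp
    · simp only [Finset.mem_insert, Finset.mem_Icc]; omega

/-- Comparison of a sum of a decreasing function with a primitive. -/
lemma sum_le_of_primitive {F f : ℝ → ℝ} {C d : ℝ} (hd : 0 < d)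
    (hcont : ContinuousOn F (Set.Ici 0)) (hderiv : ∀ t, 0 < t → HasDerivAt F (f t) t)
    (hanti : ∀ s t, 0 < s → s ≤ t → f t ≤ f s) (h0 : 0 ≤ F 0) (hC : ∀ t, 0 ≤ t → F t ≤ C) (N : ℕ) :
    ∑ n ∈ Finset.range N, f ((n + 1) * d) ≤ C / d := by
  -- Mean value theorem on each interval of length `d`, then telescoping. Continuity of `F` at `0`
  -- suffices, so `f` may be singular there.
  have hstep : ∀ n : ℕ, f ((n + 1) * d) * d ≤ F ((n + 1 : ℕ) * d) - F (n * d) := by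
    intro n
    have hlt : (n : ℝ) * d < (n + 1 : ℕ) * d := by push_cast; nlinarith
    have hn0 : 0 ≤ (n : ℝ) * d := by positivity
    obtain ⟨c, hc, he⟩ := exists_hasDerivAt_eq_slope F f hlt
      (hcont.mono fun t ht => hn0.trans ht.1) fun t ht => hderiv t (hn0.trans_lt ht.1)
    have h2 := hanti c ((n + 1) * d) (hn0.trans_lt hc.1) (by have := hc.2.le; push_cast at this; exact this)
    have hdd : ((n + 1 : ℕ) : ℝ) * d - n * d = d := by push_cast; ring
    rw [hdd, eq_div_iff hd.ne'] at he
    rw [← he]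
    exact mul_le_mul_of_nonneg_right h2 hd.le
  rw [le_div_iff₀ hd, Finset.sum_mul]
  refine (Finset.sum_le_sum fun n _ => hstep n).trans ?_
  rw [Finset.sum_range_sub (fun n : ℕ => F (n * d))]
  have := hC (N * d) (by positivity)
  simp only [Nat.cast_zero, zero_mul]
  linarith

lemma sum_inv_sqrt_mul_add_le {d B : ℝ} (hd : 0 < d) (hB : 0 < B) (N : ℕ) :
    ∑ n ∈ Finset.range N, 1 / (√((n + 1) * d) * ((n + 1) * d + B)) ≤ Real.pi / √B / d := by
  refine sum_le_of_primitive (F := fun t => 2 / √B * Real.arctan (√t / √B))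
    (f := fun t => 1 / (√t * (t + B))) hd ?_ ?_ ?_ ?_ ?_ N
  · fun_prop
  · intro t ht
    have h := (((Real.hasDerivAt_sqrt ht.ne').div_const (√B)).arctan).const_mul (2 / √B)
    refine h.congr_deriv ?_
    have h1 : 0 < √t := Real.sqrt_pos.2 ht
    have h2 : 0 < √B := Real.sqrt_pos.2 hB
    rw [div_pow, Real.sq_sqrt ht.le, Real.sq_sqrt hB.le]
    field_simp
    rw [Real.sq_sqrt hB.le]
    ring
  · intro s t hs hst
    have h1 : 0 < √s := Real.sqrt_pos.2 hs
    have h2 := Real.sqrt_le_sqrt hst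
    gcongr
  · simp
  · intro t _
    have := (Real.arctan_lt_pi_div_two (√t / √B)).le
    calc _ ≤ 2 / √B * (Real.pi / 2) := by gcongr
      _ = _ := by ring

/-- With `s = t^(1/4)` and `b = B^(1/4)`, the summand `t^(-3/4) (t+B)^(-3/2)` is dominated by `2 /
(s³ b⁴ (s² + b²))`, which has the bounded primitive `8 b⁻⁵ arctan (s / b)`. -/
lemma sum_inv_sqrt_sqrt_cube_le {d B : ℝ} (hd : 0 < d) (hB : 0 < B) (N : ℕ) :
    ∑ n ∈ Finset.range N, √(1 / (√((n + 1) * d) * ((n + 1) * d + B))) ^ 3 ≤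
      4 * Real.pi / √√B ^ 5 / d := by
  set b := √√B with hb
  have hsB : 0 < √B := Real.sqrt_pos.2 hB
  have hb0 : 0 < b := Real.sqrt_pos.2 hsB
  have hb2 : b ^ 2 = √B := Real.sq_sqrt hsB.le
  have hb4 : b ^ 4 = B := by
    rw [show b ^ 4 = (b ^ 2) ^ 2 by ring, hb2, Real.sq_sqrt hB.le]
  have hle : ∀ t : ℝ, 0 < t → √(1 / (√t * (t + B))) ^ 3 ≤
      8 / b ^ 5 * (b / (4 * √√t ^ 3 * (√√t ^ 2 + b ^ 2))) := by
    intro t ht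
    set s := √√t with hs
    have hst : 0 < √t := Real.sqrt_pos.2 ht
    have hs0 : 0 < s := Real.sqrt_pos.2 hst
    have hs2 : s ^ 2 = √t := Real.sq_sqrt hst.le
    have h1 : √(1 / (√t * (t + B))) = 1 / (s * √(t + B)) := by
      rw [Real.sqrt_div zero_le_one, Real.sqrt_one, Real.sqrt_mul hst.le]
    set r := √(t + B) with hr
    have hr0 : 0 < r := Real.sqrt_pos.2 (by linarith)
    have hr1 : s ^ 2 ≤ r := by rw [hs2]; exact Real.sqrt_le_sqrt (by linarith)
    have hr2 : b ^ 2 ≤ r := by rw [hb2]; exact Real.sqrt_le_sqrt (by linarith)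
    have hr3 : b ^ 4 ≤ r ^ 2 := by
      rw [hb4, hr, Real.sq_sqrt (by linarith)]; linarith
    have h3 : b ^ 4 * (s ^ 2 + b ^ 2) ≤ 2 * r ^ 3 := by
      calc _ ≤ r ^ 2 * (r + r) := by gcongr
        _ = _ := by ring
    rw [h1, div_pow, one_pow, mul_pow]
    have e : 8 / b ^ 5 * (b / (4 * s ^ 3 * (s ^ 2 + b ^ 2))) =
        2 / (s ^ 3 * (b ^ 4 * (s ^ 2 + b ^ 2))) := by
      field_simp; ring
    rw [e, div_le_div_iff₀ (by positivity) (by positivity)]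
    have := mul_le_mul_of_nonneg_left h3 (pow_nonneg hs0.le 3)
    linarith
  refine (Finset.sum_le_sum fun n _ => hle (((n : ℕ) + 1) * d) (by positivity)).trans ?_
  refine sum_le_of_primitive (F := fun t => 8 / b ^ 5 * Real.arctan (√√t / b))
    (f := fun t => 8 / b ^ 5 * (b / (4 * √√t ^ 3 * (√√t ^ 2 + b ^ 2)))) hd ?_ ?_ ?_ ?_ ?_ N
  · fun_prop
  · intro t ht
    have hst : 0 < √t := Real.sqrt_pos.2 ht
    have hs0 : 0 < √√t := Real.sqrt_pos.2 hst
    have h := ((((Real.hasDerivAt_sqrt ht.ne').sqrt hst.ne').div_const b).arctan).const_mul (8 / b ^ 5)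
    refine h.congr_deriv ?_
    have hs2 : √√t ^ 2 = √t := Real.sq_sqrt hst.le
    rw [← hs2]
    generalize √√t = s at *
    have hs' : s ≠ 0 := hs0.ne'
    rw [Real.sqrt_sq hs0.le]
    field_simp
    ring
  · intro s t hs hst
    have h1 : 0 < √√s := Real.sqrt_pos.2 (Real.sqrt_pos.2 hs)
    have h2 := Real.sqrt_le_sqrt (Real.sqrt_le_sqrt hst)
    gcongr
  · simp
  · intro t _
    have := (Real.arctan_lt_pi_div_two (√√t / b)).le
    calc _ ≤ 8 / b ^ 5 * (Real.pi / 2) := by gcongr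
      _ = _ := by ring

lemma sum_inv_add_sq_le {d B : ℝ} (hd : 0 < d) (hB : 0 < B) (N : ℕ) :
    ∑ n ∈ Finset.range N, 1 / ((n + 1) * d + B) ^ 2 ≤ 1 / B / d := by
  refine sum_le_of_primitive (F := fun t => 1 / B - 1 / (t + B))
    (f := fun t => 1 / (t + B) ^ 2) hd ?_ ?_ ?_ ?_ ?_ N
  · refine continuousOn_const.sub (continuousOn_const.div (by fun_prop) fun t ht => ?_)
    have : (0 : ℝ) ≤ t := ht
    positivity
  · intro t ht
    have h := ((hasDerivAt_const t (1 : ℝ)).div ((hasDerivAt_id' t).add_const B)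
      (by positivity)).const_sub (1 / B)
    refine h.congr_deriv ?_
    field_simp
    ring
  · intro s t hs hst
    gcongr
  · simp
  · intro t ht
    have : 0 ≤ 1 / (t + B) := by positivity
    linarith

/-- The origin of the error term `log L / L`. Partial fractions give the primitive; the singularity
at `0` is avoided by shifting by one and treating the first term separately. The condition `3 ≤ L`
gives `log L ≥ 1`. -/
lemma sum_inv_mul_add_le {L : ℝ} (hL : 3 ≤ L) (N : ℕ) :
    ∑ n ∈ Finset.range N, 1 / (((n : ℝ) + 1) * (n + 1 + L)) ≤ 3 * (Real.log L / L) := by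
  have hL0 : 0 < L := by linarith
  have hlog1 : 1 ≤ Real.log L := by
    rw [Real.le_log_iff_exp_le hL0]
    exact (Real.exp_one_lt_d9.le.trans (by norm_num)).trans hL
  have hlog2 : Real.log (1 + L) ≤ 2 * Real.log L := by
    rw [← Nat.cast_two, ← Real.log_pow]
    exact Real.log_le_log (by linarith) (by nlinarith)
  have hmain : ∀ N : ℕ, ∑ n ∈ Finset.range N, 1 / ((((n : ℝ) + 1) * 1 + 1) * (((n : ℝ) + 1) * 1 + 1 + L))
      ≤ Real.log (1 + L) / L / 1 := by
    intro N
    refine sum_le_of_primitive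
      (F := fun t => (Real.log (t + 1) - Real.log (t + 1 + L) + Real.log (1 + L)) / L)
      (f := fun t => 1 / ((t + 1) * (t + 1 + L))) one_pos ?_ ?_ ?_ ?_ ?_ N
    · refine ContinuousOn.div_const (ContinuousOn.add (ContinuousOn.sub ?_ ?_) continuousOn_const) _
      · refine ContinuousOn.log (by fun_prop) fun t ht => ?_
        have : (0 : ℝ) ≤ t := ht
        positivity
      · refine ContinuousOn.log (by fun_prop) fun t ht => ?_
        have : (0 : ℝ) ≤ t := ht
        positivity
    · intro t ht
      have h1 := ((hasDerivAt_id' t).add_const 1).log (by positivity)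
      have h2 := (((hasDerivAt_id' t).add_const 1).add_const L).log (by positivity)
      have h := ((h1.sub h2).add_const (Real.log (1 + L))).div_const L
      refine h.congr_deriv ?_
      field_simp
      ring
    · intro s t hs hst
      have := hs.trans_le hst
      gcongr
    · simp
    · intro t ht
      have := Real.log_le_log (by positivity : 0 < t + 1) (by linarith : t + 1 ≤ t + 1 + L)
      gcongr
      linarith
  rcases N with _ | N
  · simp; positivity
  · rw [Finset.sum_range_succ']
    have h1 := hmain N
    have h2 : ∑ n ∈ Finset.range N, 1 / ((((n + 1 : ℕ) : ℝ) + 1) * ((n + 1 : ℕ) + 1 + L)) ≤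
        2 * Real.log L / L := by
      refine le_trans (le_of_eq (Finset.sum_congr rfl fun n _ => ?_)) (h1.trans ?_)
      · push_cast; simp only [mul_one]
      · rw [div_one]; gcongr
    have h3 : 1 / ((((0 : ℕ) : ℝ) + 1) * ((0 : ℕ) + 1 + L)) ≤ Real.log L / L := by
      rw [div_le_div_iff₀ (by positivity) hL0]
      simp; nlinarith
    calc _ ≤ 2 * Real.log L / L + Real.log L / L := add_le_add h2 h3
      _ = _ := by ring

lemma sum_inv_sq_le (N : ℕ) : ∑ n ∈ Finset.range N, 1 / ((n : ℝ) + 1) ^ 2 ≤ 4 := by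
  have h := sum_inv_add_sq_le one_pos one_pos N
  have : ∀ n ∈ Finset.range N, 1 / ((n : ℝ) + 1) ^ 2 ≤ 4 * (1 / (((n : ℝ) + 1) * 1 + 1) ^ 2) := by
    intro n _
    have hn : (0 : ℝ) ≤ n := n.cast_nonneg
    rw [mul_one_div, div_le_div_iff₀ (by positivity) (by positivity)]
    nlinarith
  refine (Finset.sum_le_sum this).trans ?_
  rw [← Finset.mul_sum]
  linarith

/-! ### Sums over primitive vectors -/

lemma exists_le_latNorm (x : ℝ) {y : ℝ} (hy : y ≠ 0) : ∃ κ : ℝ, 0 < κ ∧ κ ≤ 1 ∧ ∀ v : ℤ × ℤ,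
    κ * (max v.1.natAbs v.2.natAbs : ℕ) ≤ latNorm x y v := by
  have h1 : 0 ≤ |x| / |y| := by positivity
  have h2 : 0 ≤ 1 / |y| := by positivity
  refine ⟨1 / (1 + |x| / |y| + 1 / |y|), by positivity, ?_, fun v => ?_⟩
  · rw [div_le_one (by positivity)]; linarith
  · rw [one_div_mul_eq_div, div_le_iff₀ (by positivity), Nat.cast_max, Nat.cast_natAbs,
      Nat.cast_natAbs]
    have e1 := abs_fst_le_latNorm (x := x) hy v
    have e2 := abs_snd_le_latNorm (x := x) hy v
    have e0 := latNorm_nonneg x y v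
    rw [div_eq_mul_one_div] at e2
    push_cast
    refine max_le (e1.trans ?_) (e2.trans ?_)
    · nlinarith
    · nlinarith

open Classical in
/-- The primitive half-plane vectors of sup norm at most `N`. -/
def primFinset (N : ℕ) : Finset {D : ℤ × ℤ // IsPrimHalf D} :=
  (Finset.Icc (-(N : ℤ)) N ×ˢ Finset.Icc (-(N : ℤ)) N).subtype IsPrimHalf

lemma mem_primFinset {N : ℕ} {D : {D : ℤ × ℤ // IsPrimHalf D}} :
    D ∈ primFinset N ↔ max (D : ℤ × ℤ).1.natAbs (D : ℤ × ℤ).2.natAbs ≤ N := by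
  simp only [primFinset, Finset.mem_subtype, Finset.mem_product, Finset.mem_Icc]
  omega

lemma IsPrimHalf.one_le_max {D : ℤ × ℤ} (h : IsPrimHalf D) : 1 ≤ max D.1.natAbs D.2.natAbs := by
  obtain ⟨-, h⟩ := h
  omega

/-- Group the vectors by sup norm: the box of radius `j + 1` has `8 (j + 1)` points, and on it the
decreasing `g` is at most its value at `κ (j + 1)`. -/
lemma sum_primFinset_le {x y κ : ℝ} (hκ : 0 < κ)
    (hle : ∀ v : ℤ × ℤ, κ * (max v.1.natAbs v.2.natAbs : ℕ) ≤ latNorm x y v) {g : ℝ → ℝ}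
    (hg0 : ∀ t, 0 < t → 0 ≤ g t) (hg : ∀ s t, 0 < s → s ≤ t → g t ≤ g s) (N : ℕ) :
    ∑ D ∈ primFinset N, g (latNorm x y D) ≤
      ∑ j ∈ Finset.range N, 8 * ((j : ℝ) + 1) * g (κ * (j + 1)) := by
  classical
  set ρ : {D : ℤ × ℤ // IsPrimHalf D} → ℕ :=
    fun D => max (D : ℤ × ℤ).1.natAbs (D : ℤ × ℤ).2.natAbs - 1 with hρ
  have hρ1 : ∀ D : {D : ℤ × ℤ // IsPrimHalf D},
      max (D : ℤ × ℤ).1.natAbs (D : ℤ × ℤ).2.natAbs = ρ D + 1 := fun D => by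
    have := D.2.one_le_max
    simp only [hρ]; omega
  rw [← Finset.sum_fiberwise_of_maps_to (s := primFinset N) (t := Finset.range N) (g := ρ)]
  · refine Finset.sum_le_sum fun j _ => ?_
    have hpos : 0 < κ * ((j : ℝ) + 1) := by positivity
    refine (Finset.sum_le_card_nsmul _ _ (g (κ * (j + 1))) fun D hD => ?_).trans ?_
    · refine hg _ _ hpos ?_
      have := hle D
      rw [hρ1, (Finset.mem_filter.1 hD).2] at this
      exact_mod_cast this
    · rw [nsmul_eq_mul]
      refine mul_le_mul_of_nonneg_right ?_ (hg0 _ hpos)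
      have hcard : ((primFinset N).filter fun D => ρ D = j).card ≤
          (Finset.box (j + 1) : Finset (ℤ × ℤ)).card := by
        refine Finset.card_le_card_of_injOn Subtype.val (fun D hD => ?_)
          Subtype.val_injective.injOn
        have hD' := (Finset.mem_filter.1 hD).2
        exact Int.mem_box.2 (by rw [hρ1, hD'])
      rw [Int.card_box (Nat.succ_ne_zero j)] at hcard
      exact_mod_cast hcard
  · intro D hD
    have h1 := mem_primFinset.1 hD
    rw [hρ1] at h1
    exact Finset.mem_range.2 h1

/-! ### Moments of a single class -/

lemma constTerm_multSum (c : ℝ → ℂ) (hc0 : c 0 = 0) (N : ℕ) (d : ℝ) :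
    constTerm (multSum c N d) = 0 := by
  rw [multSum, map_sum]
  refine Finset.sum_eq_zero fun n _ => ?_
  rw [constTerm_apply, AddMonoidAlgebra.coeff_single, Finsupp.single_apply]
  split_ifs with h
  · rw [h, hc0]
  · rfl

lemma constTerm_multSum_sq (c : ℝ → ℂ) (N : ℕ) {d : ℝ} (hd : d ≠ 0) :
    constTerm (multSum c N d ^ 2) =
      ∑ n ∈ Finset.Icc (-(N : ℤ)) N, c (n * d) * c (-(n * d)) := by
  rw [sq, multSum, Finset.sum_mul_sum, map_sum]
  refine Finset.sum_congr rfl fun n hn => ?_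
  rw [map_sum, Finset.sum_eq_single (-n)]
  · rw [constTerm_apply, AddMonoidAlgebra.single_mul_single, AddMonoidAlgebra.coeff_single,
      Finsupp.single_apply]
    simp
  · intro k _ hk
    rw [constTerm_apply, AddMonoidAlgebra.single_mul_single, AddMonoidAlgebra.coeff_single,
      Finsupp.single_apply, if_neg]
    intro h
    rw [← add_mul] at h
    have h1 := (mul_eq_zero.1 h).resolve_right hd
    have h2 : n + k = 0 := by exact_mod_cast h1
    exact hk (by omega)
  · intro h
    exact absurd (by simp only [Finset.mem_Icc] at hn ⊢; omega) h

/-- The function `F` is left free because the `ℓ¹`, `ℓ^(3/2)` and `ℓ²` sums are all needed. -/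
lemma sum_norm_multSum_le {c : ℝ → ℂ} {w : ℝ → ℝ} (hc : ∀ x, ‖c x‖ ≤ w |x|) (hw : w 0 = 0)
    {F : ℝ → ℝ} (hF0 : F 0 = 0) (hF : ∀ s t, 0 ≤ s → s ≤ t → F s ≤ F t) (N : ℕ) {d : ℝ}
    (hd : 0 < d) :
    ∑ n ∈ Finset.Icc (-(N : ℤ)) N, F ‖c (n * d)‖ ≤ 2 * ∑ n ∈ Finset.range N, F (w ((n + 1) * d)) := by
  rw [sum_Icc_neg_eq, Finset.mul_sum]
  have h0 : ‖c ((0 : ℤ) * d)‖ = 0 := by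
    refine le_antisymm ?_ (norm_nonneg _)
    have := hc ((0 : ℤ) * d)
    simpa [hw] using this
  rw [h0, hF0, zero_add]
  refine Finset.sum_le_sum fun n _ => ?_
  have hpos : 0 < ((n : ℝ) + 1) * d := by positivity
  have h1 := hF _ _ (norm_nonneg _) (hc (((n + 1 : ℤ) : ℝ) * d))
  have h2 := hF _ _ (norm_nonneg _) (hc (((-(n + 1) : ℤ) : ℝ) * d))
  have e1 : |((n + 1 : ℤ) : ℝ) * d| = (n + 1) * d := by push_cast; exact abs_of_pos hpos
  have e2 : |((-(n + 1) : ℤ) : ℝ) * d| = (n + 1) * d := by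
    push_cast; rw [← abs_of_pos hpos, ← abs_neg]; congr 1; ring
  rw [e1] at h1
  rw [e2] at h2
  linarith

/-- The size of the rescaled coefficients. -/
def coeffWeight (C₀ L t : ℝ) : ℝ := C₀ * √L * (1 / (√t * (t + L)))

lemma coeffWeight_zero (C₀ L : ℝ) : coeffWeight C₀ L 0 = 0 := by simp [coeffWeight]

lemma sum_norm_le {C₀ L : ℝ} (hC₀ : 0 ≤ C₀) (hL : 0 < L) {c : ℝ → ℂ}
    (hc : ∀ x, ‖c x‖ ≤ coeffWeight C₀ L |x|) (N : ℕ) {d : ℝ} (hd : 0 < d) :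
    ∑ n ∈ Finset.Icc (-(N : ℤ)) N, ‖c (n * d)‖ ≤ 2 * Real.pi * C₀ / d := by
  refine (sum_norm_multSum_le hc (coeffWeight_zero _ _) (F := id) rfl (fun _ _ _ h => h) N hd).trans ?_
  simp only [id, coeffWeight, ← Finset.mul_sum]
  have := mul_le_mul_of_nonneg_left (sum_inv_sqrt_mul_add_le hd hL N)
    (by positivity : 0 ≤ 2 * (C₀ * √L))
  have hsL : 0 < √L := Real.sqrt_pos.2 hL
  calc _ ≤ 2 * (C₀ * √L) * (Real.pi / √L / d) := by rw [← mul_assoc]; exact this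
    _ = _ := by field_simp

lemma sum_norm_three_halves_le {C₀ L : ℝ} (hC₀ : 0 ≤ C₀) (hL : 0 < L) {c : ℝ → ℂ}
    (hc : ∀ x, ‖c x‖ ≤ coeffWeight C₀ L |x|) (N : ℕ) {d : ℝ} (hd : 0 < d) :
    (∑ n ∈ Finset.Icc (-(N : ℤ)) N, √‖c (n * d)‖ ^ 3) ^ 2 ≤
      512 * Real.pi ^ 2 * C₀ ^ 3 / (d ^ 2 * (d + L)) := by
  -- Every frequency `t` is at least `d`, so `t + L` may be replaced by `t + d + L` up to a factor
  -- `2`. This yields the decay `d⁻³` for `d > L` that makes the sum over `D` converge.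
  set B := d + L with hB
  have hB0 : 0 < B := by positivity
  have hsB : 0 < √B := Real.sqrt_pos.2 hB0
  have hb0 : 0 < √√B := Real.sqrt_pos.2 hsB
  have hterm : ∀ n ∈ Finset.range N, √(coeffWeight C₀ L ((n + 1) * d)) ^ 3 ≤
      √(2 * (C₀ * √L)) ^ 3 * √(1 / (√((n + 1) * d) * ((n + 1) * d + B))) ^ 3 := by
    intro n _
    rw [← mul_pow, ← Real.sqrt_mul (by positivity)]
    refine pow_le_pow_left₀ (Real.sqrt_nonneg _) (Real.sqrt_le_sqrt ?_) 3
    have hn : (0 : ℝ) ≤ n := n.cast_nonneg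
    have ht : d ≤ ((n : ℝ) + 1) * d := by nlinarith
    set t := ((n : ℝ) + 1) * d
    have ht0 : 0 < t := hd.trans_le ht
    have hst : 0 < √t := Real.sqrt_pos.2 ht0
    have : 1 / (√t * (t + L)) ≤ 2 * (1 / (√t * (t + B))) := by
      rw [mul_one_div, div_le_div_iff₀ (by positivity) (by positivity)]
      have : t + B ≤ 2 * (t + L) := by rw [hB]; linarith
      nlinarith
    calc coeffWeight C₀ L t ≤ C₀ * √L * (2 * (1 / (√t * (t + B)))) :=
          mul_le_mul_of_nonneg_left this (by positivity)
      _ = _ := by ring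
  have h1 : ∑ n ∈ Finset.Icc (-(N : ℤ)) N, √‖c (n * d)‖ ^ 3 ≤
      2 * (√(2 * (C₀ * √L)) ^ 3 * (4 * Real.pi / √√B ^ 5 / d)) := by
    refine (sum_norm_multSum_le hc (coeffWeight_zero _ _) (F := fun t => √t ^ 3) (by simp)
      (fun s t _ h => pow_le_pow_left₀ (Real.sqrt_nonneg _) (Real.sqrt_le_sqrt h) 3) N hd).trans ?_
    refine mul_le_mul_of_nonneg_left ((Finset.sum_le_sum hterm).trans ?_) two_pos.le
    rw [← Finset.mul_sum]
    exact mul_le_mul_of_nonneg_left (sum_inv_sqrt_sqrt_cube_le hd hB0 N) (by positivity)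
  refine (pow_le_pow_left₀ (Finset.sum_nonneg fun _ _ => by positivity) h1 2).trans ?_
  have e1 : (2 * (√(2 * (C₀ * √L)) ^ 3 * (4 * Real.pi / √√B ^ 5 / d))) ^ 2 =
      64 * Real.pi ^ 2 * (√(2 * (C₀ * √L)) ^ 2) ^ 3 / ((√√B ^ 2) ^ 5 * d ^ 2) := by
    field_simp; ring
  rw [e1, Real.sq_sqrt (by positivity), Real.sq_sqrt hsB.le]
  have hLB : √L ^ 3 ≤ √B ^ 3 :=
    pow_le_pow_left₀ (Real.sqrt_nonneg _) (Real.sqrt_le_sqrt (by rw [hB]; linarith)) 3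
  calc _ = 512 * Real.pi ^ 2 * C₀ ^ 3 * √L ^ 3 / (√B ^ 5 * d ^ 2) := by ring
    _ ≤ 512 * Real.pi ^ 2 * C₀ ^ 3 * √B ^ 3 / (√B ^ 5 * d ^ 2) := by gcongr
    _ = 512 * Real.pi ^ 2 * C₀ ^ 3 / (d ^ 2 * √B ^ 2) := by field_simp
    _ = _ := by rw [Real.sq_sqrt hB0.le]

/-- The `3/2` norm supplies the factor `1 / (d² (d + L))`, and the `ℓ¹` norm is bounded because `d ≥
κ`. Adding `1` makes the base at least one, so the exponent can be raised to `m`. -/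
lemma norm_constTerm_multSum_pow_le {C₀ L κ : ℝ} (hC₀ : 0 ≤ C₀) (hL : 0 < L) (hκ : 0 < κ)
    {c : ℝ → ℂ} (hc : ∀ x, ‖c x‖ ≤ coeffWeight C₀ L |x|) (N : ℕ) {d : ℝ} (hd : κ ≤ d) {l m : ℕ}
    (hl : 3 ≤ l) (hlm : l ≤ m) :
    ‖constTerm (multSum c N d ^ l)‖ ≤
      512 * Real.pi ^ 2 * C₀ ^ 3 * (1 + 2 * Real.pi * C₀ / κ) ^ m * (1 / (d ^ 2 * (d + L))) := by
  have hd0 : 0 < d := hκ.trans_le hd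
  have hπ := Real.pi_pos
  have hinj : Set.InjOn (fun n : ℤ => (n : ℝ) * d) (Finset.Icc (-(N : ℤ)) N) := fun a _ b _ h => by
    have := mul_right_cancel₀ hd0.ne' h
    exact_mod_cast this
  refine (norm_constTerm_pow_le _ _ _ hinj hl).trans ?_
  have h1 := sum_norm_three_halves_le hC₀ hL hc N hd0
  have h2 : ∑ n ∈ Finset.Icc (-(N : ℤ)) N, ‖c (n * d)‖ ≤ 1 + 2 * Real.pi * C₀ / κ := by
    refine (sum_norm_le hC₀ hL hc N hd0).trans ?_
    have : 2 * Real.pi * C₀ / d ≤ 2 * Real.pi * C₀ / κ := by gcongr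
    linarith
  have h3 : (∑ n ∈ Finset.Icc (-(N : ℤ)) N, ‖c (n * d)‖) ^ (l - 3) ≤
      (1 + 2 * Real.pi * C₀ / κ) ^ m := by
    refine (pow_le_pow_left₀ (Finset.sum_nonneg fun _ _ => norm_nonneg _) h2 _).trans ?_
    refine pow_le_pow_right₀ ?_ (by omega)
    have : 0 ≤ 2 * Real.pi * C₀ / κ := by positivity
    linarith
  calc _ ≤ 512 * Real.pi ^ 2 * C₀ ^ 3 / (d ^ 2 * (d + L)) * (1 + 2 * Real.pi * C₀ / κ) ^ m :=
        mul_le_mul h1 h3 (pow_nonneg (Finset.sum_nonneg fun _ _ => norm_nonneg _) _)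
          (by positivity)
    _ = _ := by ring

/-- A bound for the second moment of one class. -/
def classVariance (C₀ L : ℝ) (N : ℕ) (d : ℝ) : ℝ :=
  2 * C₀ ^ 2 * L * ∑ n ∈ Finset.range N, 1 / ((n + 1) * d * ((n + 1) * d + L) ^ 2)

lemma norm_constTerm_multSum_sq_le {C₀ L : ℝ} (hL : 0 < L) {c : ℝ → ℂ}
    (hc : ∀ x, ‖c x‖ ≤ coeffWeight C₀ L |x|) (N : ℕ) {d : ℝ} (hd : 0 < d) :
    ‖constTerm (multSum c N d ^ 2)‖ ≤ classVariance C₀ L N d := by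
  rw [constTerm_multSum_sq c N hd.ne']
  refine (norm_sum_le _ _).trans ?_
  have h1 : ∀ n ∈ Finset.Icc (-(N : ℤ)) N, ‖c (n * d) * c (-(n * d))‖ ≤
      ‖((coeffWeight C₀ L |(n : ℝ) * d| : ℝ) : ℂ)‖ ^ 2 := by
    intro n _
    have e1 := hc (n * d)
    have e2 := hc (-(n * d))
    rw [abs_neg] at e2
    rw [norm_mul, Complex.norm_real, Real.norm_eq_abs, sq]
    exact mul_le_mul (e1.trans (le_abs_self _)) (e2.trans (le_abs_self _)) (norm_nonneg _)
      (abs_nonneg _)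
  refine (Finset.sum_le_sum h1).trans ?_
  refine (sum_norm_multSum_le (c := fun x => ((coeffWeight C₀ L |x| : ℝ) : ℂ))
    (w := fun t => |coeffWeight C₀ L t|) (fun x => by rw [Complex.norm_real, Real.norm_eq_abs])
    (by simp [coeffWeight_zero]) (F := fun t => t ^ 2) (by simp)
    (fun s t hs h => pow_le_pow_left₀ hs h 2) N hd).trans ?_
  rw [classVariance, Finset.mul_sum, Finset.mul_sum]
  refine Finset.sum_le_sum fun n _ => le_of_eq ?_
  simp only [sq_abs, coeffWeight]
  have ht : 0 < ((n : ℝ) + 1) * d := by positivity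
  rw [mul_pow, mul_pow, Real.sq_sqrt hL.le, div_pow, mul_pow, Real.sq_sqrt ht.le]
  ring

/-- One of the two factors `(n+1)d + L` is bounded below by `L`, cancelling the prefactor; the rest
is the sum giving `log L / L`. -/
lemma classVariance_le {C₀ L κ : ℝ} (hL : 3 ≤ L) (hκ : 0 < κ) (hκ1 : κ ≤ 1)
    (N : ℕ) {d : ℝ} (hd : κ ≤ d) :
    classVariance C₀ L N d ≤ 6 * C₀ ^ 2 / κ ^ 2 * (Real.log L / L) := by
  have hL0 : 0 < L := by linarith
  have hterm : ∀ n ∈ Finset.range N, 1 / (((n : ℝ) + 1) * d * ((n + 1) * d + L) ^ 2) ≤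
      1 / (L * κ ^ 2) * (1 / (((n : ℝ) + 1) * (n + 1 + L))) := by
    intro n _
    have hn : (0 : ℝ) ≤ n := n.cast_nonneg
    have ht : ((n : ℝ) + 1) * κ ≤ (n + 1) * d := by gcongr
    have ht0 : 0 < ((n : ℝ) + 1) * κ := by positivity
    have htd : 0 < ((n : ℝ) + 1) * d := ht0.trans_le ht
    have htL : 0 < ((n : ℝ) + 1) * d + L := by positivity
    have h2 : κ * (n + 1 + L) ≤ (n + 1) * d + L := by nlinarith
    have h3 : L ≤ (n + 1) * d + L := by linarith
    have h4 : L * κ ^ 2 * (((n : ℝ) + 1) * (n + 1 + L)) ≤ (n + 1) * d * ((n + 1) * d + L) ^ 2 := by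
      calc _ = ((n : ℝ) + 1) * κ * (κ * (n + 1 + L) * L) := by ring
        _ ≤ (n + 1) * d * (((n + 1) * d + L) * ((n + 1) * d + L)) := by gcongr
        _ = _ := by ring
    rw [one_div_mul_one_div]
    exact one_div_le_one_div_of_le (by positivity) h4
  have hsum := (Finset.sum_le_sum hterm)
  rw [← Finset.mul_sum] at hsum
  have h5 := mul_le_mul_of_nonneg_left (sum_inv_mul_add_le hL N) (by positivity : 0 ≤ 1 / (L * κ ^ 2))
  calc classVariance C₀ L N d ≤ 2 * C₀ ^ 2 * L * (1 / (L * κ ^ 2) * (3 * (Real.log L / L))) :=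
        mul_le_mul_of_nonneg_left (hsum.trans h5) (by positivity)
    _ = _ := by field_simp; ring

/-- Summing over `D` first avoids any logarithm: the `8 (j+1)` vectors in a box cancel the factor
`1/t`, leaving `O(1 / ((n+1)² L))`, which is summable over `n`. -/
lemma sum_classVariance_le {x y C₀ L κ : ℝ} (hL : 0 < L) (hκ : 0 < κ)
    (hle : ∀ v : ℤ × ℤ, κ * (max v.1.natAbs v.2.natAbs : ℕ) ≤ latNorm x y v) (N : ℕ) :
    ∑ D ∈ primFinset N, classVariance C₀ L N (latNorm x y D) ≤ 64 * C₀ ^ 2 / κ ^ 2 := by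
  simp only [classVariance]
  rw [← Finset.mul_sum, Finset.sum_comm]
  have hterm : ∀ n ∈ Finset.range N, ∑ D ∈ primFinset N,
      1 / (((n : ℝ) + 1) * latNorm x y D * ((n + 1) * latNorm x y D + L) ^ 2) ≤
      8 / (κ ^ 2 * L) * (1 / ((n : ℝ) + 1) ^ 2) := by
    intro n _
    have hn : (0 : ℝ) < n + 1 := by positivity
    refine (sum_primFinset_le hκ hle (g := fun t => 1 / (((n : ℝ) + 1) * t * ((n + 1) * t + L) ^ 2))
      (fun t ht => by positivity) (fun s t hs hst => ?_) N).trans ?_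
    · have := hs.trans_le hst
      gcongr
    · have h1 := mul_le_mul_of_nonneg_left (sum_inv_add_sq_le (mul_pos hn hκ) hL N)
        (by positivity : 0 ≤ 8 / (((n : ℝ) + 1) * κ))
      rw [Finset.mul_sum] at h1
      refine le_trans (le_of_eq (Finset.sum_congr rfl fun j _ => ?_)) (h1.trans (le_of_eq ?_))
      · have hj : (0 : ℝ) < j + 1 := by positivity
        have : (0 : ℝ) < (j + 1) * ((n + 1) * κ) + L := by positivity
        have e : ((n : ℝ) + 1) * (κ * (j + 1)) + L = (j + 1) * ((n + 1) * κ) + L := by ring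
        rw [e]
        field_simp
      · field_simp
  have hsum := Finset.sum_le_sum hterm
  rw [← Finset.mul_sum] at hsum
  have h5 := mul_le_mul_of_nonneg_left (sum_inv_sq_le N) (by positivity : 0 ≤ 8 / (κ ^ 2 * L))
  calc _ ≤ 2 * C₀ ^ 2 * L * (8 / (κ ^ 2 * L) * 4) :=
        mul_le_mul_of_nonneg_left (hsum.trans h5) (by positivity)
    _ = _ := by field_simp; ring

/-- The box count turns `1 / (t² (t + L))` into `1 / ((j+1)(j+1+L))`, hence a single logarithm. -/
lemma sum_inv_sq_mul_add_le {x y L κ : ℝ} (hL : 3 ≤ L) (hκ : 0 < κ) (hκ1 : κ ≤ 1)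
    (hle : ∀ v : ℤ × ℤ, κ * (max v.1.natAbs v.2.natAbs : ℕ) ≤ latNorm x y v) (N : ℕ) :
    ∑ D ∈ primFinset N, 1 / (latNorm x y D ^ 2 * (latNorm x y D + L)) ≤
      24 / κ ^ 3 * (Real.log L / L) := by
  have hL0 : 0 < L := by linarith
  refine (sum_primFinset_le hκ hle (g := fun t => 1 / (t ^ 2 * (t + L)))
    (fun t ht => by positivity) (fun s t hs hst => by gcongr) N).trans ?_
  have h := mul_le_mul_of_nonneg_left (sum_inv_mul_add_le hL N) (by positivity : 0 ≤ 8 / κ ^ 3)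
  rw [Finset.mul_sum] at h
  refine (Finset.sum_le_sum fun j _ => ?_).trans (h.trans (le_of_eq (by ring)))
  have hj : (0 : ℝ) < j + 1 := by positivity
  have h1 : κ * (j + 1 + L) ≤ κ * (j + 1) + L := by nlinarith
  have h2 : 1 / ((κ * ((j : ℝ) + 1)) ^ 2 * (κ * (j + 1) + L)) ≤
      1 / ((κ * ((j : ℝ) + 1)) ^ 2 * (κ * (j + 1 + L))) := by
    gcongr
  refine (mul_le_mul_of_nonneg_left h2 (by positivity)).trans (le_of_eq ?_)
  field_simp

/-- The constant term of the `m`-th power of the whole trigonometric polynomial. -/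
lemma constTerm_pow_close {ξ η : ℝ} (hη : η ≠ 0)
    (hind : ∀ p : MvPolynomial (Fin 2) ℤ, MvPolynomial.aeval ![ξ, η] p = 0 → p = 0)
    {C₀ : ℝ} (hC₀ : 0 ≤ C₀) (m : ℕ) :
    ∃ K : ℝ, 0 ≤ K ∧ ∀ᶠ L : ℝ in atTop, ∀ (N : ℕ) (c : ℝ → ℂ),
      (∀ x, ‖c x‖ ≤ coeffWeight C₀ L |x|) →
      ‖constTerm ((∑ D ∈ primFinset N, multSum c N (latNorm ξ η D)) ^ m) -
        gaussMoment m (∑ D ∈ primFinset N, constTerm (multSum c N (latNorm ξ η D) ^ 2))‖ ≤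
        K * (Real.log L / L) := by
  classical
  obtain ⟨κ, hκ, hκ1, hle⟩ := exists_le_latNorm ξ hη
  have hπ := Real.pi_pos
  set H : ℝ := 512 * Real.pi ^ 2 * C₀ ^ 3 * (1 + 2 * Real.pi * C₀ / κ) ^ m with hH
  have hH0 : 0 ≤ H := by positivity
  -- The two summands account for the largest variance and for the total of the higher moments.
  set K₁ : ℝ := 6 * C₀ ^ 2 / κ ^ 2 + H * (24 / κ ^ 3) with hK₁
  have hK₁0 : 0 ≤ K₁ := by positivity
  obtain ⟨K, hK, hmom⟩ := moment_close_gaussMoment (ι := {D : ℤ × ℤ // IsPrimHalf D}) constTerm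
    (C := 64 * C₀ ^ 2 / κ ^ 2) (by positivity) m
  have hlim : Tendsto (fun L : ℝ => K₁ * (Real.log L / L)) atTop (𝓝 0) := by
    have := (Real.isLittleO_log_id_atTop.tendsto_div_nhds_zero).const_mul K₁
    simpa using this
  refine ⟨K * K₁, by positivity, ?_⟩
  filter_upwards [hlim.eventually (ge_mem_nhds zero_lt_one), eventually_ge_atTop 3] with L hε hL N c hc
  have hL0 : 0 < L := by linarith
  have hlog : 0 ≤ Real.log L / L := div_nonneg (Real.log_nonneg (by linarith)) hL0.le
  have hd : ∀ D : {D : ℤ × ℤ // IsPrimHalf D}, κ ≤ latNorm ξ η D := fun D => by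
    refine le_trans ?_ (hle D)
    have : (1 : ℝ) ≤ (max (D : ℤ × ℤ).1.natAbs (D : ℤ × ℤ).2.natAbs : ℕ) := by
      exact_mod_cast D.2.one_le_max
    nlinarith
  have hd0 : ∀ D : {D : ℤ × ℤ // IsPrimHalf D}, 0 < latNorm ξ η D := fun D => hκ.trans_le (hd D)
  have hc0 : c 0 = 0 := by
    have := hc 0
    rw [abs_zero, coeffWeight_zero] at this
    exact norm_le_zero_iff.1 this
  have hfam : IsSmallIndepFamily constTerm
      (fun D : {D : ℤ × ℤ // IsPrimHalf D} => multSum c N (latNorm ξ η D)) (primFinset N)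
      (fun D => classVariance C₀ L N (latNorm ξ η D))
      (fun D => H * (1 / (latNorm ξ η D ^ 2 * (latNorm ξ η D + L))))
      (64 * C₀ ^ 2 / κ ^ 2) (K₁ * (Real.log L / L)) m :=
    { map_one := constTerm_one
      indep := fun s _ i _ hi p q => multSum_indep (linearIndependent_latNorm hind) c N s i hi p q
      mean_zero := fun D _ => constTerm_multSum c hc0 N _
      norm_two := fun D _ => norm_constTerm_multSum_sq_le hL0 hc N (hd0 D)
      le_eps := fun D _ => (classVariance_le hL hκ hκ1 N (hd D)).trans
        (mul_le_mul_of_nonneg_right (by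
          have : 0 ≤ H * (24 / κ ^ 3) := by positivity
          rw [hK₁]; linarith) hlog)
      sum_two := sum_classVariance_le hL0 hκ hle N
      norm_high := fun D _ l hl hlm =>
        norm_constTerm_multSum_pow_le hC₀ hL0 hκ hc N (hd D) hl hlm
      sum_high := by
        rw [← Finset.mul_sum]
        refine (mul_le_mul_of_nonneg_left (sum_inv_sq_mul_add_le hL hκ hκ1 hle N) hH0).trans ?_
        rw [← mul_assoc]
        refine mul_le_mul_of_nonneg_right ?_ hlog
        have : 0 ≤ 6 * C₀ ^ 2 / κ ^ 2 := by positivity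
        rw [hK₁]; linarith
      high_nonneg := fun D _ => by
        have := hd0 D
        positivity
      eps_nonneg := by positivity
      eps_le := hε }
  have := hmom _ _ _ _ _ hfam (primFinset N) subset_rfl m le_rfl
  rwa [← mul_assoc] at this

/-! ### Weighted means and constant terms -/

lemma weightedMean_exp {ω : ℝ → ℝ} {T : ℝ} (hT : 0 < T) (x : ℝ) :
    (1 / T : ℂ) * ∫ t : ℝ, Complex.exp (2 * Real.pi * x * t * Complex.I) * (ω (t / T) : ℂ) =
      𝓕 (fun s : ℝ => (ω s : ℂ)) (-(x * T)) := by
  have h := Measure.integral_comp_div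
    (fun s : ℝ => Complex.exp (2 * Real.pi * x * (s * T) * Complex.I) * (ω s : ℂ)) T
  have hT' : (T : ℂ) ≠ 0 := by exact_mod_cast hT.ne'
  have e1 : (∫ t : ℝ, Complex.exp (2 * Real.pi * x * t * Complex.I) * (ω (t / T) : ℂ)) =
      ∫ t : ℝ, (fun s : ℝ => Complex.exp (2 * Real.pi * x * (s * T) * Complex.I) * (ω s : ℂ))
        (t / T) := by
    refine integral_congr_ae (Eventually.of_forall fun t => ?_)
    simp only
    push_cast
    rw [div_mul_cancel₀ _ hT']
  rw [e1, h, abs_of_pos hT, Complex.real_smul, ← mul_assoc, one_div_mul_cancel hT', one_mul,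
    Real.fourier_real_eq_integral_exp_smul]
  refine integral_congr_ae (Eventually.of_forall fun t => ?_)
  simp only [smul_eq_mul]
  congr 2
  push_cast
  ring

lemma fourier_zero_of_mass_one {ω : ℝ → ℝ} (h1 : ∫ t, ω t = 1) :
    𝓕 (fun s : ℝ => (ω s : ℂ)) 0 = 1 := by
  rw [Real.fourier_real_eq_integral_exp_smul]
  simp only [mul_zero, Complex.ofReal_zero, zero_mul, Complex.exp_zero, one_smul]
  rw [integral_complex_ofReal, h1, Complex.ofReal_one]

/-- The weighted mean of a power of a trigonometric polynomial. -/
lemma weightedMean_pow {ω : ℝ → ℝ} (hω : Integrable ω) {T : ℝ} (hT : 0 < T) {κ : Type*}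
    [DecidableEq κ] (I : Finset κ) (x : κ → ℝ) (y : κ → ℂ) {S : ℝ → ℝ}
    (hS : ∀ t, (S t : ℂ) = ∑ i ∈ I, y i * Complex.exp (2 * Real.pi * x i * t * Complex.I)) (m : ℕ) :
    (weightedMean ω T (fun t => S t ^ m) : ℂ) =
      ∑ p ∈ Fintype.piFinset fun _ : Fin m => I,
        (∏ j, y (p j)) * 𝓕 (fun s : ℝ => (ω s : ℂ)) (-((∑ j, x (p j)) * T)) := by
  have hexp : ∀ t : ℝ, ((S t ^ m * ω (t / T) : ℝ) : ℂ) =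
      ∑ p ∈ Fintype.piFinset fun _ : Fin m => I, (∏ j, y (p j)) *
        (Complex.exp (2 * Real.pi * ((∑ j, x (p j) : ℝ) : ℂ) * t * Complex.I) * (ω (t / T) : ℂ)) := by
    intro t
    push_cast
    rw [hS, Finset.sum_pow', Finset.sum_mul]
    refine Finset.sum_congr rfl fun p _ => ?_
    rw [Finset.prod_mul_distrib, ← Complex.exp_sum, mul_assoc, Finset.mul_sum, Finset.sum_mul,
      Finset.sum_mul]
  have hint : ∀ z : ℝ, Integrable fun t : ℝ =>
      Complex.exp (2 * Real.pi * (z : ℂ) * t * Complex.I) * (ω (t / T) : ℂ) := by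
    intro z
    refine Integrable.bdd_mul (c := 1) (hω.comp_div hT.ne').ofReal ?_ ?_
    · exact (by fun_prop : Continuous fun t : ℝ =>
        Complex.exp (2 * Real.pi * (z : ℂ) * t * Complex.I)).aestronglyMeasurable
    · refine Eventually.of_forall fun t => ?_
      have : (2 * Real.pi * (z : ℂ) * t * Complex.I) = ((2 * Real.pi * z * t : ℝ) : ℂ) * Complex.I := by
        push_cast; ring
      rw [this, Complex.norm_exp_ofReal_mul_I]
  rw [weightedMean]
  push_cast
  rw [← integral_complex_ofReal, integral_congr_ae (Eventually.of_forall hexp),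
    integral_finsetSum _ fun p _ => (hint _).const_mul _, Finset.mul_sum]
  refine Finset.sum_congr rfl fun p _ => ?_
  rw [integral_const_mul, mul_left_comm, weightedMean_exp hT]

lemma constTerm_sum_single_pow {κ : Type*} [DecidableEq κ] (I : Finset κ) (x : κ → ℝ) (y : κ → ℂ)
    (m : ℕ) :
    constTerm ((∑ i ∈ I, AddMonoidAlgebra.single (x i) (y i)) ^ m) =
      ∑ p ∈ Fintype.piFinset fun _ : Fin m => I,
        if ∑ j, x (p j) = 0 then ∏ j, y (p j) else 0 := by
  rw [Finset.sum_pow', map_sum]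
  refine Finset.sum_congr rfl fun p _ => ?_
  rw [AddMonoidAlgebra.prod_single, constTerm_apply, AddMonoidAlgebra.coeff_single,
    Finsupp.single_apply]

/-- The weighted mean of a power differs little from the constant term when the nonzero frequencies
are large. -/
lemma norm_weightedMean_pow_sub_constTerm_le {ω : ℝ → ℝ} (hω : Integrable ω) (h1 : ∫ t, ω t = 1)
    {T : ℝ} (hT : 0 < T) {κ : Type*} [DecidableEq κ] (I : Finset κ) (x : κ → ℝ) (y : κ → ℂ)
    {S : ℝ → ℝ}
    (hS : ∀ t, (S t : ℂ) = ∑ i ∈ I, y i * Complex.exp (2 * Real.pi * x i * t * Complex.I)) (m : ℕ)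
    {δ : ℝ}
    (hδ : 0 ≤ δ) (hsep : ∀ p : Fin m → κ, (∀ j, p j ∈ I) → (∀ j, y (p j) ≠ 0) → ∑ j, x (p j) ≠ 0 →
      ‖𝓕 (fun s : ℝ => (ω s : ℂ)) (-((∑ j, x (p j)) * T))‖ ≤ δ) :
    ‖(weightedMean ω T (fun t => S t ^ m) : ℂ) -
      constTerm ((∑ i ∈ I, AddMonoidAlgebra.single (x i) (y i)) ^ m)‖ ≤
        (∑ i ∈ I, ‖y i‖) ^ m * δ := by
  rw [weightedMean_pow hω hT I x y hS, constTerm_sum_single_pow, ← Finset.sum_sub_distrib,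
    Finset.sum_pow', Finset.sum_mul]
  refine norm_sum_le_of_le _ fun p hp => ?_
  rw [← norm_prod]
  split_ifs with h
  · rw [h, zero_mul, neg_zero, fourier_zero_of_mass_one h1, mul_one, sub_self, norm_zero]
    positivity
  · rw [sub_zero, norm_mul]
    by_cases hy : ∀ j, y (p j) ≠ 0
    · exact mul_le_mul_of_nonneg_left
        (hsep p (fun j => Fintype.mem_piFinset.1 hp j) hy h) (norm_nonneg _)
    · push Not at hy
      obtain ⟨j, hj⟩ := hy
      rw [Finset.prod_eq_zero (Finset.mem_univ j) hj]; simp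

/-! ### The Fourier transform of the smoothing kernel -/

lemma abs_kernelHat_le (ψ : ℝ → ℝ) (r : ℝ) : |kernelHat ψ r| ≤ ∫ x, |ψ x| := by
  refine (Complex.abs_re_le_norm _).trans ?_
  have := VectorFourier.norm_fourierIntegral_le_integral_norm Real.fourierChar volume
    (innerₗ ℝ) (fun x : ℝ => (ψ x : ℂ)) r
  refine this.trans (le_of_eq ?_)
  simp

lemma continuous_kernelHat {ψ : ℝ → ℝ} (hψ : Integrable ψ) : Continuous (kernelHat ψ) := by
  refine Complex.continuous_re.comp ?_
  exact VectorFourier.fourierIntegral_continuous Real.continuous_fourierChar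
    (by exact continuous_inner) hψ.ofReal

lemma kernelHat_zero {ψ : ℝ → ℝ} (h1 : ∫ t, ψ t = 1) : kernelHat ψ 0 = 1 := by
  rw [kernelHat, fourier_zero_of_mass_one h1, Complex.one_re]

lemma exists_kernelHat_eq_zero {ψ : ℝ → ℝ} (h : HasCompactSupport (𝓕 (fun x : ℝ => (ψ x : ℂ)))) :
    ∃ R : ℝ, 0 < R ∧ ∀ r, R < r → kernelHat ψ r = 0 := by
  obtain ⟨R, hR⟩ := h.isCompact.isBounded.subset_closedBall 0
  refine ⟨max R 1, by positivity, fun r hr => ?_⟩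
  have : r ∉ tsupport (𝓕 (fun x : ℝ => (ψ x : ℂ))) := fun hmem => by
    have := hR hmem
    rw [Metric.mem_closedBall, dist_zero_right, Real.norm_eq_abs] at this
    have h2 := le_abs_self r
    have h3 := le_max_left R 1
    linarith
  rw [kernelHat, image_eq_zero_of_notMem_tsupport this, Complex.zero_re]

/-! ### Lattice sums arranged by primitive vectors -/

/-- The lattice vector `a + b (x + iy)`. -/
def latVec (x y : ℝ) (v : ℤ × ℤ) : ℂ := v.1 + v.2 * (x + y * Complex.I)

lemma norm_latVec (x y : ℝ) (v : ℤ × ℤ) : ‖latVec x y v‖ = latNorm x y v := by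
  have : latVec x y v = ((v.1 + v.2 * x : ℝ) : ℂ) + ((v.2 * y : ℝ) : ℂ) * Complex.I := by
    rw [latVec]; push_cast; ring
  rw [this, Complex.norm_add_mul_I, latNorm, latForm]

lemma latVec_injective (x : ℝ) {y : ℝ} (hy : y ≠ 0) : Function.Injective (latVec x y) := by
  intro u v h
  by_contra hne
  have h1 := latNorm_pos (x := x) hy (sub_ne_zero.2 hne)
  rw [← norm_latVec] at h1
  have : latVec x y (u - v) = latVec x y u - latVec x y v := by simp [latVec]; ring
  rw [this, h, sub_self, norm_zero] at h1
  exact lt_irrefl _ h1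

lemma mem_latticeStar {α β : ℝ} {k : ℂ} :
    k ∈ latticeStar α β ↔ ∃ v : ℤ × ℤ, latVec (-α / β) (1 / β) v = k := by
  rw [latticeStar, Submodule.mem_span_pair]
  constructor
  · rintro ⟨a, b, h⟩
    exact ⟨(a, b), by rw [← h]; simp [latVec, mul_add]⟩
  · rintro ⟨v, h⟩
    exact ⟨v.1, v.2, by rw [← h]; simp [latVec, mul_add]⟩

/-- Nonzero lattice vectors are multiples of primitive ones. -/
def primMultiple (α : ℝ) {β : ℝ} (hβ : β ≠ 0)
    (p : {D : ℤ × ℤ // IsPrimHalf D} × {n : ℤ // n ≠ 0}) :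
    {k : ℂ // k ∈ latticeStar α β ∧ k ≠ 0} :=
  ⟨latVec (-α / β) (1 / β) ((p.2 : ℤ) • (p.1 : ℤ × ℤ)), mem_latticeStar.2 ⟨_, rfl⟩, fun h => by
    rw [← norm_eq_zero, norm_latVec, latNorm_smul] at h
    have h1 := latNorm_pos (x := -α / β) (one_div_ne_zero hβ) p.1.2.ne_zero
    have h2 : ((p.2 : ℤ) : ℝ) ≠ 0 := by exact_mod_cast p.2.2
    exact (mul_pos (abs_pos.2 h2) h1).ne' h⟩

lemma norm_primMultiple (α : ℝ) {β : ℝ} (hβ : β ≠ 0)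
    (p : {D : ℤ × ℤ // IsPrimHalf D} × {n : ℤ // n ≠ 0}) :
    ‖(primMultiple α hβ p : ℂ)‖ = |((p.2 : ℤ) : ℝ) * latNorm (-α / β) (1 / β) p.1| := by
  rw [primMultiple, norm_latVec, latNorm_smul, abs_mul, abs_of_nonneg (latNorm_nonneg _ _ _)]

/-- The half plane selects one of `±D`, so the sign and the content of a lattice vector are both
carried by `n`. -/
lemma primMultiple_bijective (α : ℝ) {β : ℝ} (hβ : β ≠ 0) :
    Function.Bijective (primMultiple α hβ) := by
  constructor
  · rintro ⟨D, n⟩ ⟨D', n'⟩ h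
    have h1 : (n : ℤ) • (D : ℤ × ℤ) = (n' : ℤ) • (D' : ℤ × ℤ) :=
      latVec_injective _ (one_div_ne_zero hβ) (Subtype.ext_iff.1 h)
    have e1 : (n : ℤ) * (D : ℤ × ℤ).1 = n' * (D' : ℤ × ℤ).1 := congrArg Prod.fst h1
    have e2 : (n : ℤ) * (D : ℤ × ℤ).2 = n' * (D' : ℤ × ℤ).2 := congrArg Prod.snd h1
    have hD : D = D' := by
      refine Subtype.ext (D.2.eq_of_cross D'.2 ?_)
      refine mul_left_cancel₀ (mul_ne_zero n.2 n'.2) ?_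
      calc (n : ℤ) * n' * ((D : ℤ × ℤ).1 * (D' : ℤ × ℤ).2)
          = (n * (D : ℤ × ℤ).1) * (n' * (D' : ℤ × ℤ).2) := by ring
        _ = (n' * (D' : ℤ × ℤ).1) * (n * (D : ℤ × ℤ).2) := by rw [e1, e2]
        _ = _ := by ring
    subst hD
    have hn : n = n' := by
      refine Subtype.ext ?_
      rcases D.2.2 with h | ⟨-, h⟩
      · exact mul_right_cancel₀ h.ne' e2
      · exact mul_right_cancel₀ h.ne' e1
    rw [hn]
  · rintro ⟨k, hk, hk0⟩
    obtain ⟨v, rfl⟩ := mem_latticeStar.1 hk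
    obtain ⟨D, n, hD, hv, -⟩ := exists_smul_isPrimHalf v
    have hn : n ≠ 0 := by
      rintro rfl
      rw [zero_smul] at hv
      exact hk0 (by simp [hv, latVec])
    exact ⟨(⟨D, hD⟩, ⟨n, hn⟩), Subtype.ext (by simp only [primMultiple]; rw [hv])⟩

/-- A radial sum over the nonzero lattice vectors, arranged by primitive vectors. -/
lemma hasSum_latticeStar (α : ℝ) {β κ R : ℝ} (hβ : β ≠ 0) (hκ : 0 < κ)
    (hle : ∀ v : ℤ × ℤ, κ * (max v.1.natAbs v.2.natAbs : ℕ) ≤ latNorm (-α / β) (1 / β) v)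
    {f : ℝ → ℝ} (hf0 : f 0 = 0) (hf : ∀ t, R < t → f t = 0) {N : ℕ} (hN : R ≤ κ * N) :
    HasSum (fun k : {k : ℂ // k ∈ latticeStar α β ∧ k ≠ 0} => f ‖(k : ℂ)‖)
      (∑ D ∈ primFinset N, ∑ n ∈ Finset.Icc (-(N : ℤ)) N,
        f |(n : ℝ) * latNorm (-α / β) (1 / β) D|) := by
  classical
  rw [← (Equiv.ofBijective _ (primMultiple_bijective α hβ)).hasSum_iff]
  have hval : ∑ D ∈ primFinset N, ∑ n ∈ Finset.Icc (-(N : ℤ)) N,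
        f |(n : ℝ) * latNorm (-α / β) (1 / β) D| =
      ∑ p ∈ primFinset N ×ˢ (Finset.Icc (-(N : ℤ)) N).subtype (· ≠ 0),
        ((fun k : {k : ℂ // k ∈ latticeStar α β ∧ k ≠ 0} => f ‖(k : ℂ)‖) ∘
          Equiv.ofBijective _ (primMultiple_bijective α hβ)) p := by
    rw [Finset.sum_product]
    refine Finset.sum_congr rfl fun D _ => ?_
    simp only [Function.comp, Equiv.ofBijective_apply, norm_primMultiple]
    rw [Finset.sum_subtype_eq_sum_filter (f := fun n : ℤ => f |(n : ℝ) * latNorm (-α / β) (1 / β) D|)]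
    refine (Finset.sum_filter_of_ne (p := fun n : ℤ => n ≠ 0) fun n _ hne h0 => hne ?_).symm
    rw [h0]; simp [hf0]
  rw [hval]
  -- Outside the box either `D` or `n` exceeds `N`; in both cases `|n| |D| > κ N ≥ R`.
  refine hasSum_sum_of_ne_finset_zero fun p hp => ?_
  simp only [Function.comp, Equiv.ofBijective_apply, norm_primMultiple]
  refine hf _ ?_
  rw [abs_mul, abs_of_nonneg (latNorm_nonneg _ _ _)]
  have hD := hle p.1
  have hn1 : (1 : ℝ) ≤ |((p.2 : ℤ) : ℝ)| := by
    rw [← Int.cast_abs]; exact_mod_cast Int.one_le_abs p.2.2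
  rw [Finset.mem_product, not_and_or, mem_primFinset, Finset.mem_subtype, Finset.mem_Icc] at hp
  rcases hp with hp | hp
  · have h1 : (N : ℝ) < (max (p.1 : ℤ × ℤ).1.natAbs (p.1 : ℤ × ℤ).2.natAbs : ℕ) := by
      exact_mod_cast not_le.1 hp
    have h2 := latNorm_nonneg (-α / β) (1 / β) p.1
    nlinarith
  · have h1 : (N : ℝ) < |((p.2 : ℤ) : ℝ)| := by
      rw [← Int.cast_abs]
      have : (N : ℤ) < |(p.2 : ℤ)| := by
        rw [lt_abs]; omega
      exact_mod_cast this
    have h2 : κ ≤ latNorm (-α / β) (1 / β) p.1 := by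
      refine le_trans ?_ hD
      have : (1 : ℝ) ≤ (max (p.1 : ℤ × ℤ).1.natAbs (p.1 : ℤ × ℤ).2.natAbs : ℕ) := by
        exact_mod_cast p.1.2.one_le_max
      nlinarith
    nlinarith

/-! ### Amplitudes and Fourier coefficients -/

/-- The amplitude of the frequency `x`. -/
def amplitude (β : ℝ) (ψ : ℝ → ℝ) (L M x : ℝ) : ℝ :=
  2 / (β * Real.pi) * (Real.sin (Real.pi * x / L) / x ^ (3 / 2 : ℝ) * kernelHat ψ (x / √M))

lemma amplitude_zero (β : ℝ) (ψ : ℝ → ℝ) (L M : ℝ) : amplitude β ψ L M 0 = 0 := by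
  simp [amplitude]

lemma rpow_three_halves {x : ℝ} (hx : 0 ≤ x) : x ^ (3 / 2 : ℝ) = x * √x := by
  rcases hx.eq_or_lt with rfl | hx
  · norm_num
  · rw [show (3 / 2 : ℝ) = 1 + 1 / 2 by norm_num, Real.rpow_add hx, Real.rpow_one,
      Real.sqrt_eq_rpow]

/-- The constant in the amplitude bound. -/
def amplitudeConst (β : ℝ) (ψ : ℝ → ℝ) : ℝ :=
  2 / (|β| * Real.pi) * ((1 + Real.pi) * ∫ x, |ψ x|)

lemma amplitudeConst_nonneg (β : ℝ) (ψ : ℝ → ℝ) : 0 ≤ amplitudeConst β ψ := by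
  have := Real.pi_pos
  have : 0 ≤ ∫ x, |ψ x| := integral_nonneg fun _ => abs_nonneg _
  unfold amplitudeConst; positivity

/-- The bounds `|sin| ≤ 1` and `|sin| ≤ πx/L` combine to `|sin| (x + L) ≤ (1 + π) x`, covering `x ≤
L` and `x ≥ L` at once. -/
lemma abs_amplitude_le (β : ℝ) (ψ : ℝ → ℝ) {L : ℝ} (hL : 0 < L) (M : ℝ) {x : ℝ} (hx : 0 ≤ x) :
    |amplitude β ψ L M x| ≤ amplitudeConst β ψ * (1 / (√x * (x + L))) := by
  rcases hx.eq_or_lt with rfl | hx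
  · simp [amplitude_zero]
  have hπ := Real.pi_pos
  have hs : 0 < √x := Real.sqrt_pos.2 hx
  have h1 : |Real.sin (Real.pi * x / L)| * (x + L) ≤ (1 + Real.pi) * x := by
    have e1 := Real.abs_sin_le_one (Real.pi * x / L)
    have e2 : |Real.sin (Real.pi * x / L)| ≤ Real.pi * x / L := by
      refine Real.abs_sin_le_abs.trans (le_of_eq (abs_of_pos (by positivity)))
    rw [le_div_iff₀ hL] at e2
    nlinarith
  have h2 : |Real.sin (Real.pi * x / L) / x ^ (3 / 2 : ℝ)| ≤ (1 + Real.pi) * (1 / (√x * (x + L))) := by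
    rw [rpow_three_halves hx.le, abs_div, abs_of_pos (by positivity : 0 < x * √x), mul_one_div,
      div_le_div_iff₀ (by positivity) (by positivity)]
    nlinarith
  rw [amplitude, abs_mul, abs_mul, abs_div, abs_mul, abs_of_pos hπ, abs_of_pos (two_pos (α := ℝ)),
    amplitudeConst, mul_assoc]
  refine mul_le_mul_of_nonneg_left ?_ (by positivity)
  calc _ ≤ (1 + Real.pi) * (1 / (√x * (x + L))) * ∫ x, |ψ x| :=
        mul_le_mul h2 (abs_kernelHat_le ψ _) (abs_nonneg _) (by positivity)
    _ = _ := by ring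

lemma amplitude_eq_zero {β : ℝ} {ψ : ℝ → ℝ} {R : ℝ} (hR : ∀ r, R < r → kernelHat ψ r = 0) (L : ℝ)
    {M : ℝ} (hM : 0 < M) {x : ℝ} (hx : R * √M < x) : amplitude β ψ L M x = 0 := by
  rw [amplitude, hR _ ((lt_div_iff₀ (Real.sqrt_pos.2 hM)).2 hx)]; simp

/-- The phase of the frequency `x`. -/
def phase (L x : ℝ) : ℝ := Real.pi * x / L + Real.pi / 4

/-- The Fourier coefficient of the frequency `x`, scaled by `√L`. -/
def freqCoeff (β : ℝ) (ψ : ℝ → ℝ) (L M x : ℝ) : ℂ :=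
  if 0 < x then ((√L * amplitude β ψ L M x : ℝ) : ℂ) * (-Complex.I * Complex.exp (phase L x * Complex.I))
  else ((√L * amplitude β ψ L M (-x) : ℝ) : ℂ) *
    (Complex.I * Complex.exp ((-phase L (-x) : ℝ) * Complex.I))

lemma norm_freqCoeff (β : ℝ) (ψ : ℝ → ℝ) (L M x : ℝ) :
    ‖freqCoeff β ψ L M x‖ = √L * |amplitude β ψ L M (|x|)| := by
  unfold freqCoeff
  split_ifs with h
  · rw [norm_mul, norm_mul, Complex.norm_exp_ofReal_mul_I, Complex.norm_real, norm_neg,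
      Complex.norm_I, abs_of_pos h, mul_one, mul_one, norm_mul, Real.norm_eq_abs, Real.norm_eq_abs,
      abs_of_nonneg (Real.sqrt_nonneg _)]
  · rw [norm_mul, norm_mul, Complex.norm_exp_ofReal_mul_I, Complex.norm_real,
      Complex.norm_I, abs_of_nonpos (not_lt.1 h), mul_one, mul_one, norm_mul, Real.norm_eq_abs,
      Real.norm_eq_abs, abs_of_nonneg (Real.sqrt_nonneg _)]

lemma freqCoeff_zero (β : ℝ) (ψ : ℝ → ℝ) (L M : ℝ) : freqCoeff β ψ L M 0 = 0 := by
  rw [← norm_eq_zero, norm_freqCoeff, abs_zero, amplitude_zero]; simp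

lemma norm_freqCoeff_le (β : ℝ) (ψ : ℝ → ℝ) {L : ℝ} (hL : 0 < L) (M x : ℝ) :
    ‖freqCoeff β ψ L M x‖ ≤ coeffWeight (amplitudeConst β ψ) L |x| := by
  rw [norm_freqCoeff, coeffWeight]
  have := mul_le_mul_of_nonneg_left (abs_amplitude_le β ψ hL M (abs_nonneg x)) (Real.sqrt_nonneg L)
  linarith

lemma freqCoeff_neg {x : ℝ} (hx : 0 < x) (β : ℝ) (ψ : ℝ → ℝ) (L M : ℝ) :
    freqCoeff β ψ L M (-x) = ((√L * amplitude β ψ L M x : ℝ) : ℂ) *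
    (Complex.I * Complex.exp ((-phase L x : ℝ) * Complex.I)) := by
  rw [freqCoeff, if_neg (by linarith), neg_neg]

/-- The phases cancel and `-i · i = 1`. This identifies the formal second moment with the variance.
-/
lemma freqCoeff_mul_neg (β : ℝ) (ψ : ℝ → ℝ) {L : ℝ} (hL : 0 ≤ L) (M x : ℝ) :
    freqCoeff β ψ L M x * freqCoeff β ψ L M (-x) = ((L * amplitude β ψ L M |x| ^ 2 : ℝ) : ℂ) := by
  have key : ∀ x : ℝ, 0 < x → freqCoeff β ψ L M x * freqCoeff β ψ L M (-x) =
      ((L * amplitude β ψ L M x ^ 2 : ℝ) : ℂ) := by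
    intro x hx
    rw [freqCoeff_neg hx, freqCoeff, if_pos hx]
    have he : Complex.exp (phase L x * Complex.I) * Complex.exp ((-phase L x : ℝ) * Complex.I) = 1 := by
      rw [← Complex.exp_add]; simp
    have hs : ((√L : ℝ) : ℂ) ^ 2 = L := by rw [← Complex.ofReal_pow, Real.sq_sqrt hL]
    push_cast at he ⊢
    calc _ = ((√L : ℝ) : ℂ) ^ 2 * (amplitude β ψ L M x : ℂ) ^ 2 * (-(Complex.I * Complex.I)) *
        (Complex.exp (phase L x * Complex.I) * Complex.exp (-phase L x * Complex.I)) := by ring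
      _ = _ := by rw [he, hs, Complex.I_mul_I]; ring
  rcases lt_trichotomy x 0 with h | rfl | h
  · have := key (-x) (by linarith)
    rw [neg_neg] at this
    rw [mul_comm, this, abs_of_neg h]
  · simp [freqCoeff_zero, amplitude_zero]
  · rw [key x h, abs_of_pos h]

/-- The vectors `k` and `-k` give equal sine terms, whence the factor `2`; together they are the
exponentials of frequencies `±|k|`. -/
lemma freqCoeff_pair {x : ℝ} (hx : 0 < x) (β : ℝ) (ψ : ℝ → ℝ) (L M t : ℝ) :
    freqCoeff β ψ L M x * Complex.exp (2 * Real.pi * x * t * Complex.I) +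
      freqCoeff β ψ L M (-x) * Complex.exp (2 * Real.pi * ((-x : ℝ) : ℂ) * t * Complex.I) =
    ((2 * (√L * (amplitude β ψ L M x *
      Real.sin (2 * Real.pi * (t + 1 / (2 * L)) * x + Real.pi / 4))) : ℝ) : ℂ) := by
  have hph : 2 * Real.pi * (t + 1 / (2 * L)) * x + Real.pi / 4 = 2 * Real.pi * x * t + phase L x := by
    unfold phase
    by_cases hL : L = 0
    · simp [hL]; ring
    · field_simp
      ring
  rw [hph, freqCoeff_neg hx, freqCoeff, if_pos hx]
  push_cast
  rw [Complex.sin]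
  have h1 : Complex.exp ((2 * Real.pi * x * t + phase L x) * Complex.I) =
      Complex.exp (phase L x * Complex.I) * Complex.exp (2 * Real.pi * x * t * Complex.I) := by
    rw [← Complex.exp_add]; ring_nf
  have h2 : Complex.exp (-(2 * Real.pi * x * t + phase L x) * Complex.I) =
      Complex.exp (-phase L x * Complex.I) * Complex.exp (2 * Real.pi * -x * t * Complex.I) := by
    rw [← Complex.exp_add]; ring_nf
  rw [h1, h2]
  ring

lemma sum_Icc_freqCoeff {d : ℝ} (hd : 0 < d) (β : ℝ) (ψ : ℝ → ℝ) (L M t : ℝ) (N : ℕ) :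
    ∑ n ∈ Finset.Icc (-(N : ℤ)) N, freqCoeff β ψ L M (n * d) *
      Complex.exp (2 * Real.pi * ((n * d : ℝ) : ℂ) * t * Complex.I) =
    ((√L * ∑ n ∈ Finset.Icc (-(N : ℤ)) N, amplitude β ψ L M |(n : ℝ) * d| *
      Real.sin (2 * Real.pi * (t + 1 / (2 * L)) * |(n : ℝ) * d| + Real.pi / 4) : ℝ) : ℂ) := by
  rw [sum_Icc_neg_eq, sum_Icc_neg_eq]
  simp only [Int.cast_zero, zero_mul, freqCoeff_zero, abs_zero, amplitude_zero, zero_add]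
  rw [Finset.mul_sum, Complex.ofReal_sum]
  refine Finset.sum_congr rfl fun n _ => ?_
  have hpos : 0 < ((n : ℝ) + 1) * d := by positivity
  have e1 : ((n + 1 : ℤ) : ℝ) * d = (n + 1) * d := by push_cast; ring
  have e2 : ((-(n + 1) : ℤ) : ℝ) * d = -((n + 1) * d) := by push_cast; ring
  rw [e1, e2, freqCoeff_pair hpos, abs_neg, abs_of_pos hpos]
  congr 1; ring

/-- The trigonometric sum, arranged by primitive vectors. -/
lemma smoothAnnulusSum_eq (α : ℝ) {β κ R : ℝ} (hβ : β ≠ 0) (hκ : 0 < κ)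
    (hle : ∀ v : ℤ × ℤ, κ * (max v.1.natAbs v.2.natAbs : ℕ) ≤ latNorm (-α / β) (1 / β) v)
    {ψ : ℝ → ℝ} (hR : ∀ r, R < r → kernelHat ψ r = 0) (L : ℝ) {M : ℝ} (hM : 0 < M) {N : ℕ}
    (hN : R * √M ≤ κ * N) (t : ℝ) :
    ((√L * smoothAnnulusSum α β ψ L M t : ℝ) : ℂ) =
      ∑ i ∈ primFinset N ×ˢ Finset.Icc (-(N : ℤ)) N,
        freqCoeff β ψ L M (i.2 * latNorm (-α / β) (1 / β) i.1) *
        Complex.exp (2 * Real.pi * ((i.2 * latNorm (-α / β) (1 / β) i.1 : ℝ) : ℂ) * t * Complex.I) := by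
  rw [Finset.sum_product]
  simp only
  have h := (hasSum_latticeStar α hβ hκ hle (f := fun x => amplitude β ψ L M x *
      Real.sin (2 * Real.pi * (t + 1 / (2 * L)) * x + Real.pi / 4)) (by simp [amplitude_zero])
      (fun x hx => by rw [amplitude_eq_zero hR L hM hx, zero_mul]) hN).tsum_eq
  have hs : smoothAnnulusSum α β ψ L M t = ∑' k : {k : ℂ // k ∈ latticeStar α β ∧ k ≠ 0},
      amplitude β ψ L M ‖(k : ℂ)‖ *
        Real.sin (2 * Real.pi * (t + 1 / (2 * L)) * ‖(k : ℂ)‖ + Real.pi / 4) := by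
    rw [smoothAnnulusSum, ← tsum_mul_left]
    refine tsum_congr fun k => ?_
    rw [amplitude]; ring
  rw [hs, h, Finset.mul_sum, Complex.ofReal_sum]
  refine Finset.sum_congr rfl fun D _ => ?_
  rw [sum_Icc_freqCoeff (latNorm_pos (one_div_ne_zero hβ) D.2.ne_zero)]

lemma hasSum_smoothVariance (α : ℝ) {β κ R : ℝ} (hβ : β ≠ 0) (hκ : 0 < κ)
    (hle : ∀ v : ℤ × ℤ, κ * (max v.1.natAbs v.2.natAbs : ℕ) ≤ latNorm (-α / β) (1 / β) v)
    {ψ : ℝ → ℝ} (hR : ∀ r, R < r → kernelHat ψ r = 0) (L : ℝ) {M : ℝ} (hM : 0 < M) {N : ℕ}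
    (hN : R * √M ≤ κ * N) :
    HasSum (fun k : {k : ℂ // k ∈ latticeStar α β ∧ k ≠ 0} => amplitude β ψ L M ‖(k : ℂ)‖ ^ 2)
      (smoothVariance α β ψ L M) ∧
    smoothVariance α β ψ L M = ∑ D ∈ primFinset N, ∑ n ∈ Finset.Icc (-(N : ℤ)) N,
      amplitude β ψ L M |(n : ℝ) * latNorm (-α / β) (1 / β) D| ^ 2 := by
  have h := hasSum_latticeStar α hβ hκ hle (f := fun x => amplitude β ψ L M x ^ 2)
      (by simp [amplitude_zero])
      (fun x hx => by rw [amplitude_eq_zero hR L hM hx, zero_pow two_ne_zero]) hN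
  have hs : smoothVariance α β ψ L M = ∑' k : {k : ℂ // k ∈ latticeStar α β ∧ k ≠ 0},
      amplitude β ψ L M ‖(k : ℂ)‖ ^ 2 := by
    rw [smoothVariance, ← tsum_mul_left]
    refine tsum_congr fun k => ?_
    rw [amplitude, rpow_three_halves (norm_nonneg _), mul_pow, mul_pow, div_pow, div_pow, mul_pow,
      mul_pow, Real.sq_sqrt (norm_nonneg _)]
    ring
  have hs' := hs.trans h.tsum_eq
  exact ⟨by rw [hs']; exact h, hs'⟩

/-- The constant terms of the squares add up to the scaled variance. -/
lemma sum_constTerm_sq (α : ℝ) {β κ R : ℝ} (hβ : β ≠ 0) (hκ : 0 < κ)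
    (hle : ∀ v : ℤ × ℤ, κ * (max v.1.natAbs v.2.natAbs : ℕ) ≤ latNorm (-α / β) (1 / β) v)
    {ψ : ℝ → ℝ} (hR : ∀ r, R < r → kernelHat ψ r = 0) {L : ℝ} (hL : 0 ≤ L) {M : ℝ} (hM : 0 < M)
    {N : ℕ} (hN : R * √M ≤ κ * N) :
    ∑ D ∈ primFinset N,
      constTerm (multSum (freqCoeff β ψ L M) N (latNorm (-α / β) (1 / β) D) ^ 2) =
      ((L * smoothVariance α β ψ L M : ℝ) : ℂ) := by
  rw [(hasSum_smoothVariance α hβ hκ hle hR L hM hN).2, Finset.mul_sum, Complex.ofReal_sum]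
  refine Finset.sum_congr rfl fun D _ => ?_
  rw [constTerm_multSum_sq _ _ (latNorm_pos (one_div_ne_zero hβ) D.2.ne_zero).ne', Finset.mul_sum,
    Complex.ofReal_sum]
  exact Finset.sum_congr rfl fun n _ => freqCoeff_mul_neg β ψ hL M _

/-! ### Lower bound for the variance -/

/-- The variance is at least a constant multiple of `1 / L`. -/
lemma exists_le_mul_smoothVariance (α : ℝ) {β : ℝ} (hβ : β ≠ 0) {ψ : ℝ → ℝ}
    (hψ : IsSmoothingKernel ψ) :
    ∃ v₀ r₀ L₀ : ℝ, 0 < v₀ ∧ 0 < r₀ ∧ ∀ L M : ℝ, L₀ ≤ L → 0 < M → L / √M ≤ r₀ →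
      v₀ ≤ L * smoothVariance α β ψ L M := by
  have hη : 1 / β ≠ 0 := one_div_ne_zero hβ
  have hπ := Real.pi_pos
  obtain ⟨κ, hκ, -, hle⟩ := exists_le_latNorm (-α / β) hη
  obtain ⟨R, -, hR⟩ := exists_kernelHat_eq_zero hψ.fourier_compact
  have hcont := (continuous_kernelHat hψ.integrable).tendsto 0
  rw [kernelHat_zero hψ.mass_one] at hcont
  obtain ⟨r₀, hr₀, hr⟩ := Metric.eventually_nhds_iff.1
    (hcont.eventually (le_mem_nhds (by norm_num : (1 / 2 : ℝ) < 1)))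
  set κ₂ : ℝ := 1 + |-α / β| + |1 / β| with hκ₂
  have hκ₂0 : 0 < κ₂ := by positivity
  refine ⟨1 / (β ^ 2 * Real.pi ^ 2 * κ₂ ^ 2), r₀, 4 * κ₂, by positivity, hr₀, ?_⟩
  intro L M hL hM hLM
  have hL0 : 0 < L := by linarith
  have hsM : 0 < √M := Real.sqrt_pos.2 hM
  obtain ⟨N, hN⟩ := exists_nat_ge (R * √M / κ)
  rw [div_le_iff₀ hκ, mul_comm _ κ] at hN
  have hsum := (hasSum_smoothVariance α hβ hκ hle hR L hM hN).1
  -- Vectors with entries at most `J` have norm at most `κ₂ J ≤ L / 2`. There Jordan's inequality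
  -- gives `sin (πx/L) ≥ 2x/L`, and `x/√M < r₀` keeps `ψ̂` above `1/2`. The condition `L ≥ 4 κ₂`
  -- limits the loss from the floor.
  set J : ℕ := ⌊L / (2 * κ₂)⌋₊ with hJ
  have hJ1 : (J : ℝ) ≤ L / (2 * κ₂) := Nat.floor_le (by positivity)
  have hJ2 : L / (4 * κ₂) ≤ J := by
    have h1 := (Nat.lt_floor_add_one (L / (2 * κ₂))).le
    have h2 : 1 ≤ L / (4 * κ₂) := by rw [le_div_iff₀ (by positivity)]; linarith
    have h3 : L / (2 * κ₂) = L / (4 * κ₂) + L / (4 * κ₂) := by field_simp; ring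
    linarith
  have hJpos : (0 : ℝ) < J := lt_of_lt_of_le (by positivity) hJ2
  have hJL : κ₂ * J ≤ L / 2 := by
    rw [le_div_iff₀ (by positivity)] at hJ1 ⊢; linarith
  have hlow : ∀ x : ℝ, 0 < x → x ≤ κ₂ * J →
      4 / (β ^ 2 * Real.pi ^ 2 * (L ^ 2 * (κ₂ * J))) ≤ amplitude β ψ L M x ^ 2 := by
    intro x hx hxJ
    have hxL : x ≤ L / 2 := hxJ.trans hJL
    have hsin : 2 * x / L ≤ Real.sin (Real.pi * x / L) := by
      have := Real.mul_le_sin (x := Real.pi * x / L) (by positivity) (by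
        rw [div_le_div_iff₀ hL0 two_pos]; nlinarith)
      refine le_trans (le_of_eq ?_) this
      field_simp
    have hker : 1 / 2 ≤ kernelHat ψ (x / √M) := by
      refine hr ?_
      rw [dist_zero_right, Real.norm_eq_abs, abs_of_pos (by positivity)]
      refine lt_of_lt_of_le ?_ hLM
      exact div_lt_div_of_pos_right (by linarith) hsM
    have hprod : 2 * x / L / (x * √x) * (1 / 2) ≤
        Real.sin (Real.pi * x / L) / (x * √x) * kernelHat ψ (x / √M) := by
      have hs : 0 < √x := Real.sqrt_pos.2 hx
      have h0 : 0 ≤ 2 * x / L := by positivity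
      exact mul_le_mul (div_le_div_of_nonneg_right hsin (by positivity)) hker (by norm_num)
        (div_nonneg (h0.trans hsin) (by positivity))
    have hs : 0 < √x := Real.sqrt_pos.2 hx
    have hsq := pow_le_pow_left₀ (by positivity) hprod 2
    rw [amplitude, rpow_three_halves hx.le, mul_pow]
    have e1 : (2 * x / L / (x * √x) * (1 / 2)) ^ 2 = 1 / (L ^ 2 * x) := by
      have : √x ^ 2 = x := Real.sq_sqrt hx.le
      field_simp
      rw [this]
    rw [e1] at hsq
    have e2 : (2 / (β * Real.pi)) ^ 2 = 4 / (β ^ 2 * Real.pi ^ 2) := by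
      field_simp; ring
    rw [e2]
    have hβ2 : 0 < β ^ 2 := by positivity
    calc 4 / (β ^ 2 * Real.pi ^ 2 * (L ^ 2 * (κ₂ * J)))
        = 4 / (β ^ 2 * Real.pi ^ 2) * (1 / (L ^ 2 * (κ₂ * J))) := by field_simp
      _ ≤ 4 / (β ^ 2 * Real.pi ^ 2) * (1 / (L ^ 2 * x)) := by gcongr
      _ ≤ _ := mul_le_mul_of_nonneg_left hsq (by positivity)
  -- The `J²` vectors with positive entries suffice: each contributes a constant times `L⁻² J⁻¹`,
  -- and `J` is of order `L`.
  set e : ℕ × ℕ → {k : ℂ // k ∈ latticeStar α β ∧ k ≠ 0} := fun p =>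
    ⟨latVec (-α / β) (1 / β) ((p.1 : ℤ) + 1, (p.2 : ℤ) + 1), mem_latticeStar.2 ⟨_, rfl⟩, fun h => by
      have h1 : latVec (-α / β) (1 / β) 0 = 0 := by simp [latVec]
      have h2 := latVec_injective _ hη (h.trans h1.symm)
      have h3 : (p.1 : ℤ) + 1 = 0 := congrArg Prod.fst h2
      omega⟩ with he
  have hinj : Function.Injective e := by
    intro p q hpq
    have h2 := latVec_injective _ hη (Subtype.ext_iff.1 hpq)
    have h3 : (p.1 : ℤ) + 1 = q.1 + 1 := congrArg Prod.fst h2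
    have h4 : (p.2 : ℤ) + 1 = q.2 + 1 := congrArg Prod.snd h2
    exact Prod.ext (by omega) (by omega)
  have hfin := sum_le_hasSum ((Finset.range J ×ˢ Finset.range J).map ⟨e, hinj⟩)
    (fun k _ => sq_nonneg _) hsum
  rw [Finset.sum_map] at hfin
  have hcard := Finset.card_nsmul_le_sum (Finset.range J ×ˢ Finset.range J)
    (fun p => amplitude β ψ L M ‖(e p : ℂ)‖ ^ 2)
    (4 / (β ^ 2 * Real.pi ^ 2 * (L ^ 2 * (κ₂ * J)))) (fun p hp => by
      rw [Finset.mem_product, Finset.mem_range, Finset.mem_range] at hp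
      have hv : ‖(e p : ℂ)‖ = latNorm (-α / β) (1 / β) ((p.1 : ℤ) + 1, (p.2 : ℤ) + 1) := by
        simp only [he]; rw [norm_latVec]
      refine hlow _ (norm_pos_iff.2 (e p).2.2) ?_
      rw [hv, mul_comm]
      have hb : ∀ q : ℕ, q < J → |(((q : ℤ) + 1 : ℤ) : ℝ)| ≤ J := fun q hq => by
        push_cast
        rw [abs_of_nonneg (by positivity)]
        exact_mod_cast hq
      exact latNorm_le (hb _ hp.1) (hb _ hp.2))
  rw [Finset.card_product, Finset.card_range, nsmul_eq_mul] at hcard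
  have hlast := mul_le_mul_of_nonneg_left (hcard.trans hfin) hL0.le
  refine le_trans ?_ hlast
  push_cast
  have hβ2 : 0 < β ^ 2 := by positivity
  have e3 : L * ((J : ℝ) * J * (4 / (β ^ 2 * Real.pi ^ 2 * (L ^ 2 * (κ₂ * J))))) =
      4 / (β ^ 2 * Real.pi ^ 2 * (L * κ₂)) * J := by field_simp
  rw [e3]
  calc 1 / (β ^ 2 * Real.pi ^ 2 * κ₂ ^ 2)
      = 4 / (β ^ 2 * Real.pi ^ 2 * (L * κ₂)) * (L / (4 * κ₂)) := by field_simp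
    _ ≤ _ := mul_le_mul_of_nonneg_left hJ2 (by positivity)

/-! ### Comparison of the moment with the Gaussian moment -/

lemma weightedMean_scaled (ω : ℝ → ℝ) (T a : ℝ) (S : ℝ → ℝ) (m : ℕ) :
    weightedMean ω T (fun t => (a * S t) ^ m) = a ^ m * weightedMean ω T fun t => S t ^ m := by
  simp only [weightedMean, mul_pow, mul_assoc]
  rw [integral_const_mul]
  ring

lemma sum_single_eq_sum_multSum (x y : ℝ) (c : ℝ → ℂ) (N : ℕ) :
    ∑ i ∈ primFinset N ×ˢ Finset.Icc (-(N : ℤ)) N,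
      AddMonoidAlgebra.single ((i.2 : ℝ) * latNorm x y i.1) (c (i.2 * latNorm x y i.1)) =
    ∑ D ∈ primFinset N, multSum c N (latNorm x y D) := by
  rw [Finset.sum_product]; rfl

/-- Nonzero frequencies of the expanded power are bounded below. -/
lemma le_abs_sum_freq {α β : ℝ} {m K : ℕ} {c : ℝ}
    (hsep : ∀ X : ℝ, 1 ≤ X → ∀ (a b : Fin m → ℤ) (ε z : Fin m → ℝ),
      (∀ j, ε j = 1 ∨ ε j = -1) →
      (∀ j, z j = (a j : ℝ) ^ 2 + (b j : ℝ) ^ 2 * (-α / β) ^ 2 + 2 * a j * b j * (-α / β)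
        + (b j : ℝ) ^ 2 * (1 / β) ^ 2) →
      (∀ j, z j ≤ X) → ∑ j, ε j * √(z j) ≠ 0 → c / X ^ K ≤ |∑ j, ε j * √(z j)|)
    {ψ : ℝ → ℝ} {R : ℝ} (hR : ∀ r, R < r → kernelHat ψ r = 0) {L M : ℝ} (hM : 0 < M)
    (hRM : 1 ≤ R ^ 2 * M) (p : Fin m → {D : ℤ × ℤ // IsPrimHalf D} × ℤ)
    (hp : ∀ j, freqCoeff β ψ L M ((p j).2 * latNorm (-α / β) (1 / β) (p j).1) ≠ 0)
    (hne : ∑ j, ((p j).2 : ℝ) * latNorm (-α / β) (1 / β) (p j).1 ≠ 0) :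
    c / (R ^ 2 * M) ^ K ≤ |∑ j, ((p j).2 : ℝ) * latNorm (-α / β) (1 / β) (p j).1| := by
  set v : Fin m → ℤ × ℤ := fun j => (p j).2 • ((p j).1 : ℤ × ℤ) with hv
  set ε : Fin m → ℝ := fun j => if 0 ≤ (p j).2 then 1 else -1 with hε
  set z : Fin m → ℝ := fun j => latForm (-α / β) (1 / β) (v j) with hz
  have hsqrt : ∀ j, √(z j) = |((p j).2 : ℝ)| * latNorm (-α / β) (1 / β) (p j).1 := fun j =>
    latNorm_smul _ _ _ _
  have hterm : ∀ j, ((p j).2 : ℝ) * latNorm (-α / β) (1 / β) (p j).1 = ε j * √(z j) := by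
    intro j
    rw [hsqrt, ← mul_assoc]
    congr 1
    simp only [hε]
    split_ifs with h
    · rw [one_mul, abs_of_nonneg (by exact_mod_cast h)]
    · have : ((p j).2 : ℝ) < 0 := by exact_mod_cast not_le.1 h
      rw [abs_of_neg this]; ring
  -- A nonzero coefficient forces the frequency into the range where `ψ̂` does not vanish.
  have hzX : ∀ j, z j ≤ R ^ 2 * M := by
    intro j
    have h1 : √(z j) ≤ R * √M := by
      by_contra hlt
      refine hp j (norm_eq_zero.1 ?_)
      rw [norm_freqCoeff, abs_mul, abs_of_nonneg (latNorm_nonneg _ _ _), ← hsqrt,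
        amplitude_eq_zero hR L hM (not_le.1 hlt)]
      simp
    have h2 := pow_le_pow_left₀ (Real.sqrt_nonneg _) h1 2
    rwa [Real.sq_sqrt (latForm_nonneg _ _ _), mul_pow, Real.sq_sqrt hM.le] at h2
  rw [Finset.sum_congr rfl fun j _ => hterm j] at hne ⊢
  refine hsep _ hRM (fun j => (v j).1) (fun j => (v j).2) ε z (fun j => ?_) (fun j => ?_) hzX hne
  · simp only [hε]; split_ifs <;> simp
  · simp only [hz, latForm]; ring

lemma card_primFinset_le (N : ℕ) : ((primFinset N).card : ℝ) ≤ (2 * N + 1) ^ 2 := by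
  classical
  have h : (primFinset N).card ≤ (2 * N + 1) ^ 2 := by
    rw [primFinset, Finset.card_subtype]
    refine (Finset.card_filter_le _ _).trans (le_of_eq ?_)
    rw [Finset.card_product, Int.card_Icc, sq]
    have : ((N : ℤ) + 1 - -(N : ℤ)).toNat = 2 * N + 1 := by omega
    rw [this]
  exact_mod_cast h

/-- A crude bound, polynomial in `N`, is enough, since it meets arbitrarily fast decay of `ω̂`. -/
lemma sum_norm_freqCoeff_le (α : ℝ) {β κ : ℝ} (hκ : 0 < κ)
    (hle : ∀ v : ℤ × ℤ, κ * (max v.1.natAbs v.2.natAbs : ℕ) ≤ latNorm (-α / β) (1 / β) v)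
    (ψ : ℝ → ℝ) {L : ℝ} (hL : 0 < L) (M : ℝ) (N : ℕ) :
    ∑ i ∈ primFinset N ×ˢ Finset.Icc (-(N : ℤ)) N,
      ‖freqCoeff β ψ L M (i.2 * latNorm (-α / β) (1 / β) i.1)‖ ≤
      (2 * N + 1) ^ 2 * (2 * Real.pi * amplitudeConst β ψ / κ) := by
  have hC := amplitudeConst_nonneg β ψ
  have hπ := Real.pi_pos
  rw [Finset.sum_product]
  refine (Finset.sum_le_card_nsmul _ _ (2 * Real.pi * amplitudeConst β ψ / κ) fun D _ => ?_).trans ?_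
  · have hd : κ ≤ latNorm (-α / β) (1 / β) D := by
      refine le_trans ?_ (hle D)
      have : (1 : ℝ) ≤ (max (D : ℤ × ℤ).1.natAbs (D : ℤ × ℤ).2.natAbs : ℕ) := by
        exact_mod_cast D.2.one_le_max
      nlinarith
    refine (sum_norm_le hC hL (norm_freqCoeff_le β ψ hL M) N (hκ.trans_le hd)).trans ?_
    gcongr
  · rw [nsmul_eq_mul]
    exact mul_le_mul_of_nonneg_right (card_primFinset_le N) (by positivity)

set_option maxHeartbeats 1000000 in
/-- The scaled moment is close to the Gaussian moment of the scaled variance. -/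
lemma exists_norm_moment_sub_gaussMoment_le {m : ℕ} {α β : ℝ} (hβ : β ≠ 0)
    (hind : ∀ p : MvPolynomial (Fin 2) ℤ, MvPolynomial.aeval ![-α / β, 1 / β] p = 0 → p = 0)
    {ω ψ : ℝ → ℝ} (hω : IsAveragingWeight ω) (hψ : IsSmoothingKernel ψ) {K : ℕ} (hK : 0 < K)
    (hsep : SqrtSumsSeparated (-α / β) (1 / β) m K) {δ : ℝ} (hδ : 0 < δ) {L M : ℝ → ℝ}
    (hM : M =O[atTop] (fun T : ℝ => T ^ ((1 - δ) / (K : ℝ)))) (hL : Tendsto L atTop atTop)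
    (hLM : ∀ᶠ T in atTop, L T ≤ √(M T)) :
    ∃ C : ℝ, ∀ᶠ T in atTop,
      ‖((√(L T) ^ m * smoothMoment α β ω ψ m T (L T) (M T) : ℝ) : ℂ) -
        gaussMoment m ((L T * smoothVariance α β ψ (L T) (M T) : ℝ) : ℂ)‖ ≤
          C * (Real.log (L T) / L T) := by
  classical
  have hη : 1 / β ≠ 0 := one_div_ne_zero hβ
  have hπ := Real.pi_pos
  obtain ⟨κ, hκ, -, hle⟩ := exists_le_latNorm (-α / β) hη
  obtain ⟨R₁, hR₁, hR₁'⟩ := exists_kernelHat_eq_zero hψ.fourier_compact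
  -- The maximum with `1` guarantees `R ^ 2 * M ≥ 1`, as the separation condition requires of `X`.
  set R : ℝ := max R₁ 1 with hRdef
  have hR1 : 1 ≤ R := le_max_right _ _
  have hR0 : 0 < R := by linarith
  have hR : ∀ r, R < r → kernelHat ψ r = 0 := fun r hr => hR₁' r ((le_max_left _ _).trans_lt hr)
  set C₀ := amplitudeConst β ψ with hC₀
  have hC₀0 : 0 ≤ C₀ := amplitudeConst_nonneg β ψ
  obtain ⟨K₁, hK₁, hclose⟩ := constTerm_pow_close hη hind hC₀0 m
  obtain ⟨c, hc, hsep⟩ := hsep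
  obtain ⟨CM, hCM⟩ := hM.bound
  set B : ℝ := max CM 1 with hB
  have hB1 : 1 ≤ B := le_max_right _ _
  have hB0 : 0 < B := by linarith
  -- With this exponent `(T ^ δ) ^ A = T ^ (m + 1)`, which beats the total coefficient mass `O(T ^
  -- m)` by one power of `T`.
  set A : ℝ := ((m : ℝ) + 1) / δ with hA
  have hA0 : 0 < A := by positivity
  obtain ⟨CA, hCA⟩ := hω.fourier_decay A hA0
  set c' : ℝ := c / (R ^ (2 * K) * B ^ K) with hc'
  have hc'0 : 0 < c' := by positivity
  set P : ℝ := 9 * (R / κ + 1) ^ 2 * (2 * Real.pi * C₀ / κ) with hP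
  have hP0 : 0 ≤ P := by positivity
  set E : ℝ := (P * B ^ K) ^ m * (|CA| / c' ^ A) with hE
  have hE0 : 0 ≤ E := by positivity
  refine ⟨K₁ + E * B ^ K, ?_⟩
  filter_upwards [hL.eventually hclose, hL.eventually_ge_atTop 3, hLM, hCM, eventually_ge_atTop 1]
    with T hcl hL3 hLMT hMT hT1
  set l := L T
  set μ := M T
  have hT0 : 0 < T := by linarith
  have hl0 : 0 < l := by linarith
  have hsμ : 1 ≤ √μ := by linarith
  have hμ1 : 1 ≤ μ := by
    by_contra h
    have : √μ < 1 := by rw [Real.sqrt_lt' one_pos]; linarith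
    linarith
  have hμ0 : 0 < μ := by linarith
  have hsq : √μ ^ 2 = μ := Real.sq_sqrt hμ0.le
  have hlμ : l ≤ μ := by nlinarith
  have hμK : μ ^ K ≤ B ^ K * T ^ (1 - δ) := by
    have hTe : 0 < T ^ ((1 - δ) / (K : ℝ)) := Real.rpow_pos_of_pos hT0 _
    have h1 : μ ≤ B * T ^ ((1 - δ) / (K : ℝ)) := by
      rw [Real.norm_eq_abs, Real.norm_eq_abs, abs_of_pos hμ0, abs_of_pos hTe] at hMT
      exact hMT.trans (mul_le_mul_of_nonneg_right (le_max_left _ _) hTe.le)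
    have h2 := pow_le_pow_left₀ hμ0.le h1 K
    rw [mul_pow, ← Real.rpow_natCast (T ^ _), ← Real.rpow_mul hT0.le, div_mul_cancel₀] at h2
    · exact h2
    · exact_mod_cast hK.ne'
  have hμT : μ ≤ B ^ K * T := by
    have h1 : μ ≤ μ ^ K := le_self_pow₀ hμ1 hK.ne'
    have h2 : T ^ (1 - δ) ≤ T := by
      conv_rhs => rw [← Real.rpow_one T]
      exact Real.rpow_le_rpow_of_exponent_le hT1 (by linarith)
    exact h1.trans (hμK.trans (mul_le_mul_of_nonneg_left h2 (by positivity)))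
  set N : ℕ := ⌈R * √μ / κ⌉₊ with hNdef
  have hN1 : R * √μ ≤ κ * N := by
    have := Nat.le_ceil (R * √μ / κ)
    rw [div_le_iff₀ hκ] at this
    linarith
  have hN2 : (N : ℝ) ≤ (R / κ + 1) * √μ := by
    have := (Nat.ceil_lt_add_one (by positivity : 0 ≤ R * √μ / κ)).le
    calc (N : ℝ) ≤ R * √μ / κ + 1 := this
      _ ≤ R * √μ / κ + √μ := by linarith
      _ = _ := by ring
  have hN3 : (2 * (N : ℝ) + 1) ^ 2 ≤ 9 * (R / κ + 1) ^ 2 * μ := by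
    have hq : 0 ≤ R / κ * √μ := by positivity
    have : 2 * (N : ℝ) + 1 ≤ 3 * (R / κ + 1) * √μ := by nlinarith
    calc _ ≤ (3 * (R / κ + 1) * √μ) ^ 2 := pow_le_pow_left₀ (by positivity) this 2
      _ = 9 * (R / κ + 1) ^ 2 * √μ ^ 2 := by ring
      _ = _ := by rw [hsq]
  have hgauss := hcl N (freqCoeff β ψ l μ) (norm_freqCoeff_le β ψ hl0 μ)
  rw [sum_constTerm_sq α hβ hκ hle hR hl0.le hμ0 hN1] at hgauss
  have hfour : ∀ p : Fin m → {D : ℤ × ℤ // IsPrimHalf D} × ℤ,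
      (∀ j, p j ∈ primFinset N ×ˢ Finset.Icc (-(N : ℤ)) N) →
      (∀ j, freqCoeff β ψ l μ ((p j).2 * latNorm (-α / β) (1 / β) (p j).1) ≠ 0) →
      ∑ j, ((p j).2 : ℝ) * latNorm (-α / β) (1 / β) (p j).1 ≠ 0 →
      ‖𝓕 (fun s : ℝ => (ω s : ℂ))
        (-((∑ j, ((p j).2 : ℝ) * latNorm (-α / β) (1 / β) (p j).1) * T))‖ ≤
        |CA| / c' ^ A / T ^ (m + 1) := by
    intro p _ hp hne
    have hlow := le_abs_sum_freq hsep hR hμ0 (by nlinarith [one_le_pow₀ hR1 (n := 2)]) p hp hne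
    set x := ∑ j, ((p j).2 : ℝ) * latNorm (-α / β) (1 / β) (p j).1
    have hTδ : 0 < T ^ (1 - δ) := Real.rpow_pos_of_pos hT0 _
    have hTδ' : 0 < T ^ δ := Real.rpow_pos_of_pos hT0 _
    have hTT : T = T ^ δ * T ^ (1 - δ) := by
      rw [← Real.rpow_add hT0]; simp
    have h1 : c' * T ^ δ ≤ |-(x * T)| := by
      rw [abs_neg, abs_mul, abs_of_pos hT0]
      have e1 : c' / T ^ (1 - δ) ≤ c / (R ^ 2 * μ) ^ K := by
        rw [hc', div_div, mul_pow, ← pow_mul]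
        refine div_le_div_of_nonneg_left hc.le (by positivity) ?_
        rw [mul_assoc]
        exact mul_le_mul_of_nonneg_left hμK (by positivity)
      calc c' * T ^ δ = c' / T ^ (1 - δ) * (T ^ δ * T ^ (1 - δ)) := by field_simp
        _ = c' / T ^ (1 - δ) * T := by rw [← hTT]
        _ ≤ |x| * T := mul_le_mul_of_nonneg_right (e1.trans hlow) hT0.le
    refine (hCA _).trans ?_
    have h2 : c' ^ A * T ^ (m + 1) ≤ (1 + |-(x * T)|) ^ A := by
      have e1 : c' ^ A * T ^ (m + 1) = (c' * T ^ δ) ^ A := by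
        rw [Real.mul_rpow hc'0.le hTδ'.le, ← Real.rpow_mul hT0.le, hA, mul_div_cancel₀ _ hδ.ne',
          ← Real.rpow_natCast]
        push_cast; rfl
      rw [e1]
      exact Real.rpow_le_rpow (by positivity) (by linarith) hA0.le
    rw [div_div]
    exact div_le_div₀ (abs_nonneg _) (le_abs_self _) (by positivity) h2
  have hmean := norm_weightedMean_pow_sub_constTerm_le hω.integrable hω.mass_one hT0
    (primFinset N ×ˢ Finset.Icc (-(N : ℤ)) N)
    (fun i => (i.2 : ℝ) * latNorm (-α / β) (1 / β) i.1)
    (fun i => freqCoeff β ψ l μ (i.2 * latNorm (-α / β) (1 / β) i.1))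
    (smoothAnnulusSum_eq α hβ hκ hle hR l hμ0 hN1) m
    (δ := |CA| / c' ^ A / T ^ (m + 1)) (by positivity) hfour
  rw [weightedMean_scaled, sum_single_eq_sum_multSum] at hmean
  have hmean' : ‖((√l ^ m * smoothMoment α β ω ψ m T l μ : ℝ) : ℂ) -
      constTerm ((∑ D ∈ primFinset N,
        multSum (freqCoeff β ψ l μ) N (latNorm (-α / β) (1 / β) D)) ^ m)‖ ≤ E / T := by
    refine hmean.trans ?_
    have h1 : (∑ i ∈ primFinset N ×ˢ Finset.Icc (-(N : ℤ)) N,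
        ‖freqCoeff β ψ l μ (i.2 * latNorm (-α / β) (1 / β) i.1)‖) ≤ P * B ^ K * T := by
      refine (sum_norm_freqCoeff_le α hκ hle ψ hl0 μ N).trans ?_
      calc _ ≤ 9 * (R / κ + 1) ^ 2 * μ * (2 * Real.pi * C₀ / κ) :=
            mul_le_mul_of_nonneg_right hN3 (by positivity)
        _ = P * μ := by rw [hP]; ring
        _ ≤ P * (B ^ K * T) := mul_le_mul_of_nonneg_left hμT hP0
        _ = _ := by ring
    have h2 := pow_le_pow_left₀ (Finset.sum_nonneg fun _ _ => norm_nonneg _) h1 m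
    calc _ ≤ (P * B ^ K * T) ^ m * (|CA| / c' ^ A / T ^ (m + 1)) :=
          mul_le_mul_of_nonneg_right h2 (by positivity)
      _ = E / T := by
          rw [hE, mul_pow _ T, pow_succ]
          have : 0 < c' ^ A := by positivity
          field_simp
  have hlog : 1 ≤ Real.log l := by
    rw [Real.le_log_iff_exp_le hl0]
    exact (Real.exp_one_lt_d9.le.trans (by norm_num)).trans hL3
  -- The error `1/T` is absorbed because `L ≤ √M ≤ M ≪ T`.
  have hTl : E / T ≤ E * B ^ K * (Real.log l / l) := by
    have h1 : l ≤ B ^ K * T := hlμ.trans hμT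
    have h2 : 1 / T ≤ B ^ K * (Real.log l / l) := by
      rw [← mul_div_assoc, div_le_div_iff₀ hT0 hl0, one_mul]
      have : B ^ K * T ≤ B ^ K * Real.log l * T := by
        have h3 : 0 ≤ B ^ K * T := by positivity
        nlinarith
      linarith
    calc E / T = E * (1 / T) := by ring
      _ ≤ E * (B ^ K * (Real.log l / l)) := mul_le_mul_of_nonneg_left h2 hE0
      _ = _ := by ring
  refine (norm_sub_le_norm_sub_add_norm_sub _ (constTerm ((∑ D ∈ primFinset N,
    multSum (freqCoeff β ψ l μ) N (latNorm (-α / β) (1 / β) D)) ^ m)) _).trans ?_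
  calc _ ≤ E / T + K₁ * (Real.log l / l) := add_le_add hmean' hgauss
    _ ≤ E * B ^ K * (Real.log l / l) + K₁ * (Real.log l / l) := by linarith
    _ = _ := by ring

lemma eq_zero_of_aeval_eq_zero {ξ η : ℝ} (hind : AlgebraicIndependent ℚ ![ξ, η])
    (p : MvPolynomial (Fin 2) ℤ) (hp : MvPolynomial.aeval ![ξ, η] p = 0) : p = 0 := by
  have h : MvPolynomial.aeval ![ξ, η] (MvPolynomial.map (algebraMap ℤ ℚ) p) = (0 : ℝ) := by
    rw [← hp, MvPolynomial.aeval_map_algebraMap ℚ]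
  have h2 := (algebraicIndependent_iff.1 hind) _ h
  exact MvPolynomial.map_injective (algebraMap ℤ ℚ) Int.cast_injective (h2.trans (map_zero _).symm)

end

theorem proposition2p3 (m : ℕ) (α β : ℝ) (hβ : β ≠ 0)
    (hind : AlgebraicIndependent ℚ ![-α / β, 1 / β])
    (hdioph : StronglyDiophantine (-α / β) (1 / β))
    (ω ψ : ℝ → ℝ) (hω : IsAveragingWeight ω) (hψ : IsSmoothingKernel ψ) :
    (∃ K : ℕ, 0 < K ∧ SqrtSumsSeparated (-α / β) (1 / β) m K) ∧
    ∀ K : ℕ, 0 < K → SqrtSumsSeparated (-α / β) (1 / β) m K →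
      ∀ δ : ℝ, 0 < δ → ∀ L M : ℝ → ℝ,
        (∀ᶠ T in atTop, 0 < M T) →
        M =O[atTop] (fun T : ℝ => T ^ ((1 - δ) / (K : ℝ))) →
        Tendsto L atTop atTop →
        Tendsto (fun T => L T / √(M T)) atTop (𝓝 0) →
        (Even m →
          (fun T => smoothMoment α β ω ψ m T (L T) (M T) / √(smoothVariance α β ψ (L T) (M T)) ^ m
            - (m ! : ℝ) / (2 ^ (m / 2) * ((m / 2)! : ℝ)))
            =O[atTop] fun T => Real.log (L T) / L T) ∧
        (Odd m →
          (fun T => smoothMoment α β ω ψ m T (L T) (M T) / √(smoothVariance α β ψ (L T) (M T)) ^ m)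
            =O[atTop] fun T => Real.log (L T) / L T) := by
  have hind' := eq_zero_of_aeval_eq_zero hind
  refine ⟨exists_sqrtSumsSeparated (one_div_ne_zero hβ) hind' hdioph m, ?_⟩
  intro K hK hsep δ hδ L M hMpos hM hL hLM
  have hLM1 : ∀ᶠ T in atTop, L T ≤ √(M T) := by
    filter_upwards [hMpos, hLM.eventually (ge_mem_nhds zero_lt_one)] with T h1 h2
    rwa [div_le_one (Real.sqrt_pos.2 h1)] at h2
  obtain ⟨C, hC⟩ := exists_norm_moment_sub_gaussMoment_le hβ hind' hω hψ hK hsep hδ hM hL hLM1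
  obtain ⟨v₀, r₀, L₀, hv₀, hr₀, hvar⟩ := exists_le_mul_smoothVariance α hβ hψ
  -- Both parities at once: `gaussMoment m V = g V^(m/2)`, with `g = 0` for odd `m`. The powers of
  -- `√L` cancel in the quotient, and `V ≥ v₀` controls the denominator.
  have hmain : ∀ g : ℝ, (∀ V : ℝ, 0 < V → gaussMoment m (V : ℂ) = ((g * √V ^ m : ℝ) : ℂ)) →
      (fun T => smoothMoment α β ω ψ m T (L T) (M T) / √(smoothVariance α β ψ (L T) (M T)) ^ m - g)
        =O[atTop] fun T => Real.log (L T) / L T := by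
    intro g hg
    refine IsBigO.of_bound (C / √v₀ ^ m) ?_
    filter_upwards [hC, hMpos, hLM.eventually (ge_mem_nhds hr₀), hL.eventually_ge_atTop L₀,
      hL.eventually_ge_atTop 1] with T hT hMT hr hL0 hL1
    have hl0 : 0 < L T := by linarith
    have hV := hvar (L T) (M T) hL0 hMT hr
    set V := L T * smoothVariance α β ψ (L T) (M T) with hVdef
    have hV0 : 0 < V := hv₀.trans_le hV
    have hsV : 0 < √V := Real.sqrt_pos.2 hV0
    have hsL : 0 < √(L T) := Real.sqrt_pos.2 hl0
    have hsplit : √V = √(L T) * √(smoothVariance α β ψ (L T) (M T)) := Real.sqrt_mul hl0.le _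
    have hne : √(smoothVariance α β ψ (L T) (M T)) ≠ 0 := by
      intro h0
      rw [h0, mul_zero] at hsplit
      exact hsV.ne' hsplit
    rw [hg V hV0, ← Complex.ofReal_sub, Complex.norm_real] at hT
    have e : smoothMoment α β ω ψ m T (L T) (M T) / √(smoothVariance α β ψ (L T) (M T)) ^ m - g =
        (√(L T) ^ m * smoothMoment α β ω ψ m T (L T) (M T) - g * √V ^ m) / √V ^ m := by
      rw [hsplit, mul_pow]; field_simp
    have hlog : 0 ≤ Real.log (L T) / L T := div_nonneg (Real.log_nonneg hL1) hl0.le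
    rw [e, norm_div, norm_pow, Real.norm_of_nonneg hsV.le, Real.norm_of_nonneg hlog,
      div_mul_eq_mul_div]
    have hs0 : 0 < √v₀ := Real.sqrt_pos.2 hv₀
    exact div_le_div₀ ((norm_nonneg _).trans hT) hT (by positivity)
      (pow_le_pow_left₀ hs0.le (Real.sqrt_le_sqrt hV) m)
  refine ⟨fun hm => hmain _ fun V hV => ?_, fun hm => ?_⟩
  · obtain ⟨j, rfl⟩ := hm
    rw [← two_mul, gaussMoment_two_mul, Nat.mul_div_cancel_left j two_pos, pow_mul √V,
      Real.sq_sqrt hV.le]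
    push_cast
    rfl
  · have := hmain 0 fun V _ => by rw [gaussMoment_odd hm]; simp
    simpa using this
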